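/- Fix Newton's constant $G>0$. For $l>0$ and $E>0$ let $$A_E(\tau)=E\tau^4-(4-6E)\tau^2-(8E-8)\tau+4-3E,$$ $$g^{TN}=l^2E\Big[-\frac{\tau^2+1}{A_E(\tau)}\,d\tau^2+\frac{A_E(\tau)}{\tau^2+1}\,\theta_1^2+\frac{\tau^2+1}{4}\,g_{S^2(1)}\Big]$$ be the dS Taub-NUT metric on $\mathbb R\times S^3$, time oriented by $\partial_\tau$. Here $g_{S^2(1)}$ is pulled back by the Hopf map $S^3\to S^2$ and $\theta_1$ is the connection form of the Hopf fibration with period $2\pi$ on the fibres. Write $E_-=\frac23$, $E_+=\frac13(2+\sqrt3)$. *Definitions.* $dS^{\pm}$ (with length scale $l$) is the class of connected, time oriented, globally hyperbolic four-dimensional Lorentzian spacetimes $(M,g)$ with $\mathrm{Ric}_g=\frac{3}{l^2}g$ that have a compact smooth conformal completion whose boundary is spacelike and is the union $\mathcal I^+\cup\mathcal I^-$ of a non-empty future and a non-empty past conformal infinity. Let $g=(l/\rho)^2(-d\rho^2+g_\rho)$ be a geodesic compactification near $\mathcal I^+$, with $g_\rho\sim g_{(0)}+\rho^2g_{(2)}+\rho^3g_{(3)}+\cdots$,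 and let $\gamma=l^2g_{(0)}$ be its boundary metric. The holographic stress-energy tensor is $T=-\frac{3l}{16\pi G}\,g_{(3)}$. The charge of a conformal Killing field $K$ of $(\mathcal I^+,\gamma)$ is $\int_S\langle T(K),\nu\rangle$, where $S$ is a slice to the orbits of $K$ (a surface transverse to $K$ that meets every orbit exactly once, up to finitely many orbits) and $\nu$ is its unit normal in the direction of $K$. If $K$ is a nowhere vanishing Killing field and the integral has the same value for all slices, this charge is called a holographic mass of $(M,g)$. The maximal mass conjecture (of Balasubramanian, de Boer and Minic, for $dS^{\pm}$ in $3+1$ dimensions) says that every holographic mass $m$ of every $(M,g)\in dS^{\pm}$ satisfies $m\le 0=m_0$, the mass of pure de Sitter space. *Theorem.* 1. For $E\in\mathbb R$: $A_E(\tau)>0$ for all $\tau\in\mathbb R$ if and only if $E\in(E_-,E_+)$, and $A_E(\tau)\ge0$ for all $\tau\in\mathbb R$ if and only if $E\in[E_-,E_+]$. 2. For all $l>0$ and $E\in(E_-,E_+)$ the metric $g^{TN}$ is geodesically complete, globally hyperbolic, and lies in $dS^{\pm}$. 3. For $E=1$, $g^{TN}$ is the pure de Sitter metric (the induced metric of the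 hyperboloid $-t^2+|y|^2=l^2$ in Minkowski space $\mathbb R^{1,4}$). It has holographic mass $0$, and in its geodesic compactification with $g_{(0)}$ the round metric of $S^3(1)$ the charge of every conformal Killing field over every slice is $0$. 4. There is a constant $c>0$, independent of $l$ and $E$, such that for all $l>0$ and $E\in(E_-,E_+)$ the holographic mass of $g^{TN}$ is $$m=c\,\frac l2\,E^{1/2}(E-1).$$ Here $g_{(0)}=E\theta_1^2+\frac14g_{S^2(1)}$ on $\mathcal I^+=S^3$, and $K$ is the Killing field that rotates the Hopf fibres, normalised to unit length for $\gamma$. In particular $m>0=m_0$ when $E>1$. 5. For every $l>0$ there is $\varepsilon_0>0$ such that every $m\in(-\varepsilon_0,\varepsilon_0)$ is the holographic mass, as in 4, of some $g^{TN}\in dS^{\pm}$ with $E\in(E_-,E_+)$. 6. Consequently, for every $l>0$ the maximal mass conjecture for $dS^{\pm}$ in $3+1$ dimensions is false. -/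

import Mathlib

set_option maxSynthPendingDepth 3

open Set Filter Topology MeasureTheory
open scoped Manifold ContDiff

noncomputable section

namespace DeSitter

/-! ### Tensor fields, curvature and geodesics in local coordinates -/

section Geometry

variable {E : Type*} [NormedAddCommGroup E] [NormedSpace ℝ E]
  {H : Type*} [TopologicalSpace H] (I : ModelWithCorners ℝ E H)
  (M : Type*) [TopologicalSpace M] [ChartedSpace H M]

/-- A (not necessarily smooth) field of bilinear forms on the tangent spaces of `M`. -/
abbrev BilinField : Type _ :=
  ∀ x : M, TangentSpace I x →L[ℝ] TangentSpace I x →L[ℝ] ℝ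

variable {M}

/-- Smoothness of a field of bilinear forms, as a section of the bundle
`Hom(TM, Hom(TM, ℝ))`. -/
def IsSmoothField [IsManifold I ∞ M] (g : BilinField I M) : Prop :=
  ContMDiff I (I.prod 𝓘(ℝ, E →L[ℝ] E →L[ℝ] ℝ)) ∞
    (fun x ↦ Bundle.TotalSpace.mk' (E →L[ℝ] E →L[ℝ] ℝ)
      (E := fun x : M ↦ TangentSpace I x →L[ℝ] TangentSpace I x →L[ℝ] ℝ) x (g x))

/-- `g` is a smooth Lorentz metric of signature `(-,+,…,+)`: each `g x` is symmetric, and some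
`g`-negative vector has a `g`-positive definite orthogonal complement. -/
def IsLorentzMetric [IsManifold I ∞ M] (g : BilinField I M) : Prop :=
  IsSmoothField I g ∧ ∀ x : M, (∀ u v : TangentSpace I x, g x u v = g x v u) ∧
    ∃ v : TangentSpace I x, g x v v < 0 ∧
      ∀ w : TangentSpace I x, g x v w = 0 → w ≠ 0 → 0 < g x w w

/-- The metric in the chart `e`, as a function on the model vector space
(meaningful on the target of the chart). -/
def localMetric (g : BilinField I M) (e : OpenPartialHomeomorph M H) (y : E) :
    E →L[ℝ] E →L[ℝ] ℝ :=
  let A : E →L[ℝ] E := mfderiv 𝓘(ℝ, E) I (e.extend I).symm y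
  let B : E →L[ℝ] E →L[ℝ] ℝ := g ((e.extend I).symm y)
  B.bilinearComp A A

end Geometry

section Curvature

variable {E : Type*} [NormedAddCommGroup E] [NormedSpace ℝ E]

/-- Christoffel symbols of the first kind,
`(u, v, w) ↦ ½ (∂_u G(v,w) + ∂_v G(u,w) - ∂_w G(u,v))`. -/
def christoffelFirst (G : E → E →L[ℝ] E →L[ℝ] ℝ) (y : E) : E →L[ℝ] E →L[ℝ] E →L[ℝ] ℝ :=
  let D : E →L[ℝ] E →L[ℝ] E →L[ℝ] ℝ := fderiv ℝ G y
  let flip₁ : (E →L[ℝ] E →L[ℝ] ℝ) →L[ℝ] (E →L[ℝ] E →L[ℝ] ℝ) :=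
    (ContinuousLinearMap.flipₗᵢ ℝ E E ℝ).toContinuousLinearEquiv.toContinuousLinearMap
  let D₂ : E →L[ℝ] E →L[ℝ] E →L[ℝ] ℝ := D.flip
  (1 / 2 : ℝ) • (D + D₂ - flip₁ ∘L D₂)

theorem christoffelFirst_apply (G : E → E →L[ℝ] E →L[ℝ] ℝ) (y u v w : E) :
    christoffelFirst G y u v w =
      1 / 2 * (fderiv ℝ G y u v w + fderiv ℝ G y v u w - fderiv ℝ G y w u v) := by
  simp [christoffelFirst]

/-- Christoffel symbols of the second kind: `Γ(u, v)` is the vector with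
`G(Γ(u, v), w) = christoffelFirst u v w` for all `w`. -/
def christoffel (G : E → E →L[ℝ] E →L[ℝ] ℝ) (y : E) : E →L[ℝ] E →L[ℝ] E :=
  (ContinuousLinearMap.compL ℝ E (E →L[ℝ] ℝ) E (G y).inverse) ∘L christoffelFirst G y

theorem christoffel_apply (G : E → E →L[ℝ] E →L[ℝ] ℝ) (y u v : E) :
    christoffel G y u v = (G y).inverse (christoffelFirst G y u v) := by
  simp [christoffel]

/-- For fixed `u`, `v`, the linear map `w ↦ R(w, u) v`, where `R` is the Riemann curvature tensor
`R(w, u) v = ∇_w ∇_u v - ∇_u ∇_w v` on constant vector fields. -/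
def curvature (G : E → E →L[ℝ] E →L[ℝ] ℝ) (y u v : E) : E →L[ℝ] E :=
  let Γ := christoffel G y
  let D : E →L[ℝ] E →L[ℝ] E →L[ℝ] E := fderiv ℝ (christoffel G) y
  (D.flip u).flip v - (D u).flip v + Γ.flip (Γ u v) - (Γ u) ∘L (Γ.flip v)

theorem curvature_apply (G : E → E →L[ℝ] E →L[ℝ] ℝ) (y u v w : E) :
    curvature G y u v w =
      fderiv ℝ (christoffel G) y w u v - fderiv ℝ (christoffel G) y u w v
        + christoffel G y w (christoffel G y u v) - christoffel G y u (christoffel G y w v) := by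
  simp [curvature]

/-- The Ricci tensor `Ric(u, v) = tr (w ↦ R(w, u) v)`. -/
def ricci (G : E → E →L[ℝ] E →L[ℝ] ℝ) (y u v : E) : ℝ :=
  LinearMap.trace ℝ E (curvature G y u v : E →ₗ[ℝ] E)

end Curvature

section Einstein

variable {E : Type*} [NormedAddCommGroup E] [NormedSpace ℝ E]
  {H : Type*} [TopologicalSpace H] (I : ModelWithCorners ℝ E H)
  {M : Type*} [TopologicalSpace M] [ChartedSpace H M]

/-- `Ric = Λ g` on `M`, verified at each point in a smooth chart around it (the Ricci tensor is a
tensor, so the chart is immaterial). In dimension four this is the vacuum Einstein equation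
`Ric - (R/2) g + Λ g = 0`. -/
def IsEinstein (g : BilinField I M) (Λ : ℝ) : Prop :=
  ∀ x : M, ∃ e ∈ IsManifold.maximalAtlas I ∞ M, x ∈ e.source ∧ ∀ u v : E,
    ricci (localMetric I g e) (e.extend I x) u v
      = Λ * localMetric I g e (e.extend I x) u v

/-- `c : ℝ → M` is an (affinely parametrised) geodesic: `c'' + Γ(c', c') = 0` at each parameter, in
a smooth chart around the point (again the chart is immaterial). -/
def IsGeodesic (g : BilinField I M) (c : ℝ → M) : Prop :=
  ContMDiff 𝓘(ℝ, ℝ) I 2 c ∧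
    ∀ t : ℝ, ∃ e ∈ IsManifold.maximalAtlas I ∞ M, c t ∈ e.source ∧
      let x : ℝ → E := fun s ↦ e.extend I (c s)
      deriv (deriv x) t + christoffel (localMetric I g e) (x t) (deriv x t) (deriv x t) = 0

/-- Geodesic completeness: every initial vector (timelike, null or spacelike) is the velocity at
parameter `0` of a geodesic defined on all of `ℝ`. -/
def IsGeodesicallyComplete (g : BilinField I M) : Prop :=
  ∀ V : TangentBundle I M, ∃ c : ℝ → M, IsGeodesic I g c ∧
    (⟨c 0, mfderiv 𝓘(ℝ, ℝ) I c 0 (1 : ℝ)⟩ : TangentBundle I M) = V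

/-! ### Causality -/

/-- `T` is a time orientation: a smooth, everywhere timelike vector field (pointing to the
future). -/
def IsTimeOrientation [IsManifold I ∞ M] (g : BilinField I M) (T : ∀ x : M, TangentSpace I x) : Prop :=
  ContMDiff I I.tangent ∞ (fun x ↦ (⟨x, T x⟩ : TangentBundle I M)) ∧ ∀ x, g x (T x) (T x) < 0

/-- `C¹` future directed causal curves, parametrised by `ℝ`. -/
def IsFutureCausalCurve (g : BilinField I M) (T : ∀ x : M, TangentSpace I x) (c : ℝ → M) : Prop :=
  ContMDiff 𝓘(ℝ, ℝ) I 1 c ∧ ∀ t : ℝ,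
    let V : TangentSpace I (c t) := mfderiv 𝓘(ℝ, ℝ) I c t (1 : ℝ)
    V ≠ 0 ∧ g (c t) V V ≤ 0 ∧ g (c t) (T (c t)) V < 0

/-- The curve has no future endpoint. -/
def IsFutureInextendible (c : ℝ → M) : Prop := ¬ ∃ p : M, Tendsto c atTop (𝓝 p)

/-- The curve has no past endpoint. -/
def IsPastInextendible (c : ℝ → M) : Prop := ¬ ∃ p : M, Tendsto c atBot (𝓝 p)

/-- Global hyperbolicity: there is a Cauchy surface, a set that every inextendible causal curve
meets exactly once. -/
def IsGloballyHyperbolic (g : BilinField I M) (T : ∀ x : M, TangentSpace I x) : Prop :=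
  ∃ C : Set M, ∀ c : ℝ → M, IsFutureCausalCurve I g T c → IsFutureInextendible c →
    IsPastInextendible c → ∃! t : ℝ, c t ∈ C

end Einstein

/-! ### Four-dimensional spacetimes and conformal infinity -/

/-- `ℝ³`. -/
abbrev E3 := EuclideanSpace ℝ (Fin 3)

/-- `ℝ⁴`. -/
abbrev E4 := EuclideanSpace ℝ (Fin 4)

/-- The model of four-manifolds without boundary: `ℝ × ℝ³`. -/
abbrev H4 := ModelProd ℝ E3

/-- The model with corners on `ℝ × ℝ³`. -/
abbrev I4 : ModelWithCorners ℝ (ℝ × E3) H4 := 𝓘(ℝ, ℝ).prod (𝓡 3)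

/-- The model of four-manifolds with boundary: `[0, ∞) × ℝ³`. -/
abbrev HB4 := ModelProd (EuclideanHalfSpace 1) E3

/-- The model with corners on `[0, ∞) × ℝ³`. -/
abbrev IB4 : ModelWithCorners ℝ (EuclideanSpace ℝ (Fin 1) × E3) HB4 := (𝓡∂ 1).prod (𝓡 3)

section Spacetime

variable {M : Type} [TopologicalSpace M] [ChartedSpace H4 M]

/-- `(M, g)`, time oriented by `T`, is a (connected) spacetime solving the vacuum Einstein equations
with cosmological constant `Λ = 3 / l²`. -/
structure IsDeSitterSpacetime [IsManifold I4 ∞ M] (l : ℝ) (g : BilinField I4 M)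
    (T : ∀ x : M, TangentSpace I4 x) : Prop where
  t2 : T2Space M
  secondCountable : SecondCountableTopology M
  connected : ConnectedSpace M
  lorentz : IsLorentzMetric I4 g
  timeOrientation : IsTimeOrientation I4 g T
  einstein : IsEinstein I4 g (3 / l ^ 2)

/-- `ι : M → N` embeds `(M, g)` as the interior of the manifold with boundary `N`, `Ω` is a
defining function of the boundary, and `Ω² g` extends to the smooth Lorentz metric `gbar` on `N`,
for which the boundary is spacelike. -/
structure IsConformalCompletion {N : Type} [TopologicalSpace N] [ChartedSpace HB4 N]
    [IsManifold IB4 ∞ N] (g : BilinField I4 M) (ι : M → N) (Ω : N → ℝ)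
    (gbar : BilinField IB4 N) : Prop where
  smooth_embedding : ContMDiff I4 IB4 ∞ ι
  isOpenEmbedding : IsOpenEmbedding ι
  range_eq : range ι = IB4.interior N
  bijective_deriv : ∀ p : M, Function.Bijective (mfderiv I4 IB4 ι p)
  smooth_defining : ContMDiff IB4 𝓘(ℝ, ℝ) ∞ Ω
  defining_pos : ∀ q ∈ IB4.interior N, 0 < Ω q
  defining_zero : ∀ q ∈ IB4.boundary N, Ω q = 0
  defining_deriv : ∀ q ∈ IB4.boundary N, mvfderiv IB4 Ω q ≠ 0
  lorentz : IsLorentzMetric IB4 gbar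
  conformal : ∀ (p : M) (u v : TangentSpace I4 p),
    gbar (ι p) (mfderiv I4 IB4 ι p u) (mfderiv I4 IB4 ι p v) = Ω (ι p) ^ 2 * g p u v
  spacelike : ∀ q ∈ IB4.boundary N, ∀ v : TangentSpace IB4 q,
    mvfderiv IB4 Ω q v = 0 → v ≠ 0 → 0 < gbar q v v

/-- Future conformal infinity `𝓘⁺`: the boundary points near which the defining function decreases
towards the future. -/
def scriPlus {N : Type} [TopologicalSpace N] [ChartedSpace HB4 N]
    (T : ∀ x : M, TangentSpace I4 x) (ι : M → N) (Ω : N → ℝ) : Set N :=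
  {q | q ∈ IB4.boundary N ∧
    ∀ᶠ p in comap ι (𝓝 q), mvfderiv I4 (fun x ↦ Ω (ι x)) p (T p) < 0}

/-- Past conformal infinity `𝓘⁻`: the boundary points near which the defining function increases
towards the future. -/
def scriMinus {N : Type} [TopologicalSpace N] [ChartedSpace HB4 N]
    (T : ∀ x : M, TangentSpace I4 x) (ι : M → N) (Ω : N → ℝ) : Set N :=
  {q | q ∈ IB4.boundary N ∧
    ∀ᶠ p in comap ι (𝓝 q), 0 < mvfderiv I4 (fun x ↦ Ω (ι x)) p (T p)}

/-- The class `dS^±`, with length scale `l`: globally hyperbolic de Sitter spacetimes that have a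
compact conformal completion whose boundary is the union of a non-empty future and a non-empty past
conformal infinity. -/
def IsDSpm [IsManifold I4 ∞ M] (l : ℝ) (g : BilinField I4 M)
    (T : ∀ x : M, TangentSpace I4 x) : Prop :=
  IsDeSitterSpacetime l g T ∧ IsGloballyHyperbolic I4 g T ∧
    ∃ (N : Type) (_ : TopologicalSpace N) (_ : ChartedSpace HB4 N) (_ : IsManifold IB4 ∞ N)
      (ι : M → N) (Ω : N → ℝ) (gbar : BilinField IB4 N),
      CompactSpace N ∧ T2Space N ∧ IsConformalCompletion g ι Ω gbar ∧
        scriPlus T ι Ω ∪ scriMinus T ι Ω = IB4.boundary N ∧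
        (scriPlus T ι Ω).Nonempty ∧ (scriMinus T ι Ω).Nonempty

/-! ### Geodesic compactifications at future infinity -/

variable {S : Type} [TopologicalSpace S] [ChartedSpace E3 S]

/-- A geodesic compactification of `(M, g)` at `𝓘⁺ = S`. The map `Ψ` identifies `(0, ε) × S` with
a neighbourhood of future infinity, `Ψ^* g = (l/ρ)² (-dρ² + h_ρ)` there, the `h_ρ` are Riemannian
metrics on `S`, smooth up to `ρ = 0`, and `∂_ρ` is past directed. The last field says that all of
future infinity is covered: every causal curve without future endpoint ends up in each
`Ψ ((0, δ) × S)`. -/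
structure IsFutureCollar [IsManifold (𝓡 3) ∞ S] (l : ℝ) (g : BilinField I4 M)
    (T : ∀ x : M, TangentSpace I4 x) (ε : ℝ) (Ψ : ℝ × S → M) (h : ℝ → BilinField (𝓡 3) S) :
    Prop where
  pos : 0 < ε
  smooth : ContMDiffOn I4 I4 ∞ Ψ (Ioo 0 ε ×ˢ univ)
  injOn : InjOn Ψ (Ioo 0 ε ×ˢ univ)
  smooth_family : ContMDiffOn I4 ((𝓡 3).prod 𝓘(ℝ, E3 →L[ℝ] E3 →L[ℝ] ℝ)) ∞
    (fun p : ℝ × S ↦ Bundle.TotalSpace.mk' (E3 →L[ℝ] E3 →L[ℝ] ℝ)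
      (E := fun x : S ↦ TangentSpace (𝓡 3) x →L[ℝ] TangentSpace (𝓡 3) x →L[ℝ] ℝ)
      p.2 (h p.1 p.2)) (Ico 0 ε ×ˢ univ)
  symm : ∀ ρ ∈ Ico 0 ε, ∀ (x : S) (u v : TangentSpace (𝓡 3) x), h ρ x u v = h ρ x v u
  posDef : ∀ ρ ∈ Ico 0 ε, ∀ (x : S) (u : TangentSpace (𝓡 3) x), u ≠ 0 → 0 < h ρ x u u
  pullback : ∀ ρ ∈ Ioo 0 ε, ∀ (x : S) (U V : TangentSpace I4 ((ρ, x) : ℝ × S)),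
    g (Ψ (ρ, x)) (mfderiv I4 I4 Ψ (ρ, x) U) (mfderiv I4 I4 Ψ (ρ, x) V) =
      (l / ρ) ^ 2 *
        (-(mvfderiv I4 (Prod.fst : ℝ × S → ℝ) (ρ, x) U *
            mvfderiv I4 (Prod.fst : ℝ × S → ℝ) (ρ, x) V)
          + h ρ x (mfderiv I4 (𝓡 3) (Prod.snd : ℝ × S → S) (ρ, x) U)
              (mfderiv I4 (𝓡 3) (Prod.snd : ℝ × S → S) (ρ, x) V))
  past : ∀ ρ ∈ Ioo 0 ε, ∀ x : S,
    0 < g (Ψ (ρ, x)) (T (Ψ (ρ, x)))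
      (mfderiv I4 I4 Ψ (ρ, x) (((1 : ℝ), (0 : E3)) : TangentSpace I4 ((ρ, x) : ℝ × S)))
  exhausts : ∀ c : ℝ → M, IsFutureCausalCurve I4 g T c → IsFutureInextendible c →
    ∀ δ ∈ Ioc 0 ε, ∀ᶠ t in atTop, c t ∈ Ψ '' (Ioo 0 δ ×ˢ univ)

/-! ### Holographic stress-energy tensor and conserved quantities -/

/-- The boundary metric `γ = l² h_0` of the compactification `ρ² g = l² (-dρ² + h_ρ)`. -/
def boundaryMetric (l : ℝ) (h : ℝ → BilinField (𝓡 3) S) : BilinField (𝓡 3) S :=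
  fun x ↦ l ^ 2 • h 0 x

/-- The coefficient `g_(3)` of `ρ³` in the expansion of `h_ρ` at `ρ = 0`. -/
def coeffThree (h : ℝ → BilinField (𝓡 3) S) (x : S) (u v : TangentSpace (𝓡 3) x) : ℝ :=
  iteratedDerivWithin 3 (fun ρ ↦ h ρ x u v) (Ici 0) 0 / 6

/-- The holographic stress-energy tensor `-(3 l / 16πG) g_(3)` of four-dimensional asymptotically
de Sitter spacetimes (equal to `-(3 / 16πG) g_(3)` in the scale `l = 1`). -/
def stressEnergy (G l : ℝ) (h : ℝ → BilinField (𝓡 3) S) (x : S)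
    (u v : TangentSpace (𝓡 3) x) : ℝ :=
  -(3 * l / (16 * Real.pi * G)) * coeffThree h x u v

/-- `K` is a conformal Killing field of `γ`, with flow `φ`. -/
structure IsConformalKilling (γ : BilinField (𝓡 3) S) (K : ∀ x : S, TangentSpace (𝓡 3) x)
    (φ : ℝ → S → S) : Prop where
  smooth : ContMDiff I4 (𝓡 3) ∞ (fun p : ℝ × S ↦ φ p.1 p.2)
  zero : ∀ x, φ 0 x = x
  add : ∀ s t x, φ (s + t) x = φ s (φ t x)
  velocity : ∀ x, IsMIntegralCurve (I := 𝓡 3) (fun t ↦ φ t x) K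
  conformal : ∀ t x, ∃ f : ℝ, 0 < f ∧ ∀ u v : TangentSpace (𝓡 3) x,
    γ (φ t x) (mfderiv (𝓡 3) (𝓡 3) (φ t) x u) (mfderiv (𝓡 3) (𝓡 3) (φ t) x v) = f * γ x u v

/-- `K` is a Killing field of `γ`, with flow `φ`. -/
structure IsKilling (γ : BilinField (𝓡 3) S) (K : ∀ x : S, TangentSpace (𝓡 3) x)
    (φ : ℝ → S → S) : Prop extends IsConformalKilling γ K φ where
  isometric : ∀ t x, ∀ u v : TangentSpace (𝓡 3) x,
    γ (φ t x) (mfderiv (𝓡 3) (𝓡 3) (φ t) x u) (mfderiv (𝓡 3) (𝓡 3) (φ t) x v) = γ x u v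

/-- The parameter plane of slices. -/
abbrev E2 := EuclideanSpace ℝ (Fin 2)

/-- The `i`-th coordinate tangent vector of a parametrised surface. -/
def coordVec (σ : E2 → S) (y : E2) (i : Fin 2) : TangentSpace (𝓡 3) (σ y) :=
  mfderiv 𝓘(ℝ, E2) (𝓡 3) σ y (EuclideanSpace.single i (1 : ℝ))

/-- `σ : U → S` parametrises a slice to the orbits of `K`, with unit normal `ν` in the direction
of `K`: a smooth surface transverse to `K` that meets every orbit exactly once, up to finitely many
orbits (a nontrivial circle bundle, and a closed surface in one chart, leave no choice). -/
structure IsSlice (γ : BilinField (𝓡 3) S) (K : ∀ x : S, TangentSpace (𝓡 3) x) (φ : ℝ → S → S)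
    (U : Set E2) (σ : E2 → S) (ν : ∀ y : E2, TangentSpace (𝓡 3) (σ y)) : Prop where
  isOpen : IsOpen U
  smooth : ContMDiffOn 𝓘(ℝ, E2) (𝓡 3) ∞ σ U
  transverse : ∀ y ∈ U, LinearIndependent ℝ ![coordVec σ y 0, coordVec σ y 1, K (σ y)]
  once : ∀ y ∈ U, ∀ y' ∈ U, ∀ t : ℝ, φ t (σ y) = σ y' → y = y'
  covers : ∃ F : Set S, F.Finite ∧
    ∀ x, (∀ p ∈ F, ∀ t : ℝ, φ t p ≠ x) → ∃ y ∈ U, ∃ t : ℝ, φ t (σ y) = x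
  normal : ∀ y ∈ U, ∀ i, γ (σ y) (ν y) (coordVec σ y i) = 0
  unit : ∀ y ∈ U, γ (σ y) (ν y) (ν y) = 1
  direction : ∀ y ∈ U, 0 < γ (σ y) (ν y) (K (σ y))

/-- The area density of a parametrised surface with respect to `γ`. -/
def areaDensity (γ : BilinField (𝓡 3) S) (σ : E2 → S) (y : E2) : ℝ :=
  Real.sqrt (γ (σ y) (coordVec σ y 0) (coordVec σ y 0) * γ (σ y) (coordVec σ y 1) (coordVec σ y 1)
    - γ (σ y) (coordVec σ y 0) (coordVec σ y 1) ^ 2)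

/-- The integrand of `∫ ⟨T(K), ν⟩ dA` in the parameter domain of a slice. -/
def chargeDensity (G l : ℝ) (h : ℝ → BilinField (𝓡 3) S) (K : ∀ x : S, TangentSpace (𝓡 3) x)
    (σ : E2 → S) (ν : ∀ y : E2, TangentSpace (𝓡 3) (σ y)) (y : E2) : ℝ :=
  stressEnergy G l h (σ y) (K (σ y)) (ν y) * areaDensity (boundaryMetric l h) σ y

/-- The conserved quantity `∫ ⟨T(K), ν⟩ dA` of the (conformal) Killing field `K` equals `m`: slices
exist, and over each of them the integral converges and has the value `m`. -/
def HasCharge (G l : ℝ) (h : ℝ → BilinField (𝓡 3) S) (K : ∀ x : S, TangentSpace (𝓡 3) x)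
    (φ : ℝ → S → S) (m : ℝ) : Prop :=
  (∃ U σ ν, IsSlice (boundaryMetric l h) K φ U σ ν) ∧
    ∀ U σ ν, IsSlice (boundaryMetric l h) K φ U σ ν →
      IntegrableOn (chargeDensity G l h K σ ν) U ∧ ∫ y in U, chargeDensity G l h K σ ν y = m

/-- `m` is a holographic mass of `(M, g)` at `𝓘⁺`: the conserved quantity of a nowhere vanishing
(static or stationary) Killing field of a boundary metric on the compact manifold `𝓘⁺`. -/
def HasHolographicMass (G l : ℝ) (g : BilinField I4 M) (T : ∀ x : M, TangentSpace I4 x) (m : ℝ) :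
    Prop :=
  ∃ (S : Type) (_ : TopologicalSpace S) (_ : ChartedSpace E3 S) (_ : IsManifold (𝓡 3) ∞ S)
    (_ : CompactSpace S) (_ : T2Space S)
    (ε : ℝ) (Ψ : ℝ × S → M) (h : ℝ → BilinField (𝓡 3) S) (K : ∀ x : S, TangentSpace (𝓡 3) x)
    (φ : ℝ → S → S),
    IsFutureCollar l g T ε Ψ h ∧ IsKilling (boundaryMetric l h) K φ ∧ (∀ x, K x ≠ 0) ∧
      HasCharge G l h K φ m

end Spacetime

/-- The maximal mass conjecture for `dS^±` in `3+1` dimensions, with Newton constant `G` and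
length scale `l`: no spacetime in `dS^±` has a mass above that of pure de Sitter space, which is
`0`. -/
def MaximalMassConjecture (G l : ℝ) : Prop :=
  ∀ (M : Type) [TopologicalSpace M] [ChartedSpace H4 M] [IsManifold I4 ∞ M]
    (g : BilinField I4 M) (T : ∀ x : M, TangentSpace I4 x),
    IsDSpm l g T → ∀ m : ℝ, HasHolographicMass G l g T m → m ≤ 0

/-! ### The de Sitter Taub-NUT metrics on `ℝ × S³` -/

/-- The unit sphere in `ℝ⁴`. -/
abbrev S3 := Metric.sphere (0 : E4) 1

/-- Multiplication by `i` on `ℝ⁴ = ℂ²`; `hopfRot x` is the unit tangent vector of the Hopf fibre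
through `x ∈ S³`. -/
def hopfRot (x : E4) : E4 := !₂[-x 1, x 0, -x 3, x 2]

/-- The Hopf map `(z, w) ↦ (2 z w̄, |z|² - |w|²)`, which maps `S³` to the unit sphere `S²`. -/
def hopfMap (x : E4) : E3 :=
  !₂[2 * (x 0 * x 2 + x 1 * x 3), 2 * (x 1 * x 2 - x 0 * x 3),
    x 0 ^ 2 + x 1 ^ 2 - x 2 ^ 2 - x 3 ^ 2]

/-- `θ₁ ⊗ θ₁` on `ℝ⁴`, at `x`, where `θ₁ = ⟨hopfRot x, ·⟩` is the connection form of the Hopf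
fibration that has period `2π` on the fibres. -/
def thetaSq (x : E4) : E4 →L[ℝ] E4 →L[ℝ] ℝ :=
  (innerSL ℝ (hopfRot x)).smulRight (innerSL ℝ (hopfRot x))

/-- The pullback of `g_{S²(1)}` under the Hopf map, at `x`. -/
def hopfBase (x : E4) : E4 →L[ℝ] E4 →L[ℝ] ℝ :=
  (innerSL ℝ : E3 →L[ℝ] E3 →L[ℝ] ℝ).bilinearComp (fderiv ℝ hopfMap x) (fderiv ℝ hopfMap x)

/-- The function `A(τ)`. -/
def taubNUTPoly (E τ : ℝ) : ℝ :=
  E * τ ^ 4 - (4 - 6 * E) * τ ^ 2 - (8 * E - 8) * τ + 4 - 3 * E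

/-- The pullback `(u, v) ↦ B (D u) (D v)` of a bilinear form under a linear map. -/
def pullBilin {V F : Type*} [AddCommGroup V] [Module ℝ V] [TopologicalSpace V]
    [IsTopologicalAddGroup V] [ContinuousSMul ℝ V] [NormedAddCommGroup F] [NormedSpace ℝ F]
    (D : V →L[ℝ] F) (B : F →L[ℝ] F →L[ℝ] ℝ) : V →L[ℝ] V →L[ℝ] ℝ :=
  (ContinuousLinearMap.precomp ℝ D) ∘L (B ∘L D)

theorem pullBilin_apply {V F : Type*} [AddCommGroup V] [Module ℝ V] [TopologicalSpace V]
    [IsTopologicalAddGroup V] [ContinuousSMul ℝ V] [NormedAddCommGroup F] [NormedSpace ℝ F]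
    (D : V →L[ℝ] F) (B : F →L[ℝ] F →L[ℝ] ℝ) (u v : V) :
    pullBilin D B u v = B (D u) (D v) := rfl

/-- The Euclidean inner product of `ℝ⁴`. -/
def euclid4 : E4 →L[ℝ] E4 →L[ℝ] ℝ := innerSL ℝ

/-- The product `(a, b) ↦ a b` on `ℝ`. -/
def mulForm : ℝ →L[ℝ] ℝ →L[ℝ] ℝ := ContinuousLinearMap.mul ℝ ℝ

/-- The dS Taub-NUT metric on `ℝ × S³`,
`l² E (-(τ² + 1) / A(τ) dτ² + A(τ) / (τ² + 1) θ₁² + (τ² + 1) / 4 g_{S²(1)})`. -/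
def taubNUT (l E : ℝ) : BilinField I4 (ℝ × S3) := fun p ↦
  let τ : ℝ := p.1
  let dτ := mvfderiv I4 (Prod.fst : ℝ × S3 → ℝ) p
  let dx := mvfderiv I4 (fun q : ℝ × S3 ↦ (q.2 : E4)) p
  (l ^ 2 * E) • (-((τ ^ 2 + 1) / taubNUTPoly E τ) • pullBilin dτ mulForm
    + (taubNUTPoly E τ / (τ ^ 2 + 1)) • pullBilin dx (thetaSq (p.2 : E4))
    + ((τ ^ 2 + 1) / 4) • pullBilin dx (hopfBase (p.2 : E4)))

/-- The pure de Sitter metric: the metric induced from `-dt² + |dy|²` on the hyperboloid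
`-t² + |y|² = l²` in Minkowski space `ℝ × ℝ⁴`, parametrised by
`(τ, x) ↦ (t, y) = (l τ, l √(1 + τ²) x)`. -/
def deSitterMetric (l : ℝ) : BilinField I4 (ℝ × S3) := fun p ↦
  -pullBilin (mvfderiv I4 (fun q : ℝ × S3 ↦ l * q.1) p) mulForm
    + pullBilin (mvfderiv I4 (fun q : ℝ × S3 ↦ (l * Real.sqrt (1 + q.1 ^ 2)) • (q.2 : E4)) p)
        euclid4

/-- The time orientation `∂_τ` of `ℝ × S³`. -/
def partialTau (p : ℝ × S3) : TangentSpace I4 p := ((1 : ℝ), (0 : E3))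

/-- The Berger sphere metric `E θ₁² + g_{S²(1)} / 4` on `S³`. -/
def bergerMetric (E : ℝ) : BilinField (𝓡 3) S3 := fun x ↦
  let dx := mvfderiv (𝓡 3) (fun q : S3 ↦ (q : E4)) x
  E • pullBilin dx (thetaSq (x : E4)) + (1 / 4 : ℝ) • pullBilin dx (hopfBase (x : E4))

/-- The round metric of the unit sphere `S³`. -/
def roundMetric : BilinField (𝓡 3) S3 := fun x ↦
  pullBilin (mvfderiv (𝓡 3) (fun q : S3 ↦ (q : E4)) x) euclid4

/-- `m` is the holographic mass of the dS Taub-NUT metric: `𝓘⁺ = S³` carries the boundary metric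
`l²` times the Berger metric, and `m` is the conserved quantity of the Killing field `K` that
generates the rotation of the Hopf fibres, normalised to unit length. -/
def HasTaubNUTMass (G l E m : ℝ) : Prop :=
  ∃ (ε : ℝ) (Ψ : ℝ × S3 → ℝ × S3) (h : ℝ → BilinField (𝓡 3) S3)
    (K : ∀ x : S3, TangentSpace (𝓡 3) x) (φ : ℝ → S3 → S3),
    IsFutureCollar l (taubNUT l E) partialTau ε Ψ h ∧
    (∀ ρ ∈ Ioo 0 ε, ∀ x, (Ψ (ρ, x)).2 = x) ∧
    h 0 = bergerMetric E ∧
    IsKilling (boundaryMetric l h) K φ ∧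
    (∀ t x, (φ t x : E4) = Real.cos (t / (l * Real.sqrt E)) • (x : E4)
      + Real.sin (t / (l * Real.sqrt E)) • hopfRot x) ∧
    (∀ x, boundaryMetric l h x (K x) (K x) = 1) ∧
    HasCharge G l h K φ m

end DeSitter

end

open DeSitter

/-!
# The masses of the de Sitter Taub-NUT metrics

For `E = 1` the quartic `A` is `(τ² + 1)²` and `taubNUT l E` is pure de Sitter space. The family is
a deformation of it that keeps two of its symmetries, the rotation of the Hopf fibres of `S³` and
the left translations of `S³ = SU(2)`, and everything about it reduces to functions of `τ`.
The masses come from the coefficient `-(8 E - 8)` of `τ` in `A`, which changes sign at `E = 1`, so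
that they fill a neighbourhood of the mass `0` of de Sitter space.

**Range of the parameter.** `A` is affine in `E`, so for each `τ` its sign between two values of `E`
is controlled by the values there. At `E = 2 / 3` and `E = (2 + √3) / 3` the quartic is a square
with a real zero times a positive quadratic (`taubNUTPoly_lower`, `taubNUTPoly_upper`).

**Smoothness, signature, de Sitter space.** The metrics are restrictions to `ℝ × S³` of the forms
`ambForm` on `ℝ × ℝ⁴`, which depend polynomially on the point of `ℝ⁴` (`taubNUT_eq`). This reduces
these properties to algebra in `ℝ × ℝ⁴` (`isLorentzMetric_taubNUT`, `taubNUT_one`).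

**Einstein equation.** Every point `(τ, x₀)` is the centre `ζ = 0`, `β = 0` of coordinates
`(τ, ζ, β)`, `x = e^{iβ} (x₀ + ζ p) / √(1 + |ζ|²)`, in which the metric does not depend on `x₀`
(`localMetric_prodChart`). It suffices therefore to find the Ricci tensor at `ζ = 0`, for arbitrary
coefficient functions of `τ` (`ricci_locForm`), and to substitute `A` (`isEinstein_taubNUT`).

**Global hyperbolicity.** On a compact range of `τ` the spatial speed of a causal curve is bounded
by a multiple of `dτ/dt`. If `τ` stays bounded along the curve, the curve has finite spatial length,
and has an endpoint since `S³` is complete. On an inextendible causal curve `τ` therefore increases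
from `-∞` to `∞`, and `{τ = 0}` is a Cauchy surface (`isGloballyHyperbolic_taubNUT`).

**Conformal completion.** With `τ = tan s` and the defining function `cos s`, the rescaled metric is
smooth up to `s = ± π / 2`, because the positive function `cos⁴ s A(tan s)` is a polynomial in
`sin s` and `cos s` (`isDSpm_taubNUT`).

**Geodesics.** The conserved momentum of the left translations is an imaginary quaternion. With `J`
the left multiplication by its direction, which commutes with the rotation of the fibres, the
spatial part of a geodesic is `e^{iβ} exp (α J) x₀`, where `α'` and `β'` are functions of `τ`
(`ambient_geodesic_equation`). What remains is a motion of `τ` in a potential, which in terms of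
proper time along the lines `ℝ × {x}` has a globally Lipschitz force and hence exists for all times
(`exists_radial_motion`, `isGeodesicallyComplete_taubNUT`).

**Geodesic compactification.** In `r = 1 / τ` the time part of the metric is `-l² (f dr / r)²` with
`f` smooth and `f = 1 + O(r²)`. So `ρ = (r / √E) exp ∫ (f - 1) / r` is a smooth function of `r`,
with `dρ / ρ = f dr / r` (`exists_futureCollar`). The coefficients of `h_ρ` have derivatives of the
form `r m(r)` in `r`, and their third derivatives in `ρ` at `0` only see `m'(0)`, which is a
multiple of `E - 1` (`coeffThree_collarFamily`). For `E = 1` the third order coefficient vanishes,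
and with it all charges.

**Mass.** If `K` rotates the fibres, then `T(K, ·) = (E - 1) √E / (π G l) · γ(K, ·)`
(`stressEnergy_hopfField`), so the charge is a multiple of the flux of `K`. The flux through a slice
is the area of the projection of the slice to the base `S²` of the Hopf fibration, which covers `S²`
exactly once up to finitely many points. The change of variables to the coordinate `z / w` of the
fibre of `(z, w)` makes this precise (`flux_density`, `integral_flux`); the result does not depend
on the slice (`hasTaubNUTMass`). The mass is continuous in `E` and changes sign at `E = 1`, which
gives all small masses by the intermediate value theorem (`exists_taubNUT_of_mass`) and positive
ones (`not_maximalMassConjecture`).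
-/

noncomputable section

namespace DeSitter

/-! ### The Hopf fibration in coordinates -/

theorem inner_eq4 (u v : E4) : inner ℝ u v = u 0 * v 0 + u 1 * v 1 + u 2 * v 2 + u 3 * v 3 := by
  simp [PiLp.inner_apply, Fin.sum_univ_four, mul_comm]

theorem inner_eq3 (u v : E3) : inner ℝ u v = u 0 * v 0 + u 1 * v 1 + u 2 * v 2 := by
  simp [PiLp.inner_apply, Fin.sum_univ_three, mul_comm]

/-- Multiplication by `i` on `ℂ² = ℝ⁴` as a continuous linear map. -/
def hopfRotL : E4 →L[ℝ] E4 :=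
  LinearMap.toContinuousLinearMap
    { toFun := hopfRot
      map_add' := fun x y ↦ by ext i; fin_cases i <;> simp [hopfRot] <;> ring
      map_smul' := fun c x ↦ by ext i; fin_cases i <;> simp [hopfRot] }

@[simp] theorem hopfRotL_apply (x : E4) : hopfRotL x = hopfRot x := rfl

theorem hopfRot_add (x y : E4) : hopfRot (x + y) = hopfRot x + hopfRot y := hopfRotL.map_add x y

theorem hopfRot_smul (c : ℝ) (x : E4) : hopfRot (c • x) = c • hopfRot x := hopfRotL.map_smul c x

theorem hopfRot_hopfRot (x : E4) : hopfRot (hopfRot x) = -x := by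
  ext i; fin_cases i <;> simp [hopfRot]

theorem inner_hopfRot_self (x : E4) : inner ℝ (hopfRot x) x = 0 := by
  simp [inner_eq4, hopfRot]; ring

theorem inner_hopfRot_hopfRot (x y : E4) :
    inner ℝ (hopfRot x) (hopfRot y) = inner ℝ x y := by
  simp [inner_eq4, hopfRot]; ring

theorem inner_hopfRot_comm (x y : E4) : inner ℝ (hopfRot x) y = -inner ℝ x (hopfRot y) := by
  simp [inner_eq4, hopfRot]; ring

theorem contDiff_hopfMap : ContDiff ℝ ∞ hopfMap := by
  unfold hopfMap
  refine contDiff_euclidean.2 fun i ↦ ?_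
  fin_cases i <;> simp <;> fun_prop

theorem fderiv_hopfMap_apply (x u : E4) :
    fderiv ℝ hopfMap x u =
      !₂[2 * (u 0 * x 2 + x 0 * u 2 + u 1 * x 3 + x 1 * u 3),
        2 * (u 1 * x 2 + x 1 * u 2 - u 0 * x 3 - x 0 * u 3),
        2 * (x 0 * u 0 + x 1 * u 1 - x 2 * u 2 - x 3 * u 3)] := by
  have h : HasDerivAt (fun t : ℝ ↦ hopfMap (x + t • u)) (fderiv ℝ hopfMap x u) 0 := by
    have h1 : HasFDerivAt hopfMap (fderiv ℝ hopfMap x) (x + (0 : ℝ) • u) := by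
      simpa using (contDiff_hopfMap.differentiable (by simp) x).hasFDerivAt
    have h2 : HasDerivAt (fun t : ℝ ↦ x + t • u) u 0 := by
      simpa using ((hasDerivAt_id (0 : ℝ)).smul_const u).const_add x
    exact h1.comp_hasDerivAt (0 : ℝ) h2
  have c (i : Fin 4) : HasDerivAt (fun t : ℝ ↦ x i + t * u i) (u i) 0 := by
    simpa using ((hasDerivAt_id (0 : ℝ)).mul_const (u i)).const_add (x i)
  ext i
  have hi : HasDerivAt (fun t : ℝ ↦ hopfMap (x + t • u) i) (fderiv ℝ hopfMap x u i) 0 :=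
    (EuclideanSpace.proj (𝕜 := ℝ) i).hasFDerivAt.comp_hasDerivAt (0 : ℝ) h
  fin_cases i
  · refine hi.unique ?_
    simp only [hopfMap]
    refine HasDerivAt.congr_deriv ((((c 0).mul (c 2)).add ((c 1).mul (c 3))).const_mul 2) ?_
    simp; ring
  · refine hi.unique ?_
    simp only [hopfMap]
    refine HasDerivAt.congr_deriv ((((c 1).mul (c 2)).sub ((c 0).mul (c 3))).const_mul 2) ?_
    simp; ring
  · refine hi.unique ?_
    simp only [hopfMap]
    refine HasDerivAt.congr_deriv
      (((((c 0).pow 2).add ((c 1).pow 2)).sub ((c 2).pow 2)).sub ((c 3).pow 2)) ?_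
    simp; ring

theorem thetaSq_apply (x u v : E4) :
    thetaSq x u v = inner ℝ (hopfRot x) u * inner ℝ (hopfRot x) v := by
  simp [thetaSq]

/-- Off the unit sphere, too, the pullback of the metric of `S²` is the Euclidean metric with the
fibre direction projected out. -/
theorem hopfBase_apply (x u v : E4) :
    hopfBase x u v = 4 * (inner ℝ x x * inner ℝ u v
      - inner ℝ (hopfRot x) u * inner ℝ (hopfRot x) v) := by
  simp only [hopfBase, ContinuousLinearMap.bilinearComp_apply, innerSL_apply_apply,
    fderiv_hopfMap_apply, inner_eq3, inner_eq4, hopfRot]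
  simp
  ring

/-! ### Ambient bilinear forms -/

/-- The form `-a dτ² + b θ₁² + (c / 4) g_{S²}` on `ℝ × ℝ⁴`, at a point with second component `x`. -/
def ambForm (a b c : ℝ) (x : E4) : (ℝ × E4) →L[ℝ] (ℝ × E4) →L[ℝ] ℝ :=
  (-a) • pullBilin (ContinuousLinearMap.fst ℝ ℝ E4) mulForm
    + b • pullBilin (ContinuousLinearMap.snd ℝ ℝ E4) (thetaSq x)
    + (c / 4) • pullBilin (ContinuousLinearMap.snd ℝ ℝ E4) (hopfBase x)

theorem ambForm_apply (a b c : ℝ) (x : E4) (u v : ℝ × E4) :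
    ambForm a b c x u v = -a * (u.1 * v.1)
      + b * (inner ℝ (hopfRot x) u.2 * inner ℝ (hopfRot x) v.2)
      + c * (inner ℝ x x * inner ℝ u.2 v.2
          - inner ℝ (hopfRot x) u.2 * inner ℝ (hopfRot x) v.2) := by
  simp [ambForm, pullBilin_apply, thetaSq_apply, hopfBase_apply, mulForm]
  ring

theorem contDiff_thetaSq : ContDiff ℝ ∞ thetaSq := by
  rw [contDiff_clm_apply_iff]
  intro u
  rw [contDiff_clm_apply_iff]
  intro v
  have h : ContDiff ℝ ∞ hopfRot := hopfRotL.contDiff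
  simp only [thetaSq_apply]
  exact (h.inner ℝ contDiff_const).mul (h.inner ℝ contDiff_const)

theorem contDiff_hopfBase : ContDiff ℝ ∞ hopfBase := by
  rw [contDiff_clm_apply_iff]
  intro u
  rw [contDiff_clm_apply_iff]
  intro v
  have h : ContDiff ℝ ∞ hopfRot := hopfRotL.contDiff
  simp only [hopfBase_apply]
  exact contDiff_const.mul (((contDiff_id.inner ℝ contDiff_id).mul contDiff_const).sub
    ((h.inner ℝ contDiff_const).mul (h.inner ℝ contDiff_const)))

theorem contDiff_ambForm :
    ContDiff ℝ ∞ fun p : ℝ × ℝ × ℝ × E4 ↦ ambForm p.1 p.2.1 p.2.2.1 p.2.2.2 := by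
  rw [contDiff_clm_apply_iff]
  intro u
  rw [contDiff_clm_apply_iff]
  intro v
  have h : ContDiff ℝ ∞ fun p : ℝ × ℝ × ℝ × E4 ↦ hopfRot p.2.2.2 :=
    hopfRotL.contDiff.comp (by fun_prop)
  have hx : ContDiff ℝ ∞ fun p : ℝ × ℝ × ℝ × E4 ↦ p.2.2.2 := by fun_prop
  have hu := h.inner ℝ (contDiff_const (c := u.2))
  have hv := h.inner ℝ (contDiff_const (c := v.2))
  have hxx := hx.inner ℝ hx
  simp only [ambForm_apply]
  fun_prop

theorem cauchy_hopf (x u : E4) : inner ℝ (hopfRot x) u ^ 2 ≤ inner ℝ x x * inner ℝ u u := by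
  have := real_inner_mul_inner_self_le (hopfRot x) u
  rw [inner_hopfRot_hopfRot] at this
  nlinarith

/-- The spatial part of the form is positive definite on the tangent spaces of the unit sphere. -/
theorem ambForm_space_pos {a b c : ℝ} (hb : 0 < b) (hc : 0 < c) {x : E4}
    (hx : inner ℝ x x = (1 : ℝ)) {u : ℝ × E4} (hu1 : u.1 = 0) (hu : u.2 ≠ 0) :
    0 < ambForm a b c x u u := by
  have h := cauchy_hopf x u.2
  have hpos : 0 < inner ℝ u.2 u.2 := real_inner_self_pos.2 hu
  rw [hx, one_mul] at h
  rw [ambForm_apply, hu1, hx]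
  set s := inner ℝ (hopfRot x) u.2
  have h1 : 0 ≤ b * (s * s) := mul_nonneg hb.le (mul_self_nonneg s)
  rcases eq_or_ne s 0 with hs | hs
  · rw [hs]; nlinarith [mul_pos hc hpos]
  · have h2 : 0 < b * (s * s) := by positivity
    nlinarith [mul_nonneg hc.le (sub_nonneg.2 h)]

theorem ambForm_symm (a b c : ℝ) (x : E4) (u v : ℝ × E4) :
    ambForm a b c x u v = ambForm a b c x v u := by
  rw [ambForm_apply, ambForm_apply, real_inner_comm u.2 v.2]; ring

/-! ### Positivity of the quartic -/

/-- The quartic is affine in `E`. -/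
theorem taubNUTPoly_affine (E τ : ℝ) :
    taubNUTPoly E τ = E * (τ ^ 4 + 6 * τ ^ 2 - 8 * τ - 3) + (4 + 8 * τ - 4 * τ ^ 2) := by
  unfold taubNUTPoly; ring

theorem sqrt3_sq : Real.sqrt 3 ^ 2 = 3 := Real.sq_sqrt (by norm_num)

theorem sqrt3_bounds : 1.73 < Real.sqrt 3 ∧ Real.sqrt 3 < 1.733 := by
  constructor
  · rw [Real.lt_sqrt (by norm_num)]; norm_num
  · rw [Real.sqrt_lt' (by norm_num)]; norm_num

/-- At the lower end of the parameter range the quartic has the double zero `-1`. -/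
theorem taubNUTPoly_lower (τ : ℝ) :
    taubNUTPoly (2 / 3) τ = 2 / 3 * ((τ + 1) ^ 2 * ((τ - 1) ^ 2 + 2)) := by
  unfold taubNUTPoly; ring

/-- At the upper end of the parameter range the quartic has the double zero `2 - √3`. -/
theorem taubNUTPoly_upper (τ : ℝ) :
    taubNUTPoly ((2 + Real.sqrt 3) / 3) τ = (2 + Real.sqrt 3) / 3 *
      ((τ - (2 - Real.sqrt 3)) ^ 2 * ((τ + (2 - Real.sqrt 3)) ^ 2 + 4 * (Real.sqrt 3 - 1))) := by
  unfold taubNUTPoly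
  have h3 : Real.sqrt 3 ^ 3 = 3 * Real.sqrt 3 := by rw [pow_succ, sqrt3_sq]
  have h4 : Real.sqrt 3 ^ 4 = 9 := by
    have : Real.sqrt 3 ^ 4 = (Real.sqrt 3 ^ 2) ^ 2 := by ring
    rw [this, sqrt3_sq]; norm_num
  have h5 : Real.sqrt 3 ^ 5 = 9 * Real.sqrt 3 := by rw [pow_succ, h4]
  ring_nf
  simp only [sqrt3_sq, h3, h4, h5]
  ring

theorem taubNUTPoly_lower_nonneg (τ : ℝ) : 0 ≤ taubNUTPoly (2 / 3) τ := by
  rw [taubNUTPoly_lower]; positivity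

theorem taubNUTPoly_upper_nonneg (τ : ℝ) : 0 ≤ taubNUTPoly ((2 + Real.sqrt 3) / 3) τ := by
  have := sqrt3_bounds.1
  have h : 0 ≤ Real.sqrt 3 - 1 := by linarith
  rw [taubNUTPoly_upper]; positivity

/-- The values at the double zeros of the two end polynomials bound the parameter. -/
theorem parameter_of_taubNUTPoly_nonneg {E : ℝ} (h : ∀ τ, 0 ≤ taubNUTPoly E τ) :
    E ∈ Icc (2 / 3) ((2 + Real.sqrt 3) / 3) := by
  constructor
  · have := h (-1)
    unfold taubNUTPoly at this
    linarith
  · have h1 := h (2 - Real.sqrt 3)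
    have h2 : taubNUTPoly ((2 + Real.sqrt 3) / 3) (2 - Real.sqrt 3) = 0 := by
      rw [taubNUTPoly_upper]; ring
    rw [taubNUTPoly_affine] at h1 h2
    have h3 : Real.sqrt 3 ^ 3 = 3 * Real.sqrt 3 := by rw [pow_succ, sqrt3_sq]
    have h4 : Real.sqrt 3 ^ 4 = 9 := by
      have : Real.sqrt 3 ^ 4 = (Real.sqrt 3 ^ 2) ^ 2 := by ring
      rw [this, sqrt3_sq]; norm_num
    have e : (2 - Real.sqrt 3) ^ 4 + 6 * (2 - Real.sqrt 3) ^ 2 - 8 * (2 - Real.sqrt 3) - 3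
        = 120 - 72 * Real.sqrt 3 := by
      ring_nf
      simp only [sqrt3_sq, h3, h4]
      ring
    rw [e] at h1 h2
    nlinarith [sqrt3_bounds.1]

theorem taubNUTPoly_nonneg_iff (E : ℝ) :
    (∀ τ, 0 ≤ taubNUTPoly E τ) ↔ E ∈ Icc (2 / 3) ((2 + Real.sqrt 3) / 3) := by
  refine ⟨parameter_of_taubNUTPoly_nonneg, fun hE τ ↦ ?_⟩
  have h1 := taubNUTPoly_lower_nonneg τ
  have h2 := taubNUTPoly_upper_nonneg τ
  rw [taubNUTPoly_affine] at h1 h2 ⊢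
  rcases le_total 0 (τ ^ 4 + 6 * τ ^ 2 - 8 * τ - 3) with h | h
  · nlinarith [hE.1]
  · nlinarith [hE.2]

/-- A zero at an interior parameter would be a common zero of the two end polynomials, by affinity.
-/
theorem taubNUTPoly_pos {E : ℝ} (hE : E ∈ Ioo (2 / 3) ((2 + Real.sqrt 3) / 3)) (τ : ℝ) :
    0 < taubNUTPoly E τ := by
  have h1 := taubNUTPoly_lower_nonneg τ
  have h2 := taubNUTPoly_upper_nonneg τ
  rw [taubNUTPoly_affine] at h1 h2 ⊢
  rcases lt_trichotomy 0 (τ ^ 4 + 6 * τ ^ 2 - 8 * τ - 3) with h | h | h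
  · nlinarith [hE.1]
  · -- where the coefficient of `E` vanishes, the polynomial of the lower end would vanish
    by_contra hn
    have e1 : taubNUTPoly (2 / 3) τ = 0 := by
      rw [← h] at h1 hn
      rw [taubNUTPoly_affine, ← h]
      linarith
    rw [taubNUTPoly_lower] at e1
    have t : τ = -1 := by
      have : (τ + 1) ^ 2 = 0 := by
        have p : 0 < (τ - 1) ^ 2 + 2 := by positivity
        have : (τ + 1) ^ 2 * ((τ - 1) ^ 2 + 2) = 0 := by linarith
        exact (mul_eq_zero.1 this).resolve_right p.ne'
      linarith [pow_eq_zero_iff (two_ne_zero) |>.1 this]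
    rw [t] at h
    norm_num at h
  · nlinarith [hE.2]

theorem taubNUTPoly_pos_iff (E : ℝ) :
    (∀ τ, 0 < taubNUTPoly E τ) ↔ E ∈ Ioo (2 / 3) ((2 + Real.sqrt 3) / 3) := by
  refine ⟨fun h ↦ ?_, taubNUTPoly_pos⟩
  have hE := parameter_of_taubNUTPoly_nonneg fun τ ↦ (h τ).le
  refine ⟨lt_of_le_of_ne hE.1 ?_, lt_of_le_of_ne hE.2 ?_⟩
  · rintro rfl
    have := h (-1)
    rw [taubNUTPoly_lower] at this
    norm_num at this
  · rintro rfl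
    have := h (2 - Real.sqrt 3)
    rw [taubNUTPoly_upper] at this
    norm_num at this

/-! ### Smoothness of pulled back bilinear forms -/

section PullBack

variable {E : Type*} [NormedAddCommGroup E] [NormedSpace ℝ E]
  {H : Type*} [TopologicalSpace H] {I : ModelWithCorners ℝ E H}
  {M : Type*} [TopologicalSpace M] [ChartedSpace H M] [IsManifold I ∞ M]
  {E' : Type*} [NormedAddCommGroup E'] [NormedSpace ℝ E']
  {H' : Type*} [TopologicalSpace H'] {I' : ModelWithCorners ℝ E' H'}
  {P : Type*} [TopologicalSpace P] [ChartedSpace H' P]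
  {F : Type*} [NormedAddCommGroup F] [NormedSpace ℝ F]

/-- The pull-back of a form on a vector space under a smooth map is smooth. The base point and the
form may both depend on a parameter, which covers tensor fields and one-parameter families of them.
-/
theorem contMDiffWithinAt_pullBilin {f : M → F} (hf : ContMDiff I 𝓘(ℝ, F) ∞ f) {b : P → M}
    {B : P → F →L[ℝ] F →L[ℝ] ℝ} {s : Set P} {p₀ : P} (hb : ContMDiffWithinAt I' I ∞ b s p₀)
    (hB : ContMDiffWithinAt I' 𝓘(ℝ, F →L[ℝ] F →L[ℝ] ℝ) ∞ B s p₀) :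
    ContMDiffWithinAt I' (I.prod 𝓘(ℝ, E →L[ℝ] E →L[ℝ] ℝ)) ∞
      (fun p ↦ Bundle.TotalSpace.mk' (E →L[ℝ] E →L[ℝ] ℝ)
        (E := fun x : M ↦ TangentSpace I x →L[ℝ] TangentSpace I x →L[ℝ] ℝ)
        (b p) (pullBilin (mvfderiv I f (b p)) (B p))) s p₀ := by
  rw [contMDiffWithinAt_hom_bundle]
  refine ⟨hb, ?_⟩
  -- the derivative of `f`, read in the trivialization around `b p₀`
  let e := trivializationAt E (TangentSpace I) (b p₀)
  have h1 : ContMDiffWithinAt I' 𝓘(ℝ, E →L[ℝ] F) ∞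
      (fun p ↦ (mvfderiv I f (b p)) ∘L (e.symmL ℝ (b p))) s p₀ := by
    have h := (ContMDiffAt.mfderiv_const (x₀ := b p₀) (m := ∞) (hf (b p₀))
      (by simp)).comp_contMDiffWithinAt p₀ hb
    have key (p : P) : (mvfderiv I f (b p)) ∘L (e.symmL ℝ (b p)) =
        inTangentCoordinates I 𝓘(ℝ, F) id f (fun x ↦ mfderiv I 𝓘(ℝ, F) f x) (b p₀) (b p) := by
      ext v
      simp only [inTangentCoordinates, ContinuousLinearMap.inCoordinates,
        TangentBundle.continuousLinearMapAt_model_space]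
      rfl
    exact h.congr (fun p _ ↦ key p) (key p₀)
  have hc : ContDiff ℝ ∞ fun q : (E →L[ℝ] F) × (F →L[ℝ] F →L[ℝ] ℝ) ↦ pullBilin q.1 q.2 := by
    have : (fun q : (E →L[ℝ] F) × (F →L[ℝ] F →L[ℝ] ℝ) ↦ pullBilin q.1 q.2) =
      fun q ↦ ((ContinuousLinearMap.compL ℝ E F ℝ).flip q.1) ∘L (q.2 ∘L q.1) := rfl
    rw [this]
    fun_prop
  have h2 : ContMDiffWithinAt I' 𝓘(ℝ, E →L[ℝ] E →L[ℝ] ℝ) ∞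
      (fun p ↦ pullBilin ((mvfderiv I f (b p)) ∘L (e.symmL ℝ (b p))) (B p)) s p₀ :=
    (hc.contMDiff _).comp_contMDiffWithinAt p₀ (h1.prodMk_space hB)
  have hbase : ∀ᶠ p in 𝓝[insert p₀ s] p₀, b p ∈ e.baseSet := by
    refine hb.continuousWithinAt.insert ?_
    exact e.open_baseSet.mem_nhds (FiberBundle.mem_baseSet_trivializationAt' _)
  have h3 : ∀ᶠ p in 𝓝[insert p₀ s] p₀, ContinuousLinearMap.inCoordinates E
      (fun x ↦ TangentSpace I x) (E →L[ℝ] ℝ) (fun x ↦ TangentSpace I x →L[ℝ] ℝ) (b p₀) (b p) (b p₀)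
        (b p) (pullBilin (mvfderiv I f (b p)) (B p)) =
      pullBilin ((mvfderiv I f (b p)) ∘L (e.symmL ℝ (b p))) (B p) := by
    filter_upwards [hbase] with p hp
    ext v w
    rw [inCoordinates_apply_eq₂ hp hp (by simp)]
    have hs (z : E) := (trivializationAt E (TangentSpace I) (b p₀)).symmL_apply (R := ℝ) hp z
    simp [pullBilin_apply, e, hs]
  exact h2.congr_of_eventuallyEq (h3.filter_mono (nhdsWithin_mono _ (subset_insert _ _)))
    (h3.self_of_nhdsWithin (mem_insert _ _))

end PullBack

/-! ### The embedding of `ℝ × S³` into `ℝ × ℝ⁴` -/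

instance finrank_E4 : Fact (Module.finrank ℝ E4 = 3 + 1) := ⟨by simp⟩

theorem inner_coe_self (x : S3) : inner ℝ (x : E4) (x : E4) = (1 : ℝ) := by
  rw [real_inner_self_eq_norm_sq, norm_eq_of_mem_sphere]; norm_num

theorem contMDiff_coe : ContMDiff (𝓡 3) 𝓘(ℝ, E4) ∞ (fun x : S3 ↦ (x : E4)) :=
  contMDiff_coe_sphere

/-- The differential of the inclusion `S³ → ℝ⁴`. -/
abbrev dcoe (x : S3) : TangentSpace (𝓡 3) x →L[ℝ] E4 := mvfderiv (𝓡 3) (fun q : S3 ↦ (q : E4)) x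

theorem injective_dcoe (x : S3) : Function.Injective (dcoe x) :=
  injective_mvfderiv_subtypeVal_sphere x

theorem mem_range_dcoe (x : S3) (ξ : E4) : (∃ u, dcoe x u = ξ) ↔ inner ℝ (x : E4) ξ = (0 : ℝ) := by
  have h := range_mvfderiv_subtypeVal (n := 3) x
  have : (∃ u, dcoe x u = ξ) ↔ ξ ∈ (mvfderiv (𝓡 3) ((↑) : S3 → E4) x).range := by
    simp [LinearMap.mem_range]
  rw [this, h, Submodule.mem_orthogonal_singleton_iff_inner_right]

theorem inner_dcoe (x : S3) (u : TangentSpace (𝓡 3) x) : inner ℝ (x : E4) (dcoe x u) = (0 : ℝ) :=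
  (mem_range_dcoe x _).1 ⟨u, rfl⟩

/-- The inclusion `ℝ × S³ → ℝ × ℝ⁴`. -/
def emb (p : ℝ × S3) : ℝ × E4 := (p.1, (p.2 : E4))

theorem contMDiff_emb : ContMDiff I4 𝓘(ℝ, ℝ × E4) ∞ emb :=
  contMDiff_fst.prodMk_space (contMDiff_coe.comp contMDiff_snd)

theorem mvfderiv_fst_apply (p : ℝ × S3) (u : TangentSpace I4 p) :
    mvfderiv I4 (Prod.fst : ℝ × S3 → ℝ) p u = u.1 := by
  simp [mvfderiv]
  rfl

theorem mvfderiv_coe_snd_apply (p : ℝ × S3) (u : TangentSpace I4 p) :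
    mvfderiv I4 (fun q : ℝ × S3 ↦ (q.2 : E4)) p u = dcoe p.2 u.2 := by
  have h := mfderiv_comp_apply (I := I4) (I' := 𝓡 3) (I'' := 𝓘(ℝ, E4)) p
    (g := fun q : S3 ↦ (q : E4))
    (f := (Prod.snd : ℝ × S3 → S3)) (contMDiff_coe.mdifferentiable (by simp) _)
    mdifferentiableAt_snd u
  simp only [mfderiv_snd] at h
  exact h

theorem mvfderiv_emb_apply (p : ℝ × S3) (u : TangentSpace I4 p) :
    mvfderiv I4 emb p u = (u.1, dcoe p.2 u.2) := by
  have h1 : MDifferentiableAt I4 𝓘(ℝ, ℝ) (Prod.fst : ℝ × S3 → ℝ) p := mdifferentiableAt_fst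
  have h2 : MDifferentiableAt I4 𝓘(ℝ, E4) (fun q : ℝ × S3 ↦ (q.2 : E4)) p :=
    (contMDiff_coe.comp contMDiff_snd).mdifferentiable (by simp) p
  have h3 : HasMFDerivAt I4 𝓘(ℝ, ℝ × E4) emb p ((mfderiv I4 𝓘(ℝ, ℝ) (Prod.fst : ℝ × S3 → ℝ) p).prod
      (mfderiv I4 𝓘(ℝ, E4) (fun q : ℝ × S3 ↦ (q.2 : E4)) p)) :=
    ⟨(contMDiff_emb p).continuousAt, h1.hasMFDerivAt.2.prodMk h2.hasMFDerivAt.2⟩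
  rw [← mvfderiv_coe_snd_apply p u]
  simp only [mvfderiv, h3.mfderiv]
  refine Prod.ext ?_ rfl
  exact mvfderiv_fst_apply p u

theorem mvfderiv_comp_fderiv {E H M : Type*} [NormedAddCommGroup E] [NormedSpace ℝ E]
    [TopologicalSpace H] {I : ModelWithCorners ℝ E H} [TopologicalSpace M] [ChartedSpace H M]
    {F F' : Type*} [NormedAddCommGroup F] [NormedSpace ℝ F] [NormedAddCommGroup F']
    [NormedSpace ℝ F'] {f : M → F} {k : F → F'} (p : M) (hk : DifferentiableAt ℝ k (f p))
    (hf : MDifferentiableAt I 𝓘(ℝ, F) f p) (u : TangentSpace I p) :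
    mvfderiv I (fun q ↦ k (f q)) p u = fderiv ℝ k (f p) (mvfderiv I f p u) := by
  have h := mfderiv_comp_apply (I := I) (I' := 𝓘(ℝ, F)) (I'' := 𝓘(ℝ, F')) p
    hk.mdifferentiableAt hf u
  rw [mfderiv_eq_fderiv] at h
  exact h

theorem mvfderiv_emb_injective (p : ℝ × S3) : Function.Injective (mvfderiv I4 emb p) := by
  intro u v h
  rw [mvfderiv_emb_apply, mvfderiv_emb_apply] at h
  exact Prod.ext (Prod.mk.inj h).1 (injective_dcoe p.2 (Prod.mk.inj h).2)

/-! ### The metrics as pulled back ambient forms -/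

/-- The coefficient of `-dτ²`. -/
def cTau (l E τ : ℝ) : ℝ := l ^ 2 * E * ((τ ^ 2 + 1) / taubNUTPoly E τ)

/-- The coefficient of `θ₁²`. -/
def cFib (l E τ : ℝ) : ℝ := l ^ 2 * E * (taubNUTPoly E τ / (τ ^ 2 + 1))

/-- The coefficient of `g_{S²} / 4`. -/
def cBase (l E τ : ℝ) : ℝ := l ^ 2 * E * (τ ^ 2 + 1)

/-- The extension of the dS Taub-NUT metric to `ℝ × ℝ⁴`. -/
def ambTaubNUT (l E : ℝ) (q : ℝ × E4) : (ℝ × E4) →L[ℝ] (ℝ × E4) →L[ℝ] ℝ :=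
  ambForm (cTau l E q.1) (cFib l E q.1) (cBase l E q.1) q.2

theorem taubNUT_eq (l E : ℝ) (p : ℝ × S3) :
    taubNUT l E p = pullBilin (mvfderiv I4 emb p) (ambTaubNUT l E (emb p)) := by
  ext u v
  simp only [pullBilin_apply, mvfderiv_emb_apply, ambTaubNUT, ambForm, taubNUT,
    add_apply, smul_apply, mvfderiv_fst_apply,
    mvfderiv_coe_snd_apply, cTau, cFib, cBase, emb]
  simp
  ring

theorem taubNUT_apply (l E : ℝ) (p : ℝ × S3) (u v : TangentSpace I4 p) :
    taubNUT l E p u v =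
      ambForm (cTau l E p.1) (cFib l E p.1) (cBase l E p.1) (p.2 : E4)
        (u.1, dcoe p.2 u.2) (v.1, dcoe p.2 v.2) := by
  rw [taubNUT_eq, pullBilin_apply, mvfderiv_emb_apply, mvfderiv_emb_apply]; rfl

theorem bergerMetric_apply (E : ℝ) (x : S3) (u v : TangentSpace (𝓡 3) x) :
    bergerMetric E x u v = ambForm 0 E 1 (x : E4) (0, dcoe x u) (0, dcoe x v) := by
  simp [bergerMetric, ambForm, pullBilin_apply]

theorem roundMetric_eq_bergerMetric : roundMetric = bergerMetric 1 := by
  funext x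
  ext u v
  rw [bergerMetric_apply, ambForm_apply]
  simp [roundMetric, pullBilin_apply, euclid4]
  rfl

theorem taubNUTPoly_one (τ : ℝ) : taubNUTPoly 1 τ = (τ ^ 2 + 1) ^ 2 := by
  unfold taubNUTPoly; ring

theorem contMDiff_emb_snd : ContMDiff I4 𝓘(ℝ, E4) ∞ (fun q : ℝ × S3 ↦ (q.2 : E4)) :=
  contMDiff_coe.comp contMDiff_snd

/-- The differential of `(τ, x) ↦ (l τ, l √(1 + τ²) x)` splits into a multiple of the tangent vector
of `S³` and a multiple of the normal `x`, which are orthogonal. -/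
theorem taubNUT_one (l : ℝ) : taubNUT l 1 = deSitterMetric l := by
  funext p
  ext u v
  have hemb : MDifferentiableAt I4 𝓘(ℝ, ℝ × E4) emb p := contMDiff_emb.mdifferentiable (by simp) p
  have hp : 0 < 1 + p.1 ^ 2 := by positivity
  have hsq : Real.sqrt (1 + p.1 ^ 2) ^ 2 = 1 + p.1 ^ 2 := Real.sq_sqrt hp.le
  have h1 (w : TangentSpace I4 p) : mvfderiv I4 (fun q : ℝ × S3 ↦ l * q.1) p w = l * w.1 := by
    have hd : HasFDerivAt (fun q : ℝ × E4 ↦ l * q.1) (l • ContinuousLinearMap.fst ℝ ℝ E4) (emb p) :=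
      hasFDerivAt_fst.const_mul l
    have := mvfderiv_comp_fderiv (I := I4) (f := emb) (k := fun q : ℝ × E4 ↦ l * q.1) p
      hd.differentiableAt hemb w
    rw [hd.fderiv, mvfderiv_emb_apply] at this
    simpa [emb] using this
  have h2 (w : TangentSpace I4 p) :
      mvfderiv I4 (fun q : ℝ × S3 ↦ (l * Real.sqrt (1 + q.1 ^ 2)) • (q.2 : E4)) p w =
        (l * Real.sqrt (1 + p.1 ^ 2)) • dcoe p.2 w.2
          + (l * (p.1 * w.1 / Real.sqrt (1 + p.1 ^ 2))) • (p.2 : E4) := by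
    have hd1 : HasFDerivAt (fun q : ℝ × E4 ↦ 1 + q.1 ^ 2)
        ((2 * p.1) • ContinuousLinearMap.fst ℝ ℝ E4) (emb p) := by
      have := ((hasFDerivAt_fst (𝕜 := ℝ) (E := ℝ) (F := E4) (p := emb p)).pow 2).const_add 1
      refine this.congr_fderiv ?_
      ext <;> simp [emb]
    have hd := ((hd1.sqrt hp.ne').const_mul l).smul
      (hasFDerivAt_snd (𝕜 := ℝ) (E := ℝ) (F := E4) (p := emb p))
    have := mvfderiv_comp_fderiv (I := I4) (f := emb) p hd.differentiableAt hemb w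
    rw [hd.fderiv, mvfderiv_emb_apply] at this
    refine this.trans ?_
    simp [emb]
    congr 1
    field_simp
  have e1 : inner ℝ (p.2 : E4) (dcoe p.2 u.2) = (0 : ℝ) := inner_dcoe _ _
  have e2 : inner ℝ (p.2 : E4) (dcoe p.2 v.2) = (0 : ℝ) := inner_dcoe _ _
  have e3 : inner ℝ (dcoe p.2 u.2) (p.2 : E4) = (0 : ℝ) := by rw [real_inner_comm]; exact e1
  have e : deSitterMetric l p u v = -((l * u.1) * (l * v.1))
      + inner ℝ ((l * Real.sqrt (1 + p.1 ^ 2)) • dcoe p.2 u.2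
          + (l * (p.1 * u.1 / Real.sqrt (1 + p.1 ^ 2))) • (p.2 : E4))
        ((l * Real.sqrt (1 + p.1 ^ 2)) • dcoe p.2 v.2
          + (l * (p.1 * v.1 / Real.sqrt (1 + p.1 ^ 2))) • (p.2 : E4)) := by
    rw [← h1, ← h1, ← h2, ← h2]
    rfl
  have hs : Real.sqrt (1 + p.1 ^ 2) ≠ 0 := (Real.sqrt_pos.2 hp).ne'
  have hp' : p.1 ^ 2 + 1 ≠ 0 := by positivity
  rw [e, taubNUT_apply, ambForm_apply, inner_coe_self]
  simp only [inner_add_left, inner_add_right,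
    real_inner_smul_left, real_inner_smul_right, e2, e3, inner_coe_self, cTau, cFib, cBase,
    taubNUTPoly_one]
  field_simp
  rw [hsq]
  ring

/-! ### Lorentz metrics and time orientation -/

/-- The restriction of a form `-a dτ² + b θ₁² + (c / 4) g_{S²}` with positive coefficients is a
Lorentz metric. The manifold may have boundary, so that this applies to the completion as well. -/
theorem isLorentzMetric_of_ambForm {E H N : Type*} [NormedAddCommGroup E] [NormedSpace ℝ E]
    [TopologicalSpace H] {I : ModelWithCorners ℝ E H} [TopologicalSpace N] [ChartedSpace H N]
    [IsManifold I ∞ N] {f : N → ℝ × E4} (hf : ContMDiff I 𝓘(ℝ, ℝ × E4) ∞ f)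
    (hS : ∀ p, inner ℝ (f p).2 (f p).2 = (1 : ℝ))
    (hinj : ∀ p, Function.Injective (mvfderiv I f p))
    (htime : ∀ p, ∃ v, mvfderiv I f p v = (1, 0))
    {a b c : ℝ → ℝ} (ha : ContDiff ℝ ∞ a) (hb : ContDiff ℝ ∞ b) (hc : ContDiff ℝ ∞ c)
    (ha0 : ∀ t, 0 < a t) (hb0 : ∀ t, 0 < b t) (hc0 : ∀ t, 0 < c t) {g : BilinField I N}
    (hg : ∀ p, g p = pullBilin (mvfderiv I f p)
      (ambForm (a (f p).1) (b (f p).1) (c (f p).1) (f p).2)) :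
    IsLorentzMetric I g := by
  refine ⟨?_, fun p ↦ ⟨fun u v ↦ ?_, ?_⟩⟩
  · have hB : ContDiff ℝ ∞ fun q : ℝ × E4 ↦ ambForm (a q.1) (b q.1) (c q.1) q.2 :=
      contDiff_ambForm.comp (f := fun q : ℝ × E4 ↦ (a q.1, b q.1, c q.1, q.2)) (by fun_prop)
    intro p
    have h := contMDiffWithinAt_pullBilin (I' := I) hf (b := id) (s := univ) (p₀ := p)
      (B := fun p ↦ ambForm (a (f p).1) (b (f p).1) (c (f p).1) (f p).2)
      contMDiffWithinAt_id ((hB.contMDiff.comp hf).contMDiffOn p (mem_univ p))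
    rw [← contMDiffWithinAt_univ]
    refine h.congr (fun q _ ↦ ?_) ?_
    · rw [hg]; rfl
    · rw [hg]; rfl
  · rw [hg, pullBilin_apply, pullBilin_apply, ambForm_symm]
  · obtain ⟨v, hv⟩ := htime p
    refine ⟨v, ?_, fun w h0 hw ↦ ?_⟩
    · rw [hg, pullBilin_apply, hv, ambForm_apply]
      simpa using ha0 _
    · rw [hg, pullBilin_apply, hv, ambForm_apply] at h0
      have h1 : (mvfderiv I f p w).1 = 0 := by simpa [(ha0 (f p).1).ne'] using h0
      rw [hg, pullBilin_apply]
      refine ambForm_space_pos (hb0 _) (hc0 _) (hS p) h1 fun h2 ↦ hw ?_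
      refine hinj p ?_
      rw [map_zero]
      exact Prod.ext h1 h2

theorem contDiff_taubNUTPoly (E : ℝ) : ContDiff ℝ ∞ (taubNUTPoly E) := by
  unfold taubNUTPoly; fun_prop

theorem parameter_pos {E : ℝ} (hE : E ∈ Ioo (2 / 3) ((2 + Real.sqrt 3) / 3)) : 0 < E :=
  lt_trans (by norm_num) hE.1

theorem contDiff_cTau {l E : ℝ} (hE : E ∈ Ioo (2 / 3) ((2 + Real.sqrt 3) / 3)) :
    ContDiff ℝ ∞ (cTau l E) :=
  contDiff_const.mul ((by fun_prop : ContDiff ℝ ∞ fun τ : ℝ ↦ τ ^ 2 + 1).div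
    (contDiff_taubNUTPoly E) fun τ ↦ (taubNUTPoly_pos hE τ).ne')

theorem contDiff_cFib {l E : ℝ} : ContDiff ℝ ∞ (cFib l E) :=
  contDiff_const.mul ((contDiff_taubNUTPoly E).div
    (by fun_prop : ContDiff ℝ ∞ fun τ : ℝ ↦ τ ^ 2 + 1) fun τ ↦ by positivity)

theorem contDiff_cBase {l E : ℝ} : ContDiff ℝ ∞ (cBase l E) := by
  unfold cBase; fun_prop

theorem scale_pos {l E : ℝ} (hl : 0 < l) (hE : E ∈ Ioo (2 / 3) ((2 + Real.sqrt 3) / 3)) :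
    0 < l ^ 2 * E := by
  have := parameter_pos hE
  positivity

theorem cTau_pos {l E : ℝ} (hl : 0 < l) (hE : E ∈ Ioo (2 / 3) ((2 + Real.sqrt 3) / 3)) (τ : ℝ) :
    0 < cTau l E τ :=
  mul_pos (scale_pos hl hE) (div_pos (by positivity) (taubNUTPoly_pos hE τ))

theorem cFib_pos {l E : ℝ} (hl : 0 < l) (hE : E ∈ Ioo (2 / 3) ((2 + Real.sqrt 3) / 3)) (τ : ℝ) :
    0 < cFib l E τ :=
  mul_pos (scale_pos hl hE) (div_pos (taubNUTPoly_pos hE τ) (by positivity))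

theorem cBase_pos {l E : ℝ} (hl : 0 < l) (hE : E ∈ Ioo (2 / 3) ((2 + Real.sqrt 3) / 3)) (τ : ℝ) :
    0 < cBase l E τ :=
  mul_pos (scale_pos hl hE) (by positivity)

theorem mvfderiv_emb_partialTau (p : ℝ × S3) : mvfderiv I4 emb p (partialTau p) = (1, 0) := by
  rw [mvfderiv_emb_apply]
  exact Prod.ext rfl (map_zero (dcoe p.2))

theorem isLorentzMetric_taubNUT {l E : ℝ} (hl : 0 < l)
    (hE : E ∈ Ioo (2 / 3) ((2 + Real.sqrt 3) / 3)) : IsLorentzMetric I4 (taubNUT l E) :=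
  isLorentzMetric_of_ambForm contMDiff_emb (fun p ↦ inner_coe_self p.2) mvfderiv_emb_injective
    (fun p ↦ ⟨partialTau p, mvfderiv_emb_partialTau p⟩)
    (contDiff_cTau hE) contDiff_cFib contDiff_cBase
    (cTau_pos hl hE) (cFib_pos hl hE) (cBase_pos hl hE) (taubNUT_eq l E)

theorem contMDiff_partialTau :
    ContMDiff I4 I4.tangent ∞ (fun x ↦ (⟨x, partialTau x⟩ : TangentBundle I4 (ℝ × S3))) := by
  have h1 : ContMDiff 𝓘(ℝ, ℝ) 𝓘(ℝ, ℝ).tangent ∞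
      (fun x : ℝ ↦ (⟨x, (1 : ℝ)⟩ : TangentBundle 𝓘(ℝ, ℝ) ℝ)) :=
    (contMDiff_vectorSpace_iff_contDiff (V := fun _ : ℝ ↦ (1 : ℝ))).2 contDiff_const
  have h2 : ContMDiff (𝓡 3) (𝓡 3).tangent ∞
      (fun x : S3 ↦ (⟨x, (0 : E3)⟩ : TangentBundle (𝓡 3) S3)) :=
    Bundle.contMDiff_zeroSection ℝ (TangentSpace (𝓡 3) : S3 → Type)
  have h3 := (contMDiff_equivTangentBundleProd_symm (I := 𝓘(ℝ, ℝ)) (M := ℝ) (I' := 𝓡 3) (M' := S3)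
    (n := ∞)).comp ((h1.comp contMDiff_fst).prodMk (h2.comp contMDiff_snd))
  exact h3

theorem taubNUT_partialTau (l E : ℝ) (p : ℝ × S3) (v : TangentSpace I4 p) :
    taubNUT l E p (partialTau p) v = -cTau l E p.1 * v.1 := by
  rw [taubNUT_eq, pullBilin_apply, mvfderiv_emb_partialTau, mvfderiv_emb_apply, ambTaubNUT,
    ambForm_apply]
  simp [emb]

theorem isTimeOrientation_taubNUT {l E : ℝ} (hl : 0 < l)
    (hE : E ∈ Ioo (2 / 3) ((2 + Real.sqrt 3) / 3)) :
    IsTimeOrientation I4 (taubNUT l E) partialTau := by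
  refine ⟨contMDiff_partialTau, fun p ↦ ?_⟩
  rw [taubNUT_partialTau]
  simpa [partialTau] using cTau_pos hl hE p.1

instance connectedSpace_S3 : ConnectedSpace S3 := by
  rw [← isConnected_iff_connectedSpace]
  exact isConnected_sphere (by rw [← Module.finrank_eq_rank]; simp) _ zero_le_one

/-! ### Ricci curvature from second derivatives of the metric -/

section Curvature

variable {E : Type*} [NormedAddCommGroup E] [NormedSpace ℝ E] [FiniteDimensional ℝ E]
  {G : E → E →L[ℝ] E →L[ℝ] ℝ} {y : E}

theorem exists_equiv_of_injective {B : E →L[ℝ] E →L[ℝ] ℝ} (hB : ∀ u, (∀ w, B u w = 0) → u = 0) :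
    ∃ e : E ≃L[ℝ] (E →L[ℝ] ℝ), (e : E →L[ℝ] E →L[ℝ] ℝ) = B := by
  have hinj : Function.Injective (B : E →ₗ[ℝ] E →L[ℝ] ℝ) := by
    rw [injective_iff_map_eq_zero]
    intro u hu
    exact hB u fun w ↦ by simpa using congrArg (fun L : E →L[ℝ] ℝ ↦ L w) hu
  have hdim : Module.finrank ℝ E = Module.finrank ℝ (E →L[ℝ] ℝ) := by
    rw [← (LinearMap.toContinuousLinearMap (𝕜 := ℝ) (E := E) (F' := ℝ)).finrank_eq]
    exact Subspace.dual_finrank_eq.symm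
  refine ⟨(LinearEquiv.ofInjectiveOfFinrankEq _ hinj hdim).toContinuousLinearEquiv, ?_⟩
  ext u v
  simp
  rfl

/-- Lowering the index of the Christoffel symbols; for degenerate forms the inverse in their
definition has a junk value. -/
theorem christoffel_spec (hG : ∀ u, (∀ w, G y u w = 0) → u = 0) (u v z : E) :
    G y (christoffel G y u v) z = christoffelFirst G y u v z := by
  obtain ⟨e, he⟩ := exists_equiv_of_injective hG
  rw [christoffel_apply, ← he, ContinuousLinearMap.inverse_equiv]
  simp

theorem eventually_nondegenerate (hc : ContinuousAt G y) (hG : ∀ u, (∀ w, G y u w = 0) → u = 0) :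
    ∀ᶠ y' in 𝓝 y, ∀ u, (∀ w, G y' u w = 0) → u = 0 := by
  obtain ⟨e, he⟩ := exists_equiv_of_injective hG
  have h := hc.eventually (he ▸ e.nhds : range ((↑) : (E ≃L[ℝ] (E →L[ℝ] ℝ)) → _) ∈ 𝓝 (G y))
  filter_upwards [h] with y' ⟨e', he'⟩ u hu
  refine e'.injective ?_
  rw [map_zero]
  ext w
  have := hu w
  rw [← he'] at this
  simpa using this

omit [FiniteDimensional ℝ E] in
theorem differentiableAt_christoffelFirst (hc : ContDiffAt ℝ ∞ G y) :
    DifferentiableAt ℝ (christoffelFirst G) y := by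
  have h : DifferentiableAt ℝ (fderiv ℝ G) y :=
    (hc.fderiv_right (m := 1) (by norm_cast)).differentiableAt (by simp)
  have hf : DifferentiableAt ℝ (fun y ↦ (fderiv ℝ G y).flip) y :=
    ((ContinuousLinearMap.flipₗᵢ ℝ E E (E →L[ℝ] ℝ)).toContinuousLinearEquiv.differentiableAt).comp
      y h
  exact ((h.add hf).sub ((differentiableAt_const _).clm_comp hf)).const_smul (1 / 2 : ℝ)

theorem differentiableAt_christoffel (hc : ContDiffAt ℝ ∞ G y)
    (hG : ∀ u, (∀ w, G y u w = 0) → u = 0) : DifferentiableAt ℝ (christoffel G) y := by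
  have h1 := differentiableAt_christoffelFirst hc
  have h2 : DifferentiableAt ℝ (fun y ↦ (G y).inverse) y := by
    obtain ⟨e, he⟩ := exists_equiv_of_injective hG
    have : ContDiffAt ℝ ∞ (ContinuousLinearMap.inverse : (E →L[ℝ] E →L[ℝ] ℝ) → _) (G y) :=
      he ▸ contDiffAt_map_inverse e
    exact (this.differentiableAt (by simp)).comp y (hc.differentiableAt (by simp))
  unfold christoffel
  fun_prop

/-- The lowered curvature tensor in terms of Christoffel symbols of the first kind. -/
theorem metric_curvature (hc : ContDiffAt ℝ ∞ G y)
    (hsymm : ∀ᶠ y' in 𝓝 y, ∀ u v, G y' u v = G y' v u)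
    (hG : ∀ u, (∀ w, G y u w = 0) → u = 0) (u v w z : E) :
    G y (curvature G y u v w) z =
      fderiv ℝ (fun y ↦ christoffelFirst G y u v z) y w
        - fderiv ℝ (fun y ↦ christoffelFirst G y w v z) y u
        - G y (christoffel G y w z) (christoffel G y u v)
        + G y (christoffel G y u z) (christoffel G y w v) := by
  have hd : DifferentiableAt ℝ G y := hc.differentiableAt (by simp)
  have hdG := differentiableAt_christoffel hc hG
  have hsd (w u v : E) : fderiv ℝ G y w u v = fderiv ℝ G y w v u := by
    have h1 (u v : E) : fderiv ℝ (fun y ↦ G y u v) y w = fderiv ℝ G y w u v := by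
      have := ((hd.hasFDerivAt.clm_apply (hasFDerivAt_const u y)).clm_apply
        (hasFDerivAt_const v y)).fderiv
      rw [this]; simp
    have : (fun y ↦ G y u v) =ᶠ[𝓝 y] fun y ↦ G y v u := by
      filter_upwards [hsymm] with y' hy' using hy' u v
    rw [← h1, ← h1, this.fderiv_eq]
  have hmetric (w x z : E) :
      fderiv ℝ G y w x z = christoffelFirst G y w x z + christoffelFirst G y w z x := by
    rw [christoffelFirst_apply, christoffelFirst_apply, hsd w z x, hsd z w x, hsd x w z]; ring
  have hD (w u v z : E) : fderiv ℝ (fun y ↦ christoffelFirst G y u v z) y w =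
      fderiv ℝ G y w (christoffel G y u v) z + G y (fderiv ℝ (christoffel G) y w u v) z := by
    have e : (fun y ↦ christoffelFirst G y u v z) =ᶠ[𝓝 y] fun y ↦ G y (christoffel G y u v) z := by
      filter_upwards [eventually_nondegenerate hd.continuousAt hG] with y' hy'
      rw [christoffel_spec hy']
    have hk : HasFDerivAt (fun y ↦ christoffel G y u v)
        (((fderiv ℝ (christoffel G) y).flip u).flip v) y := by
      refine ((hdG.hasFDerivAt.clm_apply (hasFDerivAt_const u y)).clm_apply
        (hasFDerivAt_const v y)).congr_fderiv ?_
      ext w; simp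
    rw [e.fderiv_eq, ((hd.hasFDerivAt.clm_apply hk).clm_apply (hasFDerivAt_const z y)).fderiv]
    simp
    ring
  have hs := hsymm.self_of_nhds
  rw [curvature_apply, hD, hD, hmetric w, hmetric u]
  simp only [map_sub, map_add, sub_apply, add_apply]
  rw [christoffel_spec hG w, christoffel_spec hG u (christoffel G y w v) z,
    ← christoffel_spec hG w z, ← christoffel_spec hG u z]
  ring

/-- The Ricci tensor at a point where the coordinate basis is orthogonal, in terms of the
Christoffel symbols of the first kind, which avoids differentiating the inverse of the metric. -/
theorem ricci_eq_sum {ι : Type*} [Fintype ι] [DecidableEq ι] (b : Module.Basis ι ℝ E)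
    (horth : ∀ i j, i ≠ j → G y (b i) (b j) = 0) (hne : ∀ i, G y (b i) (b i) ≠ 0)
    (hc : ContDiffAt ℝ ∞ G y) (hsymm : ∀ᶠ y' in 𝓝 y, ∀ u v, G y' u v = G y' v u) (u v : E) :
    ricci G y u v = ∑ i, (G y (b i) (b i))⁻¹ *
      (fderiv ℝ (fun y ↦ christoffelFirst G y u v (b i)) y (b i)
        - fderiv ℝ (fun y ↦ christoffelFirst G y (b i) v (b i)) y u
        - ∑ k, (G y (b k) (b k))⁻¹ *
          (christoffelFirst G y (b i) (b i) (b k) * christoffelFirst G y u v (b k)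
            - christoffelFirst G y u (b i) (b k) * christoffelFirst G y (b i) v (b k))) := by
  have hrepr (x : E) (i : ι) : b.repr x i = (G y (b i) (b i))⁻¹ * G y x (b i) := by
    conv_rhs => rw [← b.sum_repr x]
    simp only [map_sum, map_smul, sum_apply, smul_apply, smul_eq_mul]
    rw [Finset.sum_eq_single i (fun j _ hj ↦ by rw [horth j i hj, mul_zero]) (by simp)]
    field_simp [hne i]
  have hG : ∀ u, (∀ w, G y u w = 0) → u = 0 := by
    intro u hu
    rw [← b.sum_repr u]
    simp [hrepr, hu]
  have hs := hsymm.self_of_nhds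
  have hexp (x z : E) : G y x z = ∑ k, (G y (b k) (b k))⁻¹ * (G y x (b k) * G y z (b k)) := by
    conv_lhs => rw [← b.sum_repr z]
    simp only [map_sum, map_smul, smul_eq_mul, hrepr]
    exact Finset.sum_congr rfl fun k _ ↦ by ring
  rw [ricci, LinearMap.trace_eq_matrix_trace ℝ b, Matrix.trace]
  refine Finset.sum_congr rfl fun i _ ↦ ?_
  rw [Matrix.diag_apply, LinearMap.toMatrix_apply, hrepr, ContinuousLinearMap.coe_coe,
    metric_curvature hc hsymm hG, hexp (christoffel G y (b i) (b i)),
    hexp (christoffel G y u (b i))]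
  congr 1
  simp only [christoffel_spec hG, mul_sub, Finset.sum_sub_distrib]
  ring

end Curvature

/-! ### The Ricci tensor in coordinates adapted to the Hopf fibration -/

/-- `1 + |ζ|²` in the coordinates `(τ, ζ, β)`. -/
def locN (y : ℝ × E3) : ℝ := 1 + y.2 0 ^ 2 + y.2 1 ^ 2

/-- The connection form `dβ + (ζ₀ dζ₁ - ζ₁ dζ₀) / (1 + |ζ|²)`. -/
def locTheta (y v : ℝ × E3) : ℝ := v.2 2 + (y.2 0 * v.2 1 - y.2 1 * v.2 0) / locN y

/-- The directional derivative of the connection form along `u`. -/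
def locTheta' (y u v : ℝ × E3) : ℝ :=
  (u.2 0 * v.2 1 - u.2 1 * v.2 0) / locN y
    - (y.2 0 * v.2 1 - y.2 1 * v.2 0) * (2 * (y.2 0 * u.2 0 + y.2 1 * u.2 1)) / locN y ^ 2

/-- The metric `-a dτ² + b θ² + c |dζ|² / (1 + |ζ|²)²` in the coordinates `(τ, ζ, β)`. -/
def locForm (a b c : ℝ → ℝ) (y u v : ℝ × E3) : ℝ :=
  -a y.1 * (u.1 * v.1) + b y.1 * (locTheta y u * locTheta y v)
    + c y.1 * ((u.2 0 * v.2 0 + u.2 1 * v.2 1) / locN y ^ 2)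

/-- The directional derivative along `u` of the component of the metric on `v`, `z`. -/
def locForm₁ (b c a' b' c' : ℝ → ℝ) (y u v z : ℝ × E3) : ℝ :=
  -(a' y.1 * u.1) * (v.1 * z.1)
    + (b' y.1 * u.1 * (locTheta y v * locTheta y z)
      + b y.1 * (locTheta' y u v * locTheta y z + locTheta y v * locTheta' y u z))
    + (c' y.1 * u.1 * ((v.2 0 * z.2 0 + v.2 1 * z.2 1) / locN y ^ 2)
      - c y.1 * ((v.2 0 * z.2 0 + v.2 1 * z.2 1)
          * (4 * (y.2 0 * u.2 0 + y.2 1 * u.2 1)) / locN y ^ 3))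

/-- The second derivative along `u` and `w` of the component on `v`, `z`, at `ζ = 0`. -/
def locForm₂ (b c b' a'' b'' c'' : ℝ) (w u v z : ℝ × E3) : ℝ :=
  -(a'' * (w.1 * u.1)) * (v.1 * z.1)
    + (b'' * (w.1 * u.1) * (v.2 2 * z.2 2)
      + b' * u.1 * ((w.2 0 * v.2 1 - w.2 1 * v.2 0) * z.2 2
          + v.2 2 * (w.2 0 * z.2 1 - w.2 1 * z.2 0))
      + b' * w.1 * ((u.2 0 * v.2 1 - u.2 1 * v.2 0) * z.2 2
          + v.2 2 * (u.2 0 * z.2 1 - u.2 1 * z.2 0))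
      + b * ((u.2 0 * v.2 1 - u.2 1 * v.2 0) * (w.2 0 * z.2 1 - w.2 1 * z.2 0)
          + (w.2 0 * v.2 1 - w.2 1 * v.2 0) * (u.2 0 * z.2 1 - u.2 1 * z.2 0)))
    + (c'' * (w.1 * u.1) * (v.2 0 * z.2 0 + v.2 1 * z.2 1)
      - c * ((v.2 0 * z.2 0 + v.2 1 * z.2 1) * (4 * (w.2 0 * u.2 0 + w.2 1 * u.2 1))))

theorem locN_pos (y : ℝ × E3) : 0 < locN y := by unfold locN; positivity

section Lines

variable (y u : ℝ × E3)

theorem hasDerivAt_line_fst : HasDerivAt (fun t : ℝ ↦ (y + t • u).1) u.1 0 := by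
  simpa using ((hasDerivAt_id (0 : ℝ)).mul_const u.1).const_add y.1

theorem hasDerivAt_line_snd (i : Fin 3) : HasDerivAt (fun t : ℝ ↦ (y + t • u).2 i) (u.2 i) 0 := by
  simpa using ((hasDerivAt_id (0 : ℝ)).mul_const (u.2 i)).const_add (y.2 i)

theorem hasDerivAt_line_comp {f f' : ℝ → ℝ} (hf : ∀ t, HasDerivAt f (f' t) t) :
    HasDerivAt (fun t : ℝ ↦ f (y + t • u).1) (f' y.1 * u.1) 0 := by
  have h := hf (y + (0 : ℝ) • u).1
  have := HasDerivAt.comp (0 : ℝ) h (hasDerivAt_line_fst y u)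
  simpa [Function.comp_def] using this

theorem hasDerivAt_line_locN : HasDerivAt (fun t : ℝ ↦ locN (y + t • u))
    (2 * (y.2 0 * u.2 0 + y.2 1 * u.2 1)) 0 := by
  refine ((((hasDerivAt_line_snd y u 0).pow 2).const_add 1).add
    ((hasDerivAt_line_snd y u 1).pow 2)).congr_deriv ?_
  simp; ring

theorem hasDerivAt_line_locTheta (v : ℝ × E3) :
    HasDerivAt (fun t : ℝ ↦ locTheta (y + t • u) v) (locTheta' y u v) 0 := by
  have hn := (locN_pos y).ne'
  refine (((((hasDerivAt_line_snd y u 0).mul_const (v.2 1)).sub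
    ((hasDerivAt_line_snd y u 1).mul_const (v.2 0))).div (hasDerivAt_line_locN y u)
      (by simpa using hn)).const_add (v.2 2)).congr_deriv ?_
  simp [locTheta']
  field_simp

theorem hasDerivAt_line_locForm {a b c a' b' c' : ℝ → ℝ} (ha : ∀ t, HasDerivAt a (a' t) t)
    (hb : ∀ t, HasDerivAt b (b' t) t) (hc : ∀ t, HasDerivAt c (c' t) t) (v z : ℝ × E3) :
    HasDerivAt (fun t : ℝ ↦ locForm a b c (y + t • u) v z) (locForm₁ b c a' b' c' y u v z) 0 := by
  have hn := (locN_pos y).ne'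
  refine ((((hasDerivAt_line_comp y u ha).neg.mul_const (v.1 * z.1)).add
    ((hasDerivAt_line_comp y u hb).mul ((hasDerivAt_line_locTheta y u v).mul
      (hasDerivAt_line_locTheta y u z)))).add ((hasDerivAt_line_comp y u hc).mul
      ((hasDerivAt_const (0 : ℝ) (v.2 0 * z.2 0 + v.2 1 * z.2 1)).div
        ((hasDerivAt_line_locN y u).pow 2) (by simpa using hn)))).congr_deriv ?_
  simp [locForm₁]
  field_simp
  ring

end Lines

theorem hasDerivAt_line_locForm₁ {b c a' b' c' a'' b'' c'' : ℝ → ℝ}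
    (hb : ∀ t, HasDerivAt b (b' t) t) (hc : ∀ t, HasDerivAt c (c' t) t)
    (ha' : ∀ t, HasDerivAt a' (a'' t) t) (hb' : ∀ t, HasDerivAt b' (b'' t) t)
    (hc' : ∀ t, HasDerivAt c' (c'' t) t) (τ : ℝ) (w u v z : ℝ × E3) :
    HasDerivAt (fun t : ℝ ↦ locForm₁ b c a' b' c' ((τ, (0 : E3)) + t • w) u v z)
      (locForm₂ (b τ) (c τ) (b' τ) (a'' τ) (b'' τ) (c'' τ) w u v z) 0 := by
  set y : ℝ × E3 := (τ, 0) with hy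
  have hn1 : locN (τ, (0 : E3)) = 1 := by simp [locN]
  have hn := hasDerivAt_line_locN y w
  have hn0 : (fun t : ℝ ↦ locN (y + t • w)) 0 ≠ 0 := (locN_pos _).ne'
  have hm (u : ℝ × E3) := ((hasDerivAt_line_snd y w 0).mul_const (u.2 0)).add
    ((hasDerivAt_line_snd y w 1).mul_const (u.2 1))
  have hx (v : ℝ × E3) := ((hasDerivAt_line_snd y w 0).mul_const (v.2 1)).sub
    ((hasDerivAt_line_snd y w 1).mul_const (v.2 0))
  have hT (v : ℝ × E3) := hasDerivAt_line_locTheta y w v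
  have hT' (u v : ℝ × E3) : HasDerivAt (fun t : ℝ ↦ locTheta' (y + t • w) u v) 0 0 := by
    refine (((hasDerivAt_const (0 : ℝ) (u.2 0 * v.2 1 - u.2 1 * v.2 0)).div hn hn0).sub
      (((hx v).mul ((hm u).const_mul 2)).div (hn.pow 2) (pow_ne_zero 2 hn0))).congr_deriv ?_
    simp [hy]
  refine ((((hasDerivAt_line_comp y w ha').mul_const u.1).neg.mul_const (v.1 * z.1)).add
    ((((hasDerivAt_line_comp y w hb').mul_const u.1).mul ((hT v).mul (hT z))).add
      ((hasDerivAt_line_comp y w hb).mul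
        (((hT' u v).mul (hT z)).add ((hT v).mul (hT' u z)))))).add
    ((((hasDerivAt_line_comp y w hc').mul_const u.1).mul
      ((hasDerivAt_const (0 : ℝ) (v.2 0 * z.2 0 + v.2 1 * z.2 1)).div (hn.pow 2)
        (pow_ne_zero 2 hn0))).sub
      ((hasDerivAt_line_comp y w hc).mul ((((hm u).const_mul 4).const_mul
        (v.2 0 * z.2 0 + v.2 1 * z.2 1)).div (hn.pow 3) (pow_ne_zero 3 hn0)))) |>.congr_deriv ?_
  simp [locForm₂, hn1, locTheta, locTheta', hy]
  ring

/-- The basis `∂_τ, ∂_ζ₀, ∂_ζ₁, ∂_β`. -/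
def locBasis : Module.Basis (Unit ⊕ Fin 3) ℝ (ℝ × E3) :=
  (Module.Basis.singleton Unit ℝ).prod (EuclideanSpace.basisFun (Fin 3) ℝ).toBasis

theorem locBasis_inl (i : Unit) : locBasis (Sum.inl i) = (1, 0) := by
  simp [locBasis]

theorem locBasis_inr (i : Fin 3) : locBasis (Sum.inr i) = (0, EuclideanSpace.single i 1) := by
  simp [locBasis]

/-- The Ricci tensor at `ζ = 0`, for arbitrary coefficients `a`, `b`, `c`. The Ricci tensor away
from `ζ = 0` is not needed, as every point is the centre of coordinates of this kind. -/
theorem ricci_locForm {G : ℝ × E3 → (ℝ × E3) →L[ℝ] (ℝ × E3) →L[ℝ] ℝ} {τ : ℝ}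
    {a b c a' b' c' a'' b'' c'' : ℝ → ℝ}
    (ha : ∀ t, HasDerivAt a (a' t) t) (hb : ∀ t, HasDerivAt b (b' t) t)
    (hc : ∀ t, HasDerivAt c (c' t) t) (ha' : ∀ t, HasDerivAt a' (a'' t) t)
    (hb' : ∀ t, HasDerivAt b' (b'' t) t) (hc' : ∀ t, HasDerivAt c' (c'' t) t)
    (ha0 : a τ ≠ 0) (hb0 : b τ ≠ 0) (hc0 : c τ ≠ 0) (hGc : ContDiffAt ℝ ∞ G (τ, 0))
    (hG : ∀ᶠ y in 𝓝 (τ, (0 : E3)), ∀ u v, G y u v = locForm a b c y u v) (u v : ℝ × E3) :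
    ricci G (τ, 0) u v =
      a τ * (-((b'' τ / (2 * b τ) - b' τ ^ 2 / (2 * b τ ^ 2)) / a τ
              - a' τ * b' τ / (4 * b τ * a τ ^ 2))
            - 2 * ((c'' τ / (2 * c τ) - c' τ ^ 2 / (2 * c τ ^ 2)) / a τ
              - a' τ * c' τ / (4 * c τ * a τ ^ 2))
            - b' τ ^ 2 / (4 * b τ ^ 2 * a τ) - 2 * (c' τ ^ 2 / (4 * c τ ^ 2 * a τ))) * (u.1 * v.1)
        + b τ * (2 * b τ / c τ ^ 2 + ((b'' τ / (2 * b τ) - b' τ ^ 2 / (2 * b τ ^ 2)) / a τ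
              - a' τ * b' τ / (4 * b τ * a τ ^ 2))
            + b' τ ^ 2 / (4 * b τ ^ 2 * a τ) + b' τ * c' τ / (2 * b τ * c τ * a τ))
          * (u.2 2 * v.2 2)
        + c τ * (4 / c τ - 2 * b τ / c τ ^ 2
            + ((c'' τ / (2 * c τ) - c' τ ^ 2 / (2 * c τ ^ 2)) / a τ
              - a' τ * c' τ / (4 * c τ * a τ ^ 2))
            + b' τ * c' τ / (4 * b τ * c τ * a τ) + c' τ ^ 2 / (2 * c τ ^ 2 * a τ))
          * (u.2 0 * v.2 0 + u.2 1 * v.2 1) := by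
  set y₀ : ℝ × E3 := (τ, 0) with hy₀
  have hsymm : ∀ᶠ y in 𝓝 y₀, ∀ u v, G y u v = G y v u := by
    filter_upwards [hG] with y hy u v
    rw [hy, hy]; unfold locForm; ring
  have hlocN : locN (τ, (0 : E3)) = 1 := by simp [locN]
  have hG0 (u v : ℝ × E3) : G y₀ u v = -a τ * (u.1 * v.1) + b τ * (u.2 2 * v.2 2)
      + c τ * (u.2 0 * v.2 0 + u.2 1 * v.2 1) := by
    rw [hG.self_of_nhds]
    simp [locForm, locTheta, hy₀, hlocN]
  -- first derivatives near the point
  have h1 : ∀ᶠ y in 𝓝 y₀, ∀ u v z, christoffelFirst G y u v z = 1 / 2 *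
      (locForm₁ b c a' b' c' y u v z + locForm₁ b c a' b' c' y v u z
        - locForm₁ b c a' b' c' y z u v) := by
    filter_upwards [hG.eventually_nhds, (hGc.of_le (m := 1) (by norm_cast)).eventually (by simp)]
      with y hy hyc u v z
    have hd : DifferentiableAt ℝ G y := hyc.differentiableAt (by simp)
    have key (u v z : ℝ × E3) : fderiv ℝ G y u v z = locForm₁ b c a' b' c' y u v z := by
      have hf := ((hd.hasFDerivAt.clm_apply (hasFDerivAt_const v y)).clm_apply
        (hasFDerivAt_const z y))
      have e : (fun y ↦ G y v z) =ᶠ[𝓝 y] fun y ↦ locForm a b c y v z := by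
        filter_upwards [hy] with y' hy' using hy' v z
      have := (hf.congr_of_eventuallyEq e.symm).hasLineDerivAt u
      have h2 := this.unique (hasDerivAt_line_locForm y u ha hb hc v z)
      rw [← h2]; simp
    rw [christoffelFirst_apply, key, key, key]
  have h2 (w u v z : ℝ × E3) : fderiv ℝ (fun y ↦ christoffelFirst G y u v z) y₀ w = 1 / 2 *
      (locForm₂ (b τ) (c τ) (b' τ) (a'' τ) (b'' τ) (c'' τ) w u v z
        + locForm₂ (b τ) (c τ) (b' τ) (a'' τ) (b'' τ) (c'' τ) w v u z
        - locForm₂ (b τ) (c τ) (b' τ) (a'' τ) (b'' τ) (c'' τ) w z u v) := by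
    have hd := differentiableAt_christoffelFirst hGc
    have hf := (((hd.hasFDerivAt.clm_apply (hasFDerivAt_const u y₀)).clm_apply
        (hasFDerivAt_const v y₀)).clm_apply (hasFDerivAt_const z y₀))
    have e : (fun y ↦ christoffelFirst G y u v z) =ᶠ[𝓝 y₀] fun y ↦ 1 / 2 *
      (locForm₁ b c a' b' c' y u v z + locForm₁ b c a' b' c' y v u z
        - locForm₁ b c a' b' c' y z u v) := by
      filter_upwards [h1] with y' hy' using hy' u v z
    rw [hf.fderiv]
    have hl := (hf.congr_of_eventuallyEq e.symm).hasLineDerivAt w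
    have L (u v z : ℝ × E3) := hasDerivAt_line_locForm₁ hb hc ha' hb' hc' τ w u v z
    exact hl.unique ((((L u v z).add (L v u z)).sub (L z u v)).const_mul (1 / 2))
  rw [ricci_eq_sum locBasis ?_ ?_ hGc hsymm]
  · simp only [h1.self_of_nhds, h2, hG0, Fintype.sum_sum_type, Finset.univ_unique,
      Finset.sum_singleton, Fin.sum_univ_three, locBasis_inl, locBasis_inr]
    simp [locForm₁, locForm₂, locTheta, locTheta', hy₀, hlocN]
    field_simp
    ring
  · intro i j hij
    rw [hG0]
    rcases i with i | i <;> rcases j with j | j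
    · exact absurd rfl hij
    · simp [locBasis_inl, locBasis_inr]
    · simp [locBasis_inl, locBasis_inr]
    · fin_cases i <;> fin_cases j <;> simp [locBasis_inr] at hij ⊢
  · intro i
    rw [hG0]
    rcases i with i | i
    · simpa [locBasis_inl] using ha0
    · fin_cases i <;> simpa [locBasis_inr]

/-! ### The metric in a chart -/

theorem contMDiffAt_extend_symm {e : OpenPartialHomeomorph (ℝ × S3) H4}
    (he : e ∈ IsManifold.maximalAtlas I4 ∞ (ℝ × S3)) {y : ℝ × E3}
    (hy : y ∈ (e.extend I4).target) : ContMDiffAt 𝓘(ℝ, ℝ × E3) I4 ∞ (e.extend I4).symm y := by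
  have ho : IsOpen (e.extend I4).target := e.isOpen_extend_target
  have h := contMDiffOn_extend_symm he
  rw [← e.extend_target'] at h
  exact h.contMDiffAt (ho.mem_nhds hy)

/-- The inclusion `ℝ × S³ → ℝ × ℝ⁴` in the chart `e`. -/
def locEmb (e : OpenPartialHomeomorph (ℝ × S3) H4) (y : ℝ × E3) : ℝ × E4 :=
  emb ((e.extend I4).symm y)

theorem contDiffAt_locEmb {e : OpenPartialHomeomorph (ℝ × S3) H4}
    (he : e ∈ IsManifold.maximalAtlas I4 ∞ (ℝ × S3)) {y : ℝ × E3}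
    (hy : y ∈ (e.extend I4).target) : ContDiffAt ℝ ∞ (locEmb e) y :=
  ((contMDiff_emb _).comp y (contMDiffAt_extend_symm he hy)).contDiffAt

theorem fderiv_locEmb {e : OpenPartialHomeomorph (ℝ × S3) H4}
    (he : e ∈ IsManifold.maximalAtlas I4 ∞ (ℝ × S3)) {y : ℝ × E3}
    (hy : y ∈ (e.extend I4).target) (u : ℝ × E3) :
    fderiv ℝ (locEmb e) y u = mvfderiv I4 emb ((e.extend I4).symm y)
      (mfderiv 𝓘(ℝ, ℝ × E3) I4 (e.extend I4).symm y u) := by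
  have h := mfderiv_comp_apply (I := 𝓘(ℝ, ℝ × E3)) (I' := I4) (I'' := 𝓘(ℝ, ℝ × E4)) y
    (contMDiff_emb.mdifferentiable (by simp) _)
    ((contMDiffAt_extend_symm he hy).mdifferentiableAt (by simp)) u
  rw [mfderiv_eq_fderiv] at h
  exact h

theorem localMetric_taubNUT {l E : ℝ} {e : OpenPartialHomeomorph (ℝ × S3) H4}
    (he : e ∈ IsManifold.maximalAtlas I4 ∞ (ℝ × S3)) {y : ℝ × E3}
    (hy : y ∈ (e.extend I4).target) (u v : ℝ × E3) :
    localMetric I4 (taubNUT l E) e y u v =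
      ambTaubNUT l E (locEmb e y) (fderiv ℝ (locEmb e) y u) (fderiv ℝ (locEmb e) y v) := by
  rw [fderiv_locEmb he hy, fderiv_locEmb he hy]
  simp only [localMetric]
  rw [taubNUT_eq]
  rfl

theorem contDiff_ambTaubNUT {l E : ℝ} (hE : E ∈ Ioo (2 / 3) ((2 + Real.sqrt 3) / 3)) :
    ContDiff ℝ ∞ (ambTaubNUT l E) := by
  have h1 := (contDiff_cTau (l := l) hE)
  have h2 := (contDiff_cFib (l := l) (E := E))
  have h3 := (contDiff_cBase (l := l) (E := E))
  exact contDiff_ambForm.comp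
    (f := fun q : ℝ × E4 ↦ (cTau l E q.1, cFib l E q.1, cBase l E q.1, q.2)) (by fun_prop)

theorem contDiffAt_localMetric {l E : ℝ} (hE : E ∈ Ioo (2 / 3) ((2 + Real.sqrt 3) / 3))
    {e : OpenPartialHomeomorph (ℝ × S3) H4}
    (he : e ∈ IsManifold.maximalAtlas I4 ∞ (ℝ × S3)) {y : ℝ × E3}
    (hy : y ∈ (e.extend I4).target) : ContDiffAt ℝ ∞ (localMetric I4 (taubNUT l E) e) y := by
  have hF := contDiffAt_locEmb he hy
  have hF' : ContDiffAt ℝ ∞ (fderiv ℝ (locEmb e)) y := hF.fderiv_right (by simp)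
  have hG : ContDiffAt ℝ ∞ (fun y ↦ ambTaubNUT l E (locEmb e y)) y :=
    (contDiff_ambTaubNUT hE).contDiffAt.comp y hF
  have h : ContDiffAt ℝ ∞ (fun y ↦ pullBilin (fderiv ℝ (locEmb e) y)
      (ambTaubNUT l E (locEmb e y))) y := by
    have : (fun y ↦ pullBilin (fderiv ℝ (locEmb e) y) (ambTaubNUT l E (locEmb e y))) =
      fun y ↦ ((ContinuousLinearMap.compL ℝ (ℝ × E3) (ℝ × E4) ℝ).flip (fderiv ℝ (locEmb e) y)) ∘L
        (ambTaubNUT l E (locEmb e y) ∘L fderiv ℝ (locEmb e) y) := rfl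
    rw [this]
    fun_prop
  refine h.congr_of_eventuallyEq ?_
  filter_upwards [e.isOpen_extend_target.mem_nhds hy] with y' hy'
  refine ContinuousLinearMap.ext fun u ↦ ContinuousLinearMap.ext fun v ↦ ?_
  rw [localMetric_taubNUT he hy', pullBilin_apply]

/-! ### Charts adapted to the Hopf fibration -/

/-- For `x₀ = (z₀, w₀)`, the vector `(w̄₀, -z̄₀)`, which spans the Hermitian orthogonal complement
of `x₀` in `ℂ²`. -/
def hopfPerp (x : E4) : E4 := !₂[x 2, -x 3, -x 0, x 1]

/-- The decomposition of a vector in the orthonormal frame `x, i x, p, i p`. -/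
theorem hopf_frame (x v : E4) :
    inner ℝ x v • x + inner ℝ (hopfRot x) v • hopfRot x + inner ℝ (hopfPerp x) v • hopfPerp x
      + inner ℝ (hopfRot (hopfPerp x)) v • hopfRot (hopfPerp x) = (inner ℝ x x : ℝ) • v := by
  ext i
  simp only [inner_eq4]
  fin_cases i <;> simp [hopfPerp, hopfRot] <;> ring

/-- The vector `x₀ + ζ p`, for `ζ = y₀ + i y₁`. -/
def hopfLift (x : E4) (y : E3) : E4 :=
  x + y 0 • hopfPerp x + y 1 • hopfRot (hopfPerp x)

/-- The parametrization `(ζ, β) ↦ e^{iβ} (x₀ + ζ p) / √(1 + |ζ|²)` of the sphere. -/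
def hopfParam (x : E4) (y : E3) : E4 :=
  (Real.sqrt (1 + y 0 ^ 2 + y 1 ^ 2))⁻¹ •
    (Real.cos (y 2) • hopfLift x y + Real.sin (y 2) • hopfRot (hopfLift x y))

theorem inner_hopfLift {x : E4} (hx : inner ℝ x x = (1 : ℝ)) (y : E3) :
    inner ℝ (hopfLift x y) (hopfLift x y) = 1 + y 0 ^ 2 + y 1 ^ 2 := by
  have : inner ℝ (hopfLift x y) (hopfLift x y) = (1 + y 0 ^ 2 + y 1 ^ 2) * inner ℝ x x := by
    simp only [inner_eq4]
    simp [hopfLift, hopfPerp, hopfRot]; ring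
  rw [this, hx, mul_one]

theorem inner_rotate (x y : E4) (β : ℝ) :
    inner ℝ (Real.cos β • x + Real.sin β • hopfRot x) (Real.cos β • y + Real.sin β • hopfRot y) =
      inner ℝ x y := by
  simp only [inner_add_left, inner_add_right, real_inner_smul_left, real_inner_smul_right,
    inner_hopfRot_hopfRot, inner_hopfRot_comm x y]
  linear_combination (inner ℝ x y) * Real.cos_sq_add_sin_sq β

theorem contDiff_hopfParam (x : E4) : ContDiff ℝ ∞ (hopfParam x) := by
  have h1 : ContDiff ℝ ∞ (hopfLift x) := by unfold hopfLift; fun_prop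
  have h2 : ContDiff ℝ ∞ (fun y ↦ hopfRot (hopfLift x y)) := hopfRotL.contDiff.comp h1
  have h3 : ContDiff ℝ ∞ (fun y : E3 ↦ (Real.sqrt (1 + y 0 ^ 2 + y 1 ^ 2))⁻¹) := by
    refine ContDiff.inv (ContDiff.sqrt (by fun_prop) fun y ↦ by positivity) fun y ↦ ?_
    exact (Real.sqrt_pos.2 (by positivity)).ne'
  have h4 : ContDiff ℝ ∞ (fun y : E3 ↦ Real.cos (y 2)) := by fun_prop
  have h5 : ContDiff ℝ ∞ (fun y : E3 ↦ Real.sin (y 2)) := by fun_prop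
  unfold hopfParam
  exact h3.smul ((h4.smul h1).add (h5.smul h2))

theorem hopfParam_mem (x : S3) (y : E3) : hopfParam x y ∈ Metric.sphere (0 : E4) 1 := by
  have hn : 0 < 1 + y 0 ^ 2 + y 1 ^ 2 := by positivity
  have h : inner ℝ (hopfParam x y) (hopfParam x y) = (1 : ℝ) := by
    rw [hopfParam, real_inner_smul_left, real_inner_smul_right, inner_rotate,
      inner_hopfLift (inner_coe_self x)]
    have h2 := Real.sq_sqrt hn.le
    have h3 := (Real.sqrt_pos.2 hn).ne'
    field_simp
    exact h2.symm
  rw [real_inner_self_eq_norm_sq] at h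
  rw [mem_sphere_zero_iff_norm]
  nlinarith [norm_nonneg (hopfParam (x : E4) y)]

/-- The inverse of `hopfParam`, where the Hermitian product of the argument with `x₀` has positive
real part. -/
def hopfCoord (x v : E4) : E3 :=
  let w₀ : ℝ := inner ℝ x v
  let w₁ : ℝ := inner ℝ (hopfRot x) v
  let z₀ : ℝ := inner ℝ (hopfPerp x) v
  let z₁ : ℝ := inner ℝ (hopfRot (hopfPerp x)) v
  !₂[(z₀ * w₀ + z₁ * w₁) / (w₀ ^ 2 + w₁ ^ 2), (z₁ * w₀ - z₀ * w₁) / (w₀ ^ 2 + w₁ ^ 2),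
    Real.arctan (w₁ / w₀)]

/-- The components of `hopfParam` in the frame `x, i x, p, i p`, from which `hopfCoord` recovers the
coordinates. -/
theorem hopf_products {x : E4} (hx : inner ℝ x x = (1 : ℝ)) (y : E3) :
    let s := (Real.sqrt (1 + y 0 ^ 2 + y 1 ^ 2))⁻¹
    inner ℝ x (hopfParam x y) = s * Real.cos (y 2) ∧
    inner ℝ (hopfRot x) (hopfParam x y) = s * Real.sin (y 2) ∧
    inner ℝ (hopfPerp x) (hopfParam x y) = s * (y 0 * Real.cos (y 2) - y 1 * Real.sin (y 2)) ∧
    inner ℝ (hopfRot (hopfPerp x)) (hopfParam x y) =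
      s * (y 0 * Real.sin (y 2) + y 1 * Real.cos (y 2)) := by
  intro s
  have h : x 0 ^ 2 + x 1 ^ 2 + x 2 ^ 2 + x 3 ^ 2 = 1 := by
    rw [inner_eq4] at hx; linarith
  simp only [inner_eq4, hopfParam, hopfLift, hopfPerp, hopfRot]
  simp
  refine ⟨?_, ?_, ?_, ?_⟩
  · linear_combination (s * Real.cos (y 2)) * h
  · linear_combination (s * Real.sin (y 2)) * h
  · linear_combination (s * (y 0 * Real.cos (y 2) - y 1 * Real.sin (y 2))) * h
  · linear_combination (s * (y 0 * Real.sin (y 2) + y 1 * Real.cos (y 2))) * h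

theorem hopfCoord_hopfParam {x : E4} (hx : inner ℝ x x = (1 : ℝ)) {y : E3}
    (hy : y 2 ∈ Ioo (-(Real.pi / 2)) (Real.pi / 2)) : hopfCoord x (hopfParam x y) = y := by
  obtain ⟨h1, h2, h3, h4⟩ := hopf_products hx y
  have hn : 0 < 1 + y 0 ^ 2 + y 1 ^ 2 := by positivity
  have hs : (Real.sqrt (1 + y 0 ^ 2 + y 1 ^ 2))⁻¹ ≠ 0 := (inv_pos.2 (Real.sqrt_pos.2 hn)).ne'
  have hc : Real.cos (y 2) ≠ 0 := (Real.cos_pos_of_mem_Ioo hy).ne'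
  have hcs := Real.cos_sq_add_sin_sq (y 2)
  simp only [hopfCoord, h1, h2, h3, h4]
  set s := (Real.sqrt (1 + y 0 ^ 2 + y 1 ^ 2))⁻¹
  have hd : (s * Real.cos (y 2)) ^ 2 + (s * Real.sin (y 2)) ^ 2 = s ^ 2 := by
    linear_combination s ^ 2 * hcs
  rw [hd]
  ext i
  fin_cases i
  · simp
    field_simp
    linear_combination y 0 * hcs
  · simp
    field_simp
    linear_combination y 1 * hcs
  · simp
    rw [mul_div_mul_left _ _ hs, ← Real.tan_eq_sin_div_cos, Real.arctan_tan hy.1 hy.2]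

theorem hopfParam_hopfCoord {x v : E4} (hx : inner ℝ x x = (1 : ℝ)) (hv : inner ℝ v v = (1 : ℝ))
    (h : 0 < inner ℝ x v) : hopfParam x (hopfCoord x v) = v := by
  have hf := hopf_frame x v
  rw [hx, one_smul] at hf
  set w₀ : ℝ := inner ℝ x v with hw0
  set w₁ : ℝ := inner ℝ (hopfRot x) v with hw1
  set z₀ : ℝ := inner ℝ (hopfPerp x) v with hz0
  set z₁ : ℝ := inner ℝ (hopfRot (hopfPerp x)) v with hz1
  have hsum : w₀ ^ 2 + w₁ ^ 2 + z₀ ^ 2 + z₁ ^ 2 = 1 := by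
    have : inner ℝ v (w₀ • x + w₁ • hopfRot x + z₀ • hopfPerp x + z₁ • hopfRot (hopfPerp x))
      = (1 : ℝ) := by rw [hf, hv]
    simp only [inner_add_right, real_inner_smul_right] at this
    rw [real_inner_comm x v, real_inner_comm (hopfRot x) v, real_inner_comm (hopfPerp x) v,
      real_inner_comm (hopfRot (hopfPerp x)) v, ← hw0, ← hw1, ← hz0, ← hz1] at this
    linarith
  have hr : 0 < w₀ ^ 2 + w₁ ^ 2 := by positivity
  set r := Real.sqrt (w₀ ^ 2 + w₁ ^ 2) with hrdef
  have hr0 : 0 < r := Real.sqrt_pos.2 hr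
  have hr2 : r ^ 2 = w₀ ^ 2 + w₁ ^ 2 := Real.sq_sqrt hr.le
  have e1 : Real.sqrt (1 + (w₁ / w₀) ^ 2) = r / w₀ := by
    rw [Real.sqrt_eq_iff_mul_self_eq (by positivity) (by positivity)]
    field_simp
    linarith
  have ec : Real.cos (Real.arctan (w₁ / w₀)) = w₀ / r := by
    rw [Real.cos_arctan, e1, one_div_div]
  have es : Real.sin (Real.arctan (w₁ / w₀)) = w₁ / r := by
    rw [Real.sin_arctan, e1]; field_simp
  have en : Real.sqrt (1 + ((z₀ * w₀ + z₁ * w₁) / (w₀ ^ 2 + w₁ ^ 2)) ^ 2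
      + ((z₁ * w₀ - z₀ * w₁) / (w₀ ^ 2 + w₁ ^ 2)) ^ 2) = r⁻¹ := by
    rw [Real.sqrt_eq_iff_mul_self_eq (by positivity) (by positivity)]
    rw [← mul_inv, ← pow_two, hr2]
    field_simp
    linear_combination (w₀ ^ 2 + w₁ ^ 2) * hsum
  refine Eq.trans ?_ hf
  simp only [hopfParam, hopfCoord, hopfLift, ← hw0, ← hw1, ← hz0, ← hz1]
  simp only [Matrix.cons_val, ec, es, en, inv_inv, hopfRot_add, hopfRot_smul,
    hopfRot_hopfRot, smul_add, smul_smul, smul_neg]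
  have c1 : r * (w₀ / r) = w₀ := by field_simp
  have c2 : r * (w₁ / r) = w₁ := by field_simp
  have c3 : w₀ * ((z₀ * w₀ + z₁ * w₁) / (w₀ ^ 2 + w₁ ^ 2))
      - w₁ * ((z₁ * w₀ - z₀ * w₁) / (w₀ ^ 2 + w₁ ^ 2)) = z₀ := by field_simp; ring
  have c4 : w₀ * ((z₁ * w₀ - z₀ * w₁) / (w₀ ^ 2 + w₁ ^ 2))
      + w₁ * ((z₀ * w₀ + z₁ * w₁) / (w₀ ^ 2 + w₁ ^ 2)) = z₁ := by field_simp; ring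
  generalize (z₀ * w₀ + z₁ * w₁) / (w₀ ^ 2 + w₁ ^ 2) = Z₀ at *
  generalize (z₁ * w₀ - z₀ * w₁) / (w₀ ^ 2 + w₁ ^ 2) = Z₁ at *
  linear_combination (norm := module) c1 • (x + Z₀ • hopfPerp x + Z₁ • hopfRot (hopfPerp x))
    + c2 • (hopfRot x + Z₀ • hopfRot (hopfPerp x) - Z₁ • hopfPerp x)
    + c3 • hopfPerp x + c4 • hopfRot (hopfPerp x)

/-- The derivative of `hopfLift x`. -/
def hopfLift' (x : E4) (u : E3) : E4 := u 0 • hopfPerp x + u 1 • hopfRot (hopfPerp x)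

theorem hasDerivAt_hopfParam (x : E4) (y u : E3) :
    HasDerivAt (fun t : ℝ ↦ hopfParam x (y + t • u))
      (let s := (Real.sqrt (1 + y 0 ^ 2 + y 1 ^ 2))⁻¹
       let w := (-(s * ((y 0 * u 0 + y 1 * u 1) / (1 + y 0 ^ 2 + y 1 ^ 2)))) • hopfLift x y
        + s • hopfLift' x u + (s * u 2) • hopfRot (hopfLift x y)
       Real.cos (y 2) • w + Real.sin (y 2) • hopfRot w) 0 := by
  have hn : 0 < 1 + y 0 ^ 2 + y 1 ^ 2 := by positivity
  have hi (i : Fin 3) : HasDerivAt (fun t : ℝ ↦ (y + t • u) i) (u i) 0 := by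
    simpa using ((hasDerivAt_id (0 : ℝ)).mul_const (u i)).const_add (y i)
  have hN : HasDerivAt (fun t : ℝ ↦ 1 + (y + t • u) 0 ^ 2 + (y + t • u) 1 ^ 2)
      (2 * (y 0 * u 0 + y 1 * u 1)) 0 := by
    refine ((((hi 0).pow 2).const_add 1).add ((hi 1).pow 2)).congr_deriv ?_
    simp; ring
  have hsq := Real.sqrt_pos.2 hn
  have hS := (hN.sqrt (by simpa using hn.ne')).inv (by simpa using hsq.ne')
  have hL : HasDerivAt (fun t : ℝ ↦ hopfLift x (y + t • u)) (hopfLift' x u) 0 :=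
    (((hi 0).smul_const (hopfPerp x)).const_add x).add ((hi 1).smul_const (hopfRot (hopfPerp x)))
  have hI : HasDerivAt (fun t : ℝ ↦ hopfRot (hopfLift x (y + t • u))) (hopfRot (hopfLift' x u)) 0 :=
    hopfRotL.hasFDerivAt.comp_hasDerivAt (0 : ℝ) hL
  refine (hS.smul (((hi 2).cos.smul hL).add ((hi 2).sin.smul hI))).congr_deriv ?_
  simp only [zero_smul, add_zero, hopfRot_add, hopfRot_smul, hopfRot_hopfRot, Pi.inv_apply,
    Pi.add_apply, Pi.smul_apply']
  have e : -(2 * (y 0 * u 0 + y 1 * u 1) / (2 * √(1 + y 0 ^ 2 + y 1 ^ 2))) /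
      √(1 + y 0 ^ 2 + y 1 ^ 2) ^ 2 =
      -((√(1 + y 0 ^ 2 + y 1 ^ 2))⁻¹ * ((y 0 * u 0 + y 1 * u 1) / (1 + y 0 ^ 2 + y 1 ^ 2))) := by
    rw [Real.sq_sqrt hn.le]; field_simp
  rw [e]
  module

theorem fderiv_hopfParam (x : E4) (y u : E3) :
    fderiv ℝ (hopfParam x) y u =
      (let s := (Real.sqrt (1 + y 0 ^ 2 + y 1 ^ 2))⁻¹
       let w := (-(s * ((y 0 * u 0 + y 1 * u 1) / (1 + y 0 ^ 2 + y 1 ^ 2)))) • hopfLift x y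
        + s • hopfLift' x u + (s * u 2) • hopfRot (hopfLift x y)
       Real.cos (y 2) • w + Real.sin (y 2) • hopfRot w) := by
  have h := ((contDiff_hopfParam x).differentiable (by simp) y).hasFDerivAt.hasLineDerivAt u
  exact h.unique (hasDerivAt_hopfParam x y u)

theorem hopfLift_products {x : E4} (hx : inner ℝ x x = (1 : ℝ)) (y u v : E3) :
    inner ℝ (hopfLift x y) (hopfLift' x u) = y 0 * u 0 + y 1 * u 1 ∧
    inner ℝ (hopfRot (hopfLift x y)) (hopfLift' x u) = y 0 * u 1 - y 1 * u 0 ∧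
    inner ℝ (hopfLift' x u) (hopfLift' x v) = u 0 * v 0 + u 1 * v 1 := by
  have h : x 0 ^ 2 + x 1 ^ 2 + x 2 ^ 2 + x 3 ^ 2 = 1 := by
    rw [inner_eq4] at hx; linarith
  simp only [inner_eq4]
  simp [hopfLift, hopfLift', hopfPerp, hopfRot]
  refine ⟨?_, ?_, ?_⟩
  · linear_combination (y 0 * u 0 + y 1 * u 1) * h
  · linear_combination (y 0 * u 1 - y 1 * u 0) * h
  · linear_combination (u 0 * v 0 + u 1 * v 1) * h

/-- The ambient forms are invariant under rotation of the Hopf fibres. -/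
theorem ambForm_rotate (a b c β : ℝ) (x : E4) (τ τ' : ℝ) (u v : E4) :
    ambForm a b c (Real.cos β • x + Real.sin β • hopfRot x)
      (τ, Real.cos β • u + Real.sin β • hopfRot u) (τ', Real.cos β • v + Real.sin β • hopfRot v) =
      ambForm a b c x (τ, u) (τ', v) := by
  have hr (y : E4) : inner ℝ (hopfRot (Real.cos β • x + Real.sin β • hopfRot x))
      (Real.cos β • y + Real.sin β • hopfRot y) = inner ℝ (hopfRot x) y := by
    rw [← inner_rotate (hopfRot x) y β]
    congr 1
    simp only [hopfRot_add, hopfRot_smul]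
  simp only [ambForm_apply, hr, inner_rotate]

/-- The ambient form in the coordinates `(τ, ζ, β)`. -/
theorem ambForm_hopfParam {x : E4} (hx : inner ℝ x x = (1 : ℝ)) (a b c : ℝ → ℝ)
    (y u v : ℝ × E3) :
    ambForm (a y.1) (b y.1) (c y.1) (hopfParam x y.2) (u.1, fderiv ℝ (hopfParam x) y.2 u.2)
      (v.1, fderiv ℝ (hopfParam x) y.2 v.2) = locForm a b c y u v := by
  have hn : 0 < 1 + y.2 0 ^ 2 + y.2 1 ^ 2 := by positivity
  have hsq := Real.sqrt_pos.2 hn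
  have hs2 := Real.sq_sqrt hn.le
  have hp : hopfParam x y.2 = Real.cos (y.2 2) • (Real.sqrt (1 + y.2 0 ^ 2 + y.2 1 ^ 2))⁻¹ •
      hopfLift x y.2 + Real.sin (y.2 2) • hopfRot ((Real.sqrt (1 + y.2 0 ^ 2 + y.2 1 ^ 2))⁻¹ •
      hopfLift x y.2) := by
    rw [hopfParam, hopfRot_smul]; module
  rw [fderiv_hopfParam, fderiv_hopfParam, hp, ambForm_rotate, ambForm_apply]
  obtain ⟨p1, p2, p3⟩ := hopfLift_products hx y.2 u.2 v.2
  obtain ⟨q1, q2, -⟩ := hopfLift_products hx y.2 v.2 v.2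
  have q1' : inner ℝ (hopfLift' x u.2) (hopfLift x y.2) = _ := (real_inner_comm _ _).trans p1
  have q2' : inner ℝ (hopfLift' x u.2) (hopfRot (hopfLift x y.2)) = _ :=
    (real_inner_comm _ _).trans p2
  have hh := inner_hopfLift hx y.2
  have hI (z : E4) : inner ℝ z (hopfRot z) = (0 : ℝ) := by
    rw [real_inner_comm]; exact inner_hopfRot_self z
  simp only [hopfRot_smul, real_inner_smul_left, real_inner_smul_right,
    inner_add_left, inner_add_right, p2, p3, q1, q2, q1', q2', hh, inner_hopfRot_self, hI,
    inner_hopfRot_hopfRot]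
  simp only [locForm, locTheta, locN]
  have h0 : y.2 0 ^ 2 = (1 + y.2 0 ^ 2 + y.2 1 ^ 2) - 1 - y.2 1 ^ 2 := by ring
  set n := 1 + y.2 0 ^ 2 + y.2 1 ^ 2 with hndef
  have hs : (√n)⁻¹ ^ 2 = n⁻¹ := by rw [inv_pow, hs2]
  generalize (√n)⁻¹ = s at hs
  have hs4 : s ^ 4 = n⁻¹ ^ 2 := by rw [← hs]; ring
  field_simp
  rw [hs4]
  field_simp
  rw [hndef]
  ring

theorem contDiffAt_hopfCoord (x : E4) {v : E4} (h : 0 < inner ℝ x v) :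
    ContDiffAt ℝ ∞ (hopfCoord x) v := by
  have hi (z : E4) : ContDiffAt ℝ ∞ (fun v : E4 ↦ (inner ℝ z v : ℝ)) v :=
    contDiffAt_const.inner ℝ contDiffAt_id
  have h0 := h.ne'
  have h1 : (inner ℝ x v : ℝ) ^ 2 + (inner ℝ (hopfRot x) v) ^ 2 ≠ 0 := by positivity
  rw [contDiffAt_euclidean]
  intro i
  fin_cases i
  · exact (((hi _).mul (hi _)).add ((hi _).mul (hi _))).div (((hi _).pow 2).add ((hi _).pow 2)) h1
  · exact (((hi _).mul (hi _)).sub ((hi _).mul (hi _))).div (((hi _).pow 2).add ((hi _).pow 2)) h1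
  · exact Real.contDiff_arctan.contDiffAt.comp v ((hi _).div (hi _) h0)

/-- The chart of `S³` around `x₀` with inverse `hopfParam x₀`. -/
def hopfChart (x₀ : S3) : OpenPartialHomeomorph S3 E3 where
  toFun v := hopfCoord x₀ v
  invFun y := ⟨hopfParam x₀ y, hopfParam_mem x₀ y⟩
  source := {v | 0 < inner ℝ (x₀ : E4) (v : E4)}
  target := {y | y 2 ∈ Ioo (-(Real.pi / 2)) (Real.pi / 2)}
  map_source' v hv := by
    simp only [hopfCoord, mem_ofPred_eq]
    exact ⟨Real.neg_pi_div_two_lt_arctan _, Real.arctan_lt_pi_div_two _⟩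
  map_target' y hy := by
    have hn : 0 < 1 + y 0 ^ 2 + y 1 ^ 2 := by positivity
    simp only [mem_ofPred_eq]
    rw [(hopf_products (inner_coe_self x₀) y).1]
    exact mul_pos (inv_pos.2 (Real.sqrt_pos.2 hn)) (Real.cos_pos_of_mem_Ioo hy)
  left_inv' v hv := Subtype.ext (hopfParam_hopfCoord (inner_coe_self x₀) (inner_coe_self v) hv)
  right_inv' y hy := hopfCoord_hopfParam (inner_coe_self x₀) hy
  open_source := isOpen_lt continuous_const (by fun_prop)
  open_target := isOpen_Ioo.preimage (by fun_prop)
  continuousOn_toFun v hv :=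
    ((contDiffAt_hopfCoord (x₀ : E4) hv).continuousAt.comp
      continuous_subtype_val.continuousAt).continuousWithinAt
  continuousOn_invFun :=
    ((contDiff_hopfParam (x₀ : E4)).continuous.subtype_mk _).continuousOn

theorem contMDiffOn_hopfChart (x₀ : S3) :
    ContMDiffOn (𝓡 3) (𝓡 3) ∞ (hopfChart x₀) (hopfChart x₀).source := fun v hv ↦
  ((contDiffAt_hopfCoord (x₀ : E4) hv).contMDiffAt.comp v (contMDiff_coe v)).contMDiffWithinAt

theorem contMDiffOn_hopfChart_symm (x₀ : S3) :
    ContMDiffOn (𝓡 3) (𝓡 3) ∞ (hopfChart x₀).symm (hopfChart x₀).target :=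
  ((contDiff_hopfParam (x₀ : E4)).contMDiff.codRestrict_sphere (hopfParam_mem x₀)).contMDiffOn

/-- The chart `(τ, ζ, β)` of `ℝ × S³` around the fibre `ℝ × {x₀}`. -/
def prodChart (x₀ : S3) : OpenPartialHomeomorph (ℝ × S3) H4 :=
  (OpenPartialHomeomorph.refl ℝ).prod (hopfChart x₀)

theorem prodChart_mem_maximalAtlas (x₀ : S3) :
    prodChart x₀ ∈ IsManifold.maximalAtlas I4 ∞ (ℝ × S3) := by
  apply OpenPartialHomeomorph.mem_maximalAtlas_of_contMDiffOn
  · have h := (contMDiff_id (I := 𝓘(ℝ, ℝ)) (n := ∞) (M := ℝ)).contMDiffOn (s := univ) |>.prodMap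
      (contMDiffOn_hopfChart x₀)
    rw [chartedSpaceSelf_prod] at h
    exact h
  · have h := (contMDiff_id (I := 𝓘(ℝ, ℝ)) (n := ∞) (M := ℝ)).contMDiffOn (s := univ) |>.prodMap
      (contMDiffOn_hopfChart_symm x₀)
    rw [chartedSpaceSelf_prod] at h
    exact h

theorem locEmb_prodChart (x₀ : S3) (y : ℝ × E3) :
    locEmb (prodChart x₀) y = (y.1, hopfParam x₀ y.2) := by
  rfl

theorem hopfCoord_self {x : E4} (hx : inner ℝ x x = (1 : ℝ)) : hopfCoord x x = 0 := by
  have h := hopfCoord_hopfParam hx (y := 0) (by simp [Real.pi_pos])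
  have e : hopfParam x 0 = x := by simp [hopfParam, hopfLift]
  rwa [e] at h

theorem prodChart_extend_self (τ : ℝ) (x₀ : S3) :
    (prodChart x₀).extend I4 (τ, x₀) = (τ, (0 : E3)) :=
  Prod.ext rfl (hopfCoord_self (inner_coe_self x₀))

theorem prodChart_extend_target (x₀ : S3) {y : ℝ × E3}
    (hy : y.2 2 ∈ Ioo (-(Real.pi / 2)) (Real.pi / 2)) : y ∈ ((prodChart x₀).extend I4).target := by
  rw [OpenPartialHomeomorph.extend_target]
  refine ⟨⟨mem_univ _, hy⟩, ?_⟩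
  simp

/-- In adapted coordinates the metric does not depend on the centre `x₀`. -/
theorem localMetric_prodChart (l E : ℝ) (x₀ : S3) {y : ℝ × E3}
    (hy : y.2 2 ∈ Ioo (-(Real.pi / 2)) (Real.pi / 2)) (u v : ℝ × E3) :
    localMetric I4 (taubNUT l E) (prodChart x₀) y u v =
      locForm (cTau l E) (cFib l E) (cBase l E) y u v := by
  have hd (w : ℝ × E3) : fderiv ℝ (locEmb (prodChart x₀)) y w =
      (w.1, fderiv ℝ (hopfParam x₀) y.2 w.2) := by
    have h1 := ((contDiff_hopfParam (x₀ : E4)).differentiable (by simp) y.2).hasFDerivAt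
    have h2 := (hasFDerivAt_fst (𝕜 := ℝ) (p := y)).prodMk (h1.comp y hasFDerivAt_snd)
    have : HasFDerivAt (locEmb (prodChart x₀)) _ y := h2
    rw [this.fderiv]; rfl
  rw [localMetric_taubNUT (prodChart_mem_maximalAtlas x₀) (prodChart_extend_target x₀ hy),
    locEmb_prodChart, hd, hd, ambTaubNUT]
  exact ambForm_hopfParam (inner_coe_self x₀) _ _ _ y u v

/-! ### The Einstein equation -/

/-- The derivative of `A`. -/
def taubNUTPoly₁ (E τ : ℝ) : ℝ := 4 * E * τ ^ 3 - 2 * (4 - 6 * E) * τ - (8 * E - 8)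

/-- The second derivative of `A`. -/
def taubNUTPoly₂ (E τ : ℝ) : ℝ := 12 * E * τ ^ 2 - 2 * (4 - 6 * E)

theorem hasDerivAt_taubNUTPoly (E τ : ℝ) : HasDerivAt (taubNUTPoly E) (taubNUTPoly₁ E τ) τ := by
  have h := (((((hasDerivAt_pow 4 τ).const_mul E).sub
    ((hasDerivAt_pow 2 τ).const_mul (4 - 6 * E))).sub
    ((hasDerivAt_id τ).const_mul (8 * E - 8))).add_const 4).sub_const (3 * E)
  refine h.congr_deriv ?_
  simp [taubNUTPoly₁]; ring

theorem hasDerivAt_taubNUTPoly₁ (E τ : ℝ) :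
    HasDerivAt (taubNUTPoly₁ E) (taubNUTPoly₂ E τ) τ := by
  have h := (((hasDerivAt_pow 3 τ).const_mul (4 * E)).sub
    ((hasDerivAt_id τ).const_mul (2 * (4 - 6 * E)))).sub_const (8 * E - 8)
  refine h.congr_deriv ?_
  simp [taubNUTPoly₂]; ring

theorem hasDerivAt_sq_add_one (τ : ℝ) : HasDerivAt (fun τ : ℝ ↦ τ ^ 2 + 1) (2 * τ) τ := by
  simpa using (hasDerivAt_pow 2 τ).add_const 1

/-- The derivative of `cTau`. -/
def cTau₁ (l E τ : ℝ) : ℝ := l ^ 2 * E *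
  ((2 * τ * taubNUTPoly E τ - (τ ^ 2 + 1) * taubNUTPoly₁ E τ) / taubNUTPoly E τ ^ 2)

/-- The derivative of `cFib`. -/
def cFib₁ (l E τ : ℝ) : ℝ := l ^ 2 * E *
  ((taubNUTPoly₁ E τ * (τ ^ 2 + 1) - taubNUTPoly E τ * (2 * τ)) / (τ ^ 2 + 1) ^ 2)

/-- The derivative of `cBase`. -/
def cBase₁ (l E τ : ℝ) : ℝ := l ^ 2 * E * (2 * τ)

theorem hasDerivAt_cTau {l E : ℝ} (hE : E ∈ Ioo (2 / 3) ((2 + Real.sqrt 3) / 3)) (τ : ℝ) :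
    HasDerivAt (cTau l E) (cTau₁ l E τ) τ :=
  ((hasDerivAt_sq_add_one τ).div (hasDerivAt_taubNUTPoly E τ)
    (taubNUTPoly_pos hE τ).ne').const_mul (l ^ 2 * E)

theorem hasDerivAt_cFib (l E τ : ℝ) : HasDerivAt (cFib l E) (cFib₁ l E τ) τ :=
  ((hasDerivAt_taubNUTPoly E τ).div (hasDerivAt_sq_add_one τ) (by positivity)).const_mul (l ^ 2 * E)

theorem hasDerivAt_cBase (l E τ : ℝ) : HasDerivAt (cBase l E) (cBase₁ l E τ) τ :=
  (hasDerivAt_sq_add_one τ).const_mul (l ^ 2 * E)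

/-- The second derivative of `cFib`. -/
def cFib₂ (l E τ : ℝ) : ℝ := l ^ 2 * E *
  (((taubNUTPoly₂ E τ * (τ ^ 2 + 1) - taubNUTPoly E τ * 2) * (τ ^ 2 + 1)
    - (taubNUTPoly₁ E τ * (τ ^ 2 + 1) - taubNUTPoly E τ * (2 * τ)) * (4 * τ)) / (τ ^ 2 + 1) ^ 3)

theorem hasDerivAt_cFib₁ (l E τ : ℝ) : HasDerivAt (cFib₁ l E) (cFib₂ l E τ) τ := by
  have hq : τ ^ 2 + 1 ≠ 0 := by positivity
  refine (((((hasDerivAt_taubNUTPoly₁ E τ).mul (hasDerivAt_sq_add_one τ)).sub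
      ((hasDerivAt_taubNUTPoly E τ).mul ((hasDerivAt_id τ).const_mul 2))).div
        ((hasDerivAt_sq_add_one τ).pow 2) (pow_ne_zero 2 hq)).const_mul
          (l ^ 2 * E)).congr_deriv ?_
  simp only [cFib₂, id, Pi.sub_apply, Pi.mul_apply, Pi.pow_apply]
  field_simp
  ring

theorem hasDerivAt_cBase₁ (l E τ : ℝ) : HasDerivAt (cBase₁ l E) (l ^ 2 * E * 2) τ :=
  (((hasDerivAt_id τ).const_mul 2).const_mul (l ^ 2 * E)).congr_deriv (by ring)

/-- The components of the Einstein equation for the coefficients of the metric. They are the three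
coefficients in `ricci_locForm`, and hold identically in `τ` and `E` after substitution of `A`. -/
theorem einstein_coefficients {l E : ℝ} (τ : ℝ) (hl : l ≠ 0) (hE : E ≠ 0)
    (hA : taubNUTPoly E τ ≠ 0) :
    let a := cTau l E τ
    let a' := cTau₁ l E τ
    let b := cFib l E τ
    let b' := cFib₁ l E τ
    let b'' := cFib₂ l E τ
    let c := cBase l E τ
    let c' := cBase₁ l E τ
    let c'' := l ^ 2 * E * 2
    a * (-((b'' / (2 * b) - b' ^ 2 / (2 * b ^ 2)) / a - a' * b' / (4 * b * a ^ 2))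
      - 2 * ((c'' / (2 * c) - c' ^ 2 / (2 * c ^ 2)) / a - a' * c' / (4 * c * a ^ 2))
      - b' ^ 2 / (4 * b ^ 2 * a) - 2 * (c' ^ 2 / (4 * c ^ 2 * a))) = -(3 / l ^ 2 * a) ∧
    b * (2 * b / c ^ 2 + ((b'' / (2 * b) - b' ^ 2 / (2 * b ^ 2)) / a - a' * b' / (4 * b * a ^ 2))
      + b' ^ 2 / (4 * b ^ 2 * a) + b' * c' / (2 * b * c * a)) = 3 / l ^ 2 * b ∧
    c * (4 / c - 2 * b / c ^ 2 + ((c'' / (2 * c) - c' ^ 2 / (2 * c ^ 2)) / a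
      - a' * c' / (4 * c * a ^ 2)) + b' * c' / (4 * b * c * a) + c' ^ 2 / (2 * c ^ 2 * a))
      = 3 / l ^ 2 * c := by
  have hq : τ ^ 2 + 1 ≠ 0 := by positivity
  simp only [cTau, cTau₁, cFib, cFib₁, cFib₂, cBase, cBase₁]
  have e : taubNUTPoly E τ = E * τ ^ 4 - (4 - 6 * E) * τ ^ 2 - (8 * E - 8) * τ + 4 - 3 * E := rfl
  generalize taubNUTPoly E τ = A at *
  refine ⟨?_, ?_, ?_⟩
  · field_simp
    rw [e, taubNUTPoly₁, taubNUTPoly₂]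
    ring
  · field_simp
    rw [e, taubNUTPoly₁, taubNUTPoly₂]
    ring
  · field_simp
    rw [e, taubNUTPoly₁]
    ring

/-- Each point is tested in the adapted coordinates of which it is the centre. -/
theorem isEinstein_taubNUT {l E : ℝ} (hl : 0 < l)
    (hE : E ∈ Ioo (2 / 3) ((2 + Real.sqrt 3) / 3)) : IsEinstein I4 (taubNUT l E) (3 / l ^ 2) := by
  rintro ⟨τ, x₀⟩
  have hA := fun τ ↦ (taubNUTPoly_pos hE τ).ne'
  have hq : ∀ τ : ℝ, τ ^ 2 + 1 ≠ 0 := fun τ ↦ by positivity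
  refine ⟨prodChart x₀, prodChart_mem_maximalAtlas x₀, ⟨mem_univ _, ?_⟩, fun u v ↦ ?_⟩
  · simp [hopfChart]
  have h0 : ((τ, (0 : E3)) : ℝ × E3).2 2 ∈ Ioo (-(Real.pi / 2)) (Real.pi / 2) := by
    simp [Real.pi_pos]
  have ha' (t : ℝ) : HasDerivAt (cTau₁ l E) _ t :=
    (((((hasDerivAt_id t).const_mul 2).mul (hasDerivAt_taubNUTPoly E t)).sub
      ((hasDerivAt_sq_add_one t).mul (hasDerivAt_taubNUTPoly₁ E t))).div
        ((hasDerivAt_taubNUTPoly E t).pow 2) (pow_ne_zero 2 (hA t))).const_mul (l ^ 2 * E)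
  have hev : ∀ᶠ y in 𝓝 (τ, (0 : E3)), ∀ u v, localMetric I4 (taubNUT l E) (prodChart x₀) y u v =
      locForm (cTau l E) (cFib l E) (cBase l E) y u v := by
    have ho : IsOpen {y : ℝ × E3 | y.2 2 ∈ Ioo (-(Real.pi / 2)) (Real.pi / 2)} :=
      isOpen_Ioo.preimage (by fun_prop)
    filter_upwards [ho.mem_nhds h0] with y hy u v using localMetric_prodChart l E x₀ hy u v
  have hlE := scale_pos hl hE
  rw [prodChart_extend_self, ricci_locForm (hasDerivAt_cTau hE) (hasDerivAt_cFib l E)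
    (hasDerivAt_cBase l E) ha' (hasDerivAt_cFib₁ l E) (hasDerivAt_cBase₁ l E)
    (cTau_pos hl hE τ).ne' (cFib_pos hl hE τ).ne'
    (cBase_pos hl hE τ).ne' (contDiffAt_localMetric hE (prodChart_mem_maximalAtlas x₀)
      (prodChart_extend_target x₀ h0)) hev, localMetric_prodChart l E x₀ h0]
  obtain ⟨h1, h2, h3⟩ := einstein_coefficients (l := l) τ hl.ne' (parameter_pos hE).ne' (hA τ)
  rw [h1, h2, h3]
  simp [locForm, locTheta, locN]
  ring

/-! ### Causal curves -/

/-- The velocity of a curve in `ℝ × S³`, seen in `ℝ × ℝ⁴`. -/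
theorem hasDerivAt_emb_comp {c : ℝ → ℝ × S3} {t : ℝ}
    (hc : MDifferentiableAt 𝓘(ℝ, ℝ) I4 c t) :
    HasDerivAt (fun t ↦ emb (c t))
      (mvfderiv I4 emb (c t) (mfderiv 𝓘(ℝ, ℝ) I4 c t (1 : ℝ))) t := by
  have h : HasMFDerivAt I4 𝓘(ℝ, ℝ × E4) emb (c t) (mfderiv I4 𝓘(ℝ, ℝ × E4) emb (c t)) :=
    (contMDiff_emb.mdifferentiable (by simp) (c t)).hasMFDerivAt
  have h2 : HasFDerivAt (𝕜 := ℝ) (E := ℝ) (F := ℝ × E4) (fun t ↦ emb (c t)) _ t :=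
    hasMFDerivAt_iff_hasFDerivAt.1 (h.comp t hc.hasMFDerivAt)
  exact HasFDerivAt.hasDerivAt (𝕜 := ℝ) (F := ℝ × E4) h2

theorem hasDerivAt_of_causal {l E : ℝ} {c : ℝ → ℝ × S3}
    (hc : IsFutureCausalCurve I4 (taubNUT l E) partialTau c) (t : ℝ) :
    HasDerivAt (fun t ↦ (c t).1) (mfderiv 𝓘(ℝ, ℝ) I4 c t (1 : ℝ)).1 t ∧
    HasDerivAt (fun t ↦ ((c t).2 : E4)) (dcoe (c t).2 (mfderiv 𝓘(ℝ, ℝ) I4 c t (1 : ℝ)).2) t := by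
  have h := hasDerivAt_emb_comp (hc.1.mdifferentiable (by simp) t)
  rw [mvfderiv_emb_apply] at h
  have h1 := (hasFDerivAt_fst (𝕜 := ℝ) (E := ℝ) (F := E4) (p := emb (c t))).comp_hasDerivAt t h
  have h2 := (hasFDerivAt_snd (𝕜 := ℝ) (E := ℝ) (F := E4) (p := emb (c t))).comp_hasDerivAt t h
  exact ⟨h1, h2⟩

theorem causal_fst_pos {l E : ℝ} (hl : 0 < l) (hE : E ∈ Ioo (2 / 3) ((2 + Real.sqrt 3) / 3))
    {c : ℝ → ℝ × S3} (hc : IsFutureCausalCurve I4 (taubNUT l E) partialTau c) (t : ℝ) :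
    0 < (mfderiv 𝓘(ℝ, ℝ) I4 c t (1 : ℝ)).1 := by
  have h := (hc.2 t).2.2
  rw [taubNUT_partialTau] at h
  have := cTau_pos hl hE (c t).1
  nlinarith

/-- In a compact range of `τ`, the spatial velocity of a causal curve is bounded by `dτ/dt`. -/
theorem causal_estimate {l E : ℝ} (hl : 0 < l) (hE : E ∈ Ioo (2 / 3) ((2 + Real.sqrt 3) / 3))
    (p q : ℝ) : ∃ C : ℝ, ∀ c : ℝ → ℝ × S3,
      IsFutureCausalCurve I4 (taubNUT l E) partialTau c → ∀ t, (c t).1 ∈ Icc p q →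
        ‖dcoe (c t).2 (mfderiv 𝓘(ℝ, ℝ) I4 c t (1 : ℝ)).2‖ ≤
          C * (mfderiv 𝓘(ℝ, ℝ) I4 c t (1 : ℝ)).1 := by
  have hb (τ : ℝ) := cFib_pos hl hE τ
  have hc (τ : ℝ) := cBase_pos hl hE τ
  have ha (τ : ℝ) := cTau_pos hl hE τ
  have hcont : Continuous fun τ ↦
      Real.sqrt (cTau l E τ / cFib l E τ + cTau l E τ / cBase l E τ) :=
    (((contDiff_cTau hE).continuous.div contDiff_cFib.continuous fun τ ↦ (hb τ).ne').add
      ((contDiff_cTau hE).continuous.div contDiff_cBase.continuous fun τ ↦ (hc τ).ne')).sqrt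
  obtain ⟨C, hC⟩ := isCompact_Icc.bddAbove_image (hcont.continuousOn (s := Icc p q))
  refine ⟨C, fun c h t ht ↦ ?_⟩
  have hpos := causal_fst_pos hl hE h t
  have hle := (h.2 t).2.1
  set V : TangentSpace I4 (c t) := mfderiv 𝓘(ℝ, ℝ) I4 c t (1 : ℝ)
  rw [taubNUT_apply, ambForm_apply, inner_coe_self] at hle
  have hCt := hC (mem_image_of_mem _ ht)
  have ha := ha (c t).1
  have hb := hb (c t).1
  have hc := hc (c t).1
  set a := cTau l E (c t).1
  set b := cFib l E (c t).1
  set k := cBase l E (c t).1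
  simp only [real_inner_self_eq_norm_sq] at hle
  set θ : ℝ := inner ℝ (hopfRot (c t).2) (dcoe (c t).2 V.2)
  set n := ‖dcoe (c t).2 V.2‖
  have hθ : θ ^ 2 ≤ n ^ 2 := by
    have h1 : ‖hopfRot ((c t).2 : E4)‖ ^ 2 = 1 := by
      rw [← real_inner_self_eq_norm_sq, inner_hopfRot_hopfRot, inner_coe_self]
    have h2 := real_inner_mul_inner_self_le (hopfRot ((c t).2 : E4)) (dcoe (c t).2 V.2)
    rw [real_inner_self_eq_norm_sq, real_inner_self_eq_norm_sq, h1] at h2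
    nlinarith
  have h1 : θ ^ 2 ≤ a / b * V.1 ^ 2 := by
    rw [div_mul_eq_mul_div, le_div_iff₀ hb]; nlinarith
  have h2 : n ^ 2 - θ ^ 2 ≤ a / k * V.1 ^ 2 := by
    rw [div_mul_eq_mul_div, le_div_iff₀ hc]; nlinarith [mul_nonneg hb.le (sq_nonneg θ)]
  have h3 : n ≤ Real.sqrt (a / b + a / k) * V.1 := by
    refine (pow_le_pow_iff_left₀ (norm_nonneg _) (by positivity) two_ne_zero).1 ?_
    rw [mul_pow, Real.sq_sqrt (by positivity)]
    linarith
  exact h3.trans (mul_le_mul_of_nonneg_right hCt hpos.le)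

/-- The spatial distance along a causal curve is controlled by the increase of `τ`. -/
theorem causal_dist_le {l E : ℝ} (hl : 0 < l) (hE : E ∈ Ioo (2 / 3) ((2 + Real.sqrt 3) / 3))
    (p q : ℝ) : ∃ C : ℝ, ∀ c : ℝ → ℝ × S3,
      IsFutureCausalCurve I4 (taubNUT l E) partialTau c → ∀ s t, s ≤ t →
        (∀ r ∈ Icc s t, (c r).1 ∈ Icc p q) →
        dist (c s).2 (c t).2 ≤ C * ((c t).1 - (c s).1) := by
  obtain ⟨C, hC⟩ := causal_estimate hl hE p q
  refine ⟨C, fun c hc s t hst h ↦ ?_⟩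
  have h1 := fun r ↦ (hasDerivAt_of_causal hc r).1
  have h2 := fun r ↦ (hasDerivAt_of_causal hc r).2
  have key := image_norm_le_of_norm_deriv_right_le_deriv_boundary (a := s) (b := t)
    (f := fun r ↦ ((c r).2 : E4) - (c s).2) (B := fun r ↦ C * ((c r).1 - (c s).1))
    (f' := fun r ↦ dcoe (c r).2 (mfderiv 𝓘(ℝ, ℝ) I4 c r (1 : ℝ)).2)
    (B' := fun r ↦ C * (mfderiv 𝓘(ℝ, ℝ) I4 c r (1 : ℝ)).1)
    (fun r _ ↦ ((h2 r).sub_const _).continuousAt.continuousWithinAt)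
    (fun r _ ↦ ((h2 r).sub_const _).hasDerivWithinAt) (by simp)
    (fun r ↦ ((h1 r).sub_const _).const_mul C)
    (fun r hr ↦ hC c hc r (h r ⟨hr.1, hr.2.le⟩)) (right_mem_Icc.2 hst)
  rw [Subtype.dist_eq, dist_comm, dist_eq_norm]
  exact key

theorem strictMono_causal {l E : ℝ} (hl : 0 < l) (hE : E ∈ Ioo (2 / 3) ((2 + Real.sqrt 3) / 3))
    {c : ℝ → ℝ × S3} (hc : IsFutureCausalCurve I4 (taubNUT l E) partialTau c) :
    StrictMono fun t ↦ (c t).1 := by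
  refine strictMono_of_deriv_pos fun t ↦ ?_
  rw [(hasDerivAt_of_causal hc t).1.deriv]
  exact causal_fst_pos hl hE hc t

/-- A path whose displacement is dominated by that of a convergent function is Cauchy. -/
theorem exists_endpoint {σ : ℝ → ℝ} {y : ℝ → S3} {L C : ℝ} (hL : Tendsto σ atTop (𝓝 L))
    (h : ∀ s t, 0 ≤ s → s ≤ t → dist (y s) (y t) ≤ C * (σ t - σ s)) :
    ∃ x, Tendsto y atTop (𝓝 x) := by
  apply cauchySeq_tendsto_of_complete
  rw [Metric.cauchySeq_iff']
  intro ε hε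
  have hd : 0 < |C| + 1 := by positivity
  obtain ⟨N', hN'⟩ := Metric.cauchySeq_iff.1 hL.cauchySeq (ε / (|C| + 1)) (by positivity)
  refine ⟨max N' 0, fun n hn ↦ ?_⟩
  rw [dist_comm]
  have h1 := h (max N' 0) n (le_max_right _ _) hn
  have h2 := hN' n (le_trans (le_max_left _ _) hn) (max N' 0) (le_max_left _ _)
  rw [Real.dist_eq, lt_div_iff₀ hd] at h2
  have h3 : C * (σ n - σ (max N' 0)) ≤ |C| * |σ n - σ (max N' 0)| := by
    rw [← abs_mul]; exact le_abs_self _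
  nlinarith [abs_nonneg (σ n - σ (max N' 0))]

/-- If `τ` were bounded above on the curve, it would converge, and the curve would have an endpoint.
-/
theorem tendsto_atTop_of_futureInextendible {l E : ℝ} (hl : 0 < l)
    (hE : E ∈ Ioo (2 / 3) ((2 + Real.sqrt 3) / 3)) {c : ℝ → ℝ × S3}
    (hc : IsFutureCausalCurve I4 (taubNUT l E) partialTau c) (h : IsFutureInextendible c) :
    Tendsto (fun t ↦ (c t).1) atTop atTop := by
  have hm := (strictMono_causal hl hE hc).monotone
  rcases tendsto_atTop_of_monotone hm with h' | ⟨L, hL⟩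
  · exact h'
  · obtain ⟨C, hC⟩ := causal_dist_le hl hE (c 0).1 L
    obtain ⟨x, hx⟩ := exists_endpoint (y := fun t ↦ (c t).2) hL fun s t hs hst ↦
      hC c hc s t hst fun r hr ↦ ⟨hm (hs.trans hr.1), hm.ge_of_tendsto hL r⟩
    exact absurd ⟨(L, x), hL.prodMk_nhds hx⟩ h

theorem tendsto_atBot_of_pastInextendible {l E : ℝ} (hl : 0 < l)
    (hE : E ∈ Ioo (2 / 3) ((2 + Real.sqrt 3) / 3)) {c : ℝ → ℝ × S3}
    (hc : IsFutureCausalCurve I4 (taubNUT l E) partialTau c) (h : IsPastInextendible c) :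
    Tendsto (fun t ↦ (c t).1) atBot atBot := by
  have hm := (strictMono_causal hl hE hc).monotone
  have hm' : Monotone fun t ↦ -(c (-t)).1 := fun s t hst ↦ neg_le_neg (hm (neg_le_neg hst))
  rcases tendsto_atTop_of_monotone hm' with h' | ⟨L, hL⟩
  · have := (tendsto_neg_atTop_atBot.comp h').comp tendsto_neg_atBot_atTop
    simpa [Function.comp_def] using this
  · obtain ⟨C, hC⟩ := causal_dist_le hl hE (-L) (c 0).1
    obtain ⟨x, hx⟩ := exists_endpoint (C := C) (y := fun t ↦ (c (-t)).2) hL fun s t hs hst ↦ by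
      rw [dist_comm]
      refine (hC c hc (-t) (-s) (neg_le_neg hst) fun r hr ↦ ⟨?_, ?_⟩).trans_eq (by ring)
      · have := hm'.ge_of_tendsto hL (-r)
        simp only [neg_neg] at this
        linarith
      · exact hm (hr.2.trans (by linarith))
    have h1 := (hL.neg.prodMk_nhds hx).comp tendsto_neg_atBot_atTop
    simp only [Function.comp_def, neg_neg] at h1
    exact absurd ⟨(-L, x), h1⟩ h

/-- The hypersurface `{τ = 0}` is a Cauchy surface. -/
theorem isGloballyHyperbolic_taubNUT {l E : ℝ} (hl : 0 < l)
    (hE : E ∈ Ioo (2 / 3) ((2 + Real.sqrt 3) / 3)) :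
    IsGloballyHyperbolic I4 (taubNUT l E) partialTau := by
  refine ⟨{p | p.1 = 0}, fun c hc hf hp ↦ ?_⟩
  have hcont : Continuous fun t ↦ (c t).1 := continuous_fst.comp hc.1.continuous
  obtain ⟨t, ht⟩ := hcont.surjective (tendsto_atTop_of_futureInextendible hl hE hc hf)
    (tendsto_atBot_of_pastInextendible hl hE hc hp) 0
  exact ⟨t, ht, fun s hs ↦ (strictMono_causal hl hE hc).injective (hs.trans ht.symm)⟩

theorem isDeSitterSpacetime_taubNUT {l E : ℝ} (hl : 0 < l)
    (hE : E ∈ Ioo (2 / 3) ((2 + Real.sqrt 3) / 3)) :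
    IsDeSitterSpacetime l (taubNUT l E) partialTau where
  t2 := inferInstance
  secondCountable := inferInstance
  connected := inferInstance
  lorentz := isLorentzMetric_taubNUT hl hE
  timeOrientation := isTimeOrientation_taubNUT hl hE
  einstein := isEinstein_taubNUT hl hE

/-! ### The conformal completion -/

/-- `cos⁴ s · A(tan s)`, as a polynomial in `sin s` and `cos s`. -/
def angularPoly (E s : ℝ) : ℝ :=
  E * Real.sin s ^ 4 - (4 - 6 * E) * (Real.sin s ^ 2 * Real.cos s ^ 2)
    - (8 * E - 8) * (Real.sin s * Real.cos s ^ 3) + (4 - 3 * E) * Real.cos s ^ 4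

theorem contDiff_angularPoly (E : ℝ) : ContDiff ℝ ∞ (angularPoly E) := by
  unfold angularPoly; fun_prop

theorem angularPoly_eq (E : ℝ) {s : ℝ} (hs : Real.cos s ≠ 0) :
    angularPoly E s = Real.cos s ^ 4 * taubNUTPoly E (Real.tan s) := by
  rw [angularPoly, taubNUTPoly, Real.tan_eq_sin_div_cos]
  field_simp
  ring

theorem angularPoly_pos {E : ℝ} (hE : E ∈ Ioo (2 / 3) ((2 + Real.sqrt 3) / 3)) (s : ℝ) :
    0 < angularPoly E s := by
  by_cases hs : Real.cos s = 0
  · have h := Real.sin_sq_add_cos_sq s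
    have h4 : Real.sin s ^ 4 = 1 := by rw [hs] at h; nlinarith
    simpa [angularPoly, hs, h4] using parameter_pos hE
  · rw [angularPoly_eq E hs]
    have := taubNUTPoly_pos hE (Real.tan s)
    positivity

theorem angularPoly_arctan (E τ : ℝ) :
    angularPoly E (Real.arctan τ) = taubNUTPoly E τ / (1 + τ ^ 2) ^ 2 := by
  rw [angularPoly_eq E (Real.cos_arctan_pos τ).ne', Real.tan_arctan, div_eq_inv_mul]
  congr 1
  have : Real.cos (Real.arctan τ) ^ 4 = (Real.cos (Real.arctan τ) ^ 2) ^ 2 := by ring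
  rw [this, Real.cos_sq_arctan, one_div, inv_pow]

instance fact_pi : Fact (-(Real.pi / 2) < Real.pi / 2) := ⟨by linarith [Real.pi_pos]⟩

instance fact_pi_le : Fact (-(Real.pi / 2) ≤ Real.pi / 2) := ⟨fact_pi.out.le⟩

/-- The closed interval to which `arctan` compactifies the time axis. -/
abbrev CTime := Icc (-(Real.pi / 2)) (Real.pi / 2)

/-- The differential of the inclusion of the closed interval. -/
abbrev dval (s : CTime) : TangentSpace (𝓡∂ 1) s →L[ℝ] ℝ :=
  mvfderiv (𝓡∂ 1) (fun z : CTime ↦ (z : ℝ)) s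

theorem exists_dval_eq_one (s : CTime) : ∃ w, dval s w = 1 :=
  ⟨1, mfderiv_subtypeVal_Icc_one s⟩

theorem injective_dval (s : CTime) : Function.Injective (dval s) := by
  obtain ⟨w, hw⟩ := exists_dval_eq_one s
  let L : EuclideanSpace ℝ (Fin 1) →ₗ[ℝ] ℝ := (dval s).toLinearMap
  have hs : Function.Surjective L := fun r ↦ ⟨r • w, by
    change dval s (r • w) = r
    rw [map_smul, hw, smul_eq_mul, mul_one]⟩
  exact (LinearMap.injective_iff_surjective_of_finrank_eq_finrank (f := L) (by simp)).2 hs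

/-- The inclusion of the completion into `ℝ × ℝ⁴`. -/
def embC (q : CTime × S3) : ℝ × E4 := ((q.1 : ℝ), (q.2 : E4))

theorem contMDiff_embC : ContMDiff IB4 𝓘(ℝ, ℝ × E4) ∞ embC :=
  (contMDiff_subtypeVal_Icc.comp contMDiff_fst).prodMk_space (contMDiff_coe.comp contMDiff_snd)

theorem mvfderiv_embC_apply (q : CTime × S3) (w : TangentSpace IB4 q) :
    mvfderiv IB4 embC q w = (dval q.1 w.1, dcoe q.2 w.2) := by
  have h1 : HasMFDerivAt IB4 𝓘(ℝ, ℝ) (fun q : CTime × S3 ↦ (q.1 : ℝ)) q _ :=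
    ((contMDiff_subtypeVal_Icc (n := ∞)).mdifferentiable (by simp) q.1).hasMFDerivAt.comp q
      (hasMFDerivAt_fst (I := 𝓡∂ 1) (I' := 𝓡 3) q)
  have h2 : HasMFDerivAt IB4 𝓘(ℝ, E4) (fun q : CTime × S3 ↦ (q.2 : E4)) q _ :=
    (contMDiff_coe.mdifferentiable (by simp) q.2).hasMFDerivAt.comp q
      (hasMFDerivAt_snd (I := 𝓡∂ 1) (I' := 𝓡 3) q)
  have h3 : HasMFDerivAt IB4 𝓘(ℝ, ℝ × E4) embC q _ :=
    ⟨(contMDiff_embC q).continuousAt, h1.2.prodMk h2.2⟩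
  simp only [mvfderiv, h3.mfderiv]
  rfl

theorem mvfderiv_embC_injective (q : CTime × S3) : Function.Injective (mvfderiv IB4 embC q) := by
  intro u v h
  rw [mvfderiv_embC_apply, mvfderiv_embC_apply] at h
  exact Prod.ext (injective_dval q.1 (Prod.mk.inj h).1) (injective_dcoe q.2 (Prod.mk.inj h).2)

/-- `arctan`, as a map into the closed interval. -/
def arctanC (τ : ℝ) : CTime :=
  ⟨Real.arctan τ, (Real.neg_pi_div_two_lt_arctan τ).le, (Real.arctan_lt_pi_div_two τ).le⟩

theorem isOpenEmbedding_arctanC : IsOpenEmbedding arctanC := by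
  have hr : range Real.arctan = Ioo (-(Real.pi / 2)) (Real.pi / 2) := Real.range_arctan
  have h1 : IsEmbedding Real.arctan :=
    Real.arctan_strictMono.isEmbedding_of_ordConnected (by rw [hr]; exact ordConnected_Ioo)
  have h2 : IsEmbedding arctanC :=
    IsEmbedding.of_comp (Real.continuous_arctan.subtype_mk _) continuous_subtype_val h1
  refine ⟨h2, ?_⟩
  have : range arctanC = Subtype.val ⁻¹' (Ioo (-(Real.pi / 2)) (Real.pi / 2)) := by
    ext z
    rw [mem_preimage, ← hr]
    constructor
    · rintro ⟨τ, rfl⟩; exact ⟨τ, rfl⟩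
    · rintro ⟨τ, h⟩; exact ⟨τ, Subtype.ext h⟩
  rw [this]
  exact isOpen_Ioo.preimage continuous_subtype_val

theorem range_arctanC : range arctanC = {⊥, ⊤}ᶜ := by
  ext z
  constructor
  · rintro ⟨τ, rfl⟩ h
    rcases h with h | h
    · exact (Real.neg_pi_div_two_lt_arctan τ).ne' (congrArg Subtype.val h)
    · exact (Real.arctan_lt_pi_div_two τ).ne (congrArg Subtype.val h)
  · intro h
    have h1 : z ≠ ⊥ := fun e ↦ h (Or.inl e)
    have h2 : z ≠ ⊤ := fun e ↦ h (Or.inr e)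
    have : (z : ℝ) ∈ range Real.arctan := by
      rw [Real.range_arctan]
      exact ⟨lt_of_le_of_ne z.2.1 fun e ↦ h1 (Subtype.ext e.symm),
        lt_of_le_of_ne z.2.2 fun e ↦ h2 (Subtype.ext e)⟩
    obtain ⟨τ, h⟩ := this
    exact ⟨τ, Subtype.ext h⟩

/-- The conformal embedding `(τ, x) ↦ (arctan τ, x)`. -/
def compactify (p : ℝ × S3) : CTime × S3 := (arctanC p.1, p.2)

theorem isOpenEmbedding_compactify : IsOpenEmbedding compactify :=
  isOpenEmbedding_arctanC.prodMap IsOpenEmbedding.id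

theorem contMDiff_compactify : ContMDiff I4 IB4 ∞ compactify := by
  refine ContMDiff.prodMk (f := fun p : ℝ × S3 ↦ arctanC p.1) ?_ contMDiff_snd
  rw [contMDiff_iff_comp_subtypeVal_Icc]
  exact ⟨isOpenEmbedding_arctanC.continuous.comp (continuous_fst (X := ℝ) (Y := S3)),
    Real.contDiff_arctan.contMDiff.comp contMDiff_fst⟩

theorem boundary_completion : IB4.boundary (CTime × S3) = {q | q.1 = ⊥ ∨ q.1 = ⊤} := by
  rw [ModelWithCorners.boundary_of_boundaryless_right, boundary_Icc]
  ext q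
  exact ⟨fun h ↦ h.1, fun h ↦ ⟨h, mem_univ _⟩⟩

theorem interior_completion : IB4.interior (CTime × S3) = range compactify := by
  rw [← ModelWithCorners.compl_boundary, boundary_completion]
  have : range compactify = range arctanC ×ˢ univ := by
    rw [← range_id (α := S3), ← range_prodMap]; rfl
  rw [this, range_arctanC]
  ext q
  simp

theorem mvfderiv_embC_compactify (p : ℝ × S3) (u : TangentSpace I4 p) :
    mvfderiv IB4 embC (compactify p) (mfderiv I4 IB4 compactify p u) =
      (u.1 / (1 + p.1 ^ 2), dcoe p.2 u.2) := by
  have h := mfderiv_comp_apply (I := I4) (I' := IB4) (I'' := 𝓘(ℝ, ℝ × E4)) p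
    (contMDiff_embC.mdifferentiable (by simp) _)
    (contMDiff_compactify.mdifferentiable (by simp) p) u
  have hd : HasFDerivAt (fun q : ℝ × E4 ↦ (Real.arctan q.1, q.2)) _ (emb p) :=
    (hasFDerivAt_fst (𝕜 := ℝ) (E := ℝ) (F := E4) (p := emb p)).arctan.prodMk
      (hasFDerivAt_snd (𝕜 := ℝ) (E := ℝ) (F := E4) (p := emb p))
  have h2 := mvfderiv_comp_fderiv (I := I4) (f := emb) p hd.differentiableAt
    (contMDiff_emb.mdifferentiable (by simp) p) u
  rw [hd.fderiv, mvfderiv_emb_apply] at h2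
  refine (h.symm.trans h2).trans (Prod.ext ?_ rfl)
  simp [emb]
  ring

/-- The conformally rescaled metric. -/
def completedMetric (l E : ℝ) : BilinField IB4 (CTime × S3) := fun q ↦
  pullBilin (mvfderiv IB4 embC q) (ambForm (l ^ 2 * E / angularPoly E (embC q).1)
    (l ^ 2 * E * angularPoly E (embC q).1) (l ^ 2 * E) (embC q).2)

/-- The defining function of the boundary. -/
def boundaryFun (q : CTime × S3) : ℝ := Real.cos q.1

theorem mvfderiv_boundaryFun (q : CTime × S3) (w : TangentSpace IB4 q) :
    mvfderiv IB4 boundaryFun q w = -Real.sin q.1 * dval q.1 w.1 := by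
  have hd : HasFDerivAt (fun q : ℝ × E4 ↦ Real.cos q.1) _ (embC q) :=
    (hasFDerivAt_fst (𝕜 := ℝ) (E := ℝ) (F := E4) (p := embC q)).cos
  have h := mvfderiv_comp_fderiv (I := IB4) (f := embC) q hd.differentiableAt
    (contMDiff_embC.mdifferentiable (by simp) q) w
  rw [hd.fderiv, mvfderiv_embC_apply] at h
  exact h

/-- In `s = arctan τ` the metric `cos² s · g` is the restriction of an ambient form with
coefficients `l² E / P`, `l² E P` and `l² E`, for the positive function `P = cos⁴ s A(tan s)`. -/
theorem isConformalCompletion_taubNUT {l E : ℝ} (hl : 0 < l)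
    (hE : E ∈ Ioo (2 / 3) ((2 + Real.sqrt 3) / 3)) :
    IsConformalCompletion (taubNUT l E) compactify boundaryFun (completedMetric l E) := by
  have hs := scale_pos hl hE
  have hA := angularPoly_pos hE
  refine ⟨contMDiff_compactify, isOpenEmbedding_compactify, interior_completion.symm,
    fun p ↦ ?_, ?_, ?_, ?_, ?_, ?_, ?_, ?_⟩
  -- the differential of the embedding is bijective: it is injective between spaces of dimension `4`
  · have hinj : Function.Injective (mfderiv I4 IB4 compactify p) := by
      intro u v h
      have h' := congrArg (mvfderiv IB4 embC (compactify p)) h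
      rw [mvfderiv_embC_compactify, mvfderiv_embC_compactify] at h'
      have hp : 1 + p.1 ^ 2 ≠ 0 := by positivity
      exact Prod.ext ((div_left_inj' hp).1 (Prod.mk.inj h').1)
        (injective_dcoe p.2 (Prod.mk.inj h').2)
    let L : (ℝ × E3) →ₗ[ℝ] (EuclideanSpace ℝ (Fin 1) × E3) :=
      (mfderiv I4 IB4 compactify p).toLinearMap
    exact ⟨hinj, (LinearMap.injective_iff_surjective_of_finrank_eq_finrank (f := L) (by simp)).1
      hinj⟩
  · exact (Real.contDiff_cos.contMDiff.comp contMDiff_subtypeVal_Icc).comp contMDiff_fst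
  · intro q hq
    rw [interior_completion] at hq
    obtain ⟨p, rfl⟩ := hq
    exact Real.cos_arctan_pos p.1
  · intro q hq
    rw [boundary_completion] at hq
    rcases hq with h | h <;> simp [boundaryFun, h]
  · intro q hq h0
    rw [boundary_completion] at hq
    obtain ⟨w, hw⟩ := exists_dval_eq_one q.1
    have h := mvfderiv_boundaryFun q (w, (0 : E3))
    rw [h0] at h
    have h2 : (0 : ℝ) = -Real.sin q.1 * dval q.1 w := h
    rw [hw] at h2
    rcases hq with e | e <;> simp [e] at h2
  · refine isLorentzMetric_of_ambForm contMDiff_embC (fun q ↦ inner_coe_self q.2)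
      mvfderiv_embC_injective (fun q ↦ ?_) (a := fun s ↦ l ^ 2 * E / angularPoly E s)
      (b := fun s ↦ l ^ 2 * E * angularPoly E s) (c := fun s ↦ l ^ 2 * E)
      (contDiff_const.div (contDiff_angularPoly E) fun s ↦ (hA s).ne')
      (contDiff_const.mul (contDiff_angularPoly E)) contDiff_const
      (fun s ↦ div_pos hs (hA s)) (fun s ↦ mul_pos hs (hA s)) (fun _ ↦ hs) fun q ↦ rfl
    obtain ⟨w, hw⟩ := exists_dval_eq_one q.1
    exact ⟨(w, (0 : E3)), (mvfderiv_embC_apply q (w, (0 : E3))).trans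
      (Prod.ext hw (map_zero (dcoe q.2)))⟩
  · intro p u v
    have hp : 1 + p.1 ^ 2 ≠ 0 := by positivity
    have hA' := (taubNUTPoly_pos hE p.1).ne'
    have e : (embC (compactify p)).1 = Real.arctan p.1 := rfl
    have e2 : (embC (compactify p)).2 = p.2 := rfl
    rw [completedMetric, pullBilin_apply, mvfderiv_embC_compactify, mvfderiv_embC_compactify,
      taubNUT_apply, ambForm_apply, ambForm_apply, e, e2, angularPoly_arctan]
    have e3 : boundaryFun (compactify p) ^ 2 = 1 / (1 + p.1 ^ 2) := Real.cos_sq_arctan p.1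
    rw [e3, cTau, cFib, cBase]
    rw [add_comm (p.1 ^ 2) 1]
    field_simp
  · intro q hq w hw hw0
    rw [boundary_completion] at hq
    have h1 : dval q.1 w.1 = 0 := by
      rw [mvfderiv_boundaryFun] at hw
      rcases hq with e | e <;> simpa [e] using hw
    rw [completedMetric, pullBilin_apply, mvfderiv_embC_apply]
    refine ambForm_space_pos (mul_pos hs (hA _)) hs (inner_coe_self q.2) h1 fun h2 ↦ hw0 ?_
    exact Prod.ext (injective_dval q.1 (h1.trans (map_zero (dval q.1)).symm))
      (injective_dcoe q.2 (h2.trans (map_zero (dcoe q.2)).symm))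

theorem mvfderiv_boundaryFun_compactify (p : ℝ × S3) :
    mvfderiv I4 (fun p ↦ boundaryFun (compactify p)) p (partialTau p) =
      -Real.sin (Real.arctan p.1) / (1 + p.1 ^ 2) := by
  have hd : HasFDerivAt (fun q : ℝ × E4 ↦ Real.cos (Real.arctan q.1)) _ (emb p) :=
    (hasFDerivAt_fst (𝕜 := ℝ) (E := ℝ) (F := E4) (p := emb p)).arctan.cos
  have h := mvfderiv_comp_fderiv (I := I4) (f := emb) p hd.differentiableAt
    (contMDiff_emb.mdifferentiable (by simp) p) (partialTau p)
  rw [hd.fderiv, mvfderiv_emb_partialTau] at h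
  refine h.trans ?_
  simp [emb]
  ring

/-- The future and past infinities are the ends `s = π / 2` and `s = -π / 2` of the completion:
`cos s` decreases in the direction of `∂_τ` for `s > 0` and increases for `s < 0`. -/
theorem isDSpm_taubNUT {l E : ℝ} (hl : 0 < l) (hE : E ∈ Ioo (2 / 3) ((2 + Real.sqrt 3) / 3)) :
    IsDSpm l (taubNUT l E) partialTau := by
  have hπ := Real.pi_pos
  have hplus : {q : CTime × S3 | q.1 = ⊤} ⊆ scriPlus partialTau compactify boundaryFun := by
    intro q hq
    refine ⟨by rw [boundary_completion]; exact Or.inr hq, ?_⟩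
    have ho : IsOpen {q : CTime × S3 | 0 < (q.1 : ℝ)} :=
      isOpen_lt continuous_const (continuous_subtype_val.comp continuous_fst)
    have hq0 : q ∈ {q : CTime × S3 | 0 < (q.1 : ℝ)} := by
      have : q.1 = ⊤ := hq
      simp [this, hπ]
    filter_upwards [preimage_mem_comap (ho.mem_nhds hq0)] with p hp
    have hp' : 0 < Real.arctan p.1 := hp
    rw [mvfderiv_boundaryFun_compactify]
    have := Real.sin_pos_of_pos_of_lt_pi hp' (by linarith [Real.arctan_lt_pi_div_two p.1])
    exact div_neg_of_neg_of_pos (by linarith) (by positivity)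
  have hminus : {q : CTime × S3 | q.1 = ⊥} ⊆ scriMinus partialTau compactify boundaryFun := by
    intro q hq
    refine ⟨by rw [boundary_completion]; exact Or.inl hq, ?_⟩
    have ho : IsOpen {q : CTime × S3 | (q.1 : ℝ) < 0} :=
      isOpen_lt (continuous_subtype_val.comp continuous_fst) continuous_const
    have hq0 : q ∈ {q : CTime × S3 | (q.1 : ℝ) < 0} := by
      have : q.1 = ⊥ := hq
      simp [this, hπ]
    filter_upwards [preimage_mem_comap (ho.mem_nhds hq0)] with p hp
    have hp' : Real.arctan p.1 < 0 := hp
    rw [mvfderiv_boundaryFun_compactify]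
    have := Real.sin_neg_of_neg_of_neg_pi_lt hp' (by linarith [Real.neg_pi_div_two_lt_arctan p.1])
    exact div_pos (by linarith) (by positivity)
  have x₀ : S3 := ⟨EuclideanSpace.single 0 1, by simp⟩
  refine ⟨isDeSitterSpacetime_taubNUT hl hE, isGloballyHyperbolic_taubNUT hl hE, CTime × S3,
    inferInstance, inferInstance, inferInstance, compactify, boundaryFun, completedMetric l E,
    inferInstance, inferInstance, isConformalCompletion_taubNUT hl hE, ?_,
    ⟨(⊤, x₀), hplus rfl⟩, ⟨(⊥, x₀), hminus rfl⟩⟩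
  refine Subset.antisymm (union_subset (fun q h ↦ h.1) fun q h ↦ h.1) fun q hq ↦ ?_
  rw [boundary_completion] at hq
  rcases hq with h | h
  · exact Or.inr (hminus h)
  · exact Or.inl (hplus h)

/-! ### Global solutions of ordinary differential equations -/

/-- A globally Lipschitz vector field is complete. -/
theorem exists_global_solution {F : Type*} [NormedAddCommGroup F] [NormedSpace ℝ F]
    [CompleteSpace F] {f : F → F} {K : NNReal} (hl : LipschitzWith K f) (hc : ContDiff ℝ 1 f)
    (x : F) : ∃ γ : ℝ → F, γ 0 = x ∧ ∀ t, HasDerivAt γ (f (γ t)) t := by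
  -- the Lipschitz constant is global, so the time of existence does not depend on the point
  set ε : ℝ := (1 + K)⁻¹ with hεdef
  have hε : 0 < ε := by positivity
  have hloc (x : F) : ∃ γ : ℝ → F, γ 0 = x ∧ ∀ t ∈ Ioo (-ε) ε, HasDerivAt γ (f (γ t)) t := by
    have h0 : (0 : ℝ) ∈ Icc (-ε) ε := ⟨by linarith, hε.le⟩
    have hpl : IsPicardLindelof (fun _ ↦ f) (tmin := -ε) (tmax := ε) ⟨0, h0⟩ x (‖f x‖₊ + 1) 0
        (‖f x‖₊ + K * (‖f x‖₊ + 1)) K := by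
      refine IsPicardLindelof.of_time_independent (fun z hz ↦ ?_) (hl.lipschitzOnWith) ?_
      · have h1 : ‖f z - f x‖ ≤ K * ‖z - x‖ := by
          simpa [dist_eq_norm] using hl.dist_le_mul z x
        have h2 : ‖z - x‖ ≤ ‖f x‖ + 1 := by simpa [dist_eq_norm] using hz
        have h3 : ‖f z‖ ≤ ‖f x‖ + ‖f z - f x‖ := by
          simpa using norm_add_le (f x) (f z - f x)
        push_cast
        have : (K : ℝ) * ‖z - x‖ ≤ K * (‖f x‖ + 1) := by gcongr
        linarith
      · push_cast
        simp only [sub_zero, zero_sub, neg_neg, max_self]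
        rw [hεdef, ← div_eq_mul_inv, div_le_iff₀ (by positivity)]
        nlinarith [norm_nonneg (f x), K.2]
    obtain ⟨γ, hγ0, hγ⟩ := hpl.exists_eq_forall_mem_Icc_hasDerivWithinAt₀
    exact ⟨γ, hγ0, fun t ht ↦
      (hγ t (Ioo_subset_Icc_self ht)).hasDerivAt (Icc_mem_nhds ht.1 ht.2)⟩
  have hv : ContMDiff 𝓘(ℝ, F) 𝓘(ℝ, F).tangent 1
      (fun x ↦ (⟨x, f x⟩ : TangentBundle 𝓘(ℝ, F) F)) :=
    contMDiff_vectorSpace_iff_contDiff.2 hc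
  obtain ⟨γ, h0, h⟩ := exists_isMIntegralCurve_of_isMIntegralCurveOn hv hε (fun x ↦ by
    obtain ⟨γ, h0, h⟩ := hloc x
    exact ⟨γ, h0, fun t ht ↦ (h t ht).hasFDerivAt.hasMFDerivAt.hasMFDerivWithinAt⟩) x
  refine ⟨γ, h0, fun t ↦ ?_⟩
  have h1 : HasFDerivAt (𝕜 := ℝ) (E := ℝ) (F := F) γ ((1 : ℝ →L[ℝ] ℝ).smulRight (f (γ t))) t :=
    hasMFDerivAt_iff_hasFDerivAt.1 (h t)
  simpa using HasFDerivAt.hasDerivAt (𝕜 := ℝ) (F := F) h1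

theorem bounded_of_periodic {f : ℝ → ℝ} {c : ℝ} (hc : c ≠ 0) (hp : Function.Periodic f c)
    (hf : Continuous f) : ∃ C : ℝ, ∀ x, |f x| ≤ C := by
  obtain ⟨C, hC⟩ := (hp.isBounded_of_continuous hc hf).exists_norm_le
  exact ⟨C, fun x ↦ hC _ (mem_range_self x)⟩

theorem periodic_deriv {f : ℝ → ℝ} {c : ℝ} (hp : Function.Periodic f c) :
    Function.Periodic (deriv f) c := fun x ↦ by
  rw [← deriv_comp_add_const]
  congr 1
  funext y
  exact hp y

theorem lipschitzWith_of_abs_deriv_le {f f' : ℝ → ℝ} (hf : ∀ x, HasDerivAt f (f' x) x) {C : ℝ}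
    (h : ∀ x, |f' x| ≤ C) : ∃ K, LipschitzWith K f := by
  refine ⟨C.toNNReal, lipschitzWith_of_nnnorm_deriv_le (fun x ↦ (hf x).differentiableAt)
    fun x ↦ ?_⟩
  rw [(hf x).deriv, ← NNReal.coe_le_coe, coe_nnnorm]
  exact (h x).trans (Real.le_coe_toNNReal C)

/-! ### Motion in the time direction -/

/-- The derivative of `arctan τ` with respect to proper time along the lines `ℝ × {x}`, as a
function of the angle `s = arctan τ`. -/
def angularSpeed (l E s : ℝ) : ℝ := Real.cos s * Real.sqrt (angularPoly E s) / (l * Real.sqrt E)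

theorem contDiff_angularSpeed {l E : ℝ} (hE : E ∈ Ioo (2 / 3) ((2 + Real.sqrt 3) / 3)) :
    ContDiff ℝ ∞ (angularSpeed l E) :=
  (Real.contDiff_cos.mul ((contDiff_angularPoly E).sqrt
    fun s ↦ (angularPoly_pos hE s).ne')).div_const _

theorem periodic_angularPoly (E : ℝ) : Function.Periodic (angularPoly E) (2 * Real.pi) := fun s ↦ by
  simp [angularPoly]

theorem periodic_angularSpeed (l E : ℝ) :
    Function.Periodic (angularSpeed l E) (2 * Real.pi) := fun s ↦ by
  simp [angularSpeed, periodic_angularPoly E s]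

/-- The lines `ℝ × {x}` are complete: proper time parametrizes `τ ∈ ℝ` by all of `ℝ`. -/
theorem exists_properTime {l E : ℝ} (hE : E ∈ Ioo (2 / 3) ((2 + Real.sqrt 3) / 3)) (τ₀ : ℝ) :
    ∃ s : ℝ → ℝ, s 0 = Real.arctan τ₀ ∧ (∀ y, HasDerivAt s (angularSpeed l E (s y)) y) ∧
      ∀ y, s y ∈ Ioo (-(Real.pi / 2)) (Real.pi / 2) := by
  have h2π : (2 * Real.pi) ≠ 0 := by positivity
  have hc := contDiff_angularSpeed (l := l) hE
  obtain ⟨C, hC⟩ := bounded_of_periodic h2π (periodic_deriv (periodic_angularSpeed l E))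
    (hc.continuous_deriv (by simp))
  obtain ⟨K, hK⟩ := lipschitzWith_of_abs_deriv_le
    (fun x ↦ (hc.differentiable (by simp) x).hasDerivAt) hC
  obtain ⟨s, hs0, hs⟩ := exists_global_solution hK (hc.of_le (by simp)) (Real.arctan τ₀)
  refine ⟨s, hs0, hs, fun y ↦ ?_⟩
  have hcont : Continuous s := continuous_iff_continuousAt.2 fun y ↦ (hs y).continuousAt
  -- the zeros of the cosine are stationary points, which no other solution reaches
  have hne (y : ℝ) : Real.cos (s y) ≠ 0 := by
    intro h0
    have hstat : ∀ t, HasDerivAt (fun _ : ℝ ↦ s y) (angularSpeed l E (s y)) t := fun t ↦ by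
      simpa [angularSpeed, h0] using hasDerivAt_const t (s y)
    have := ODE_solution_unique_univ (v := fun _ ↦ angularSpeed l E) (s := fun _ ↦ univ)
      (t₀ := y) (fun _ ↦ hK.lipschitzOnWith) (f := s) (g := fun _ ↦ s y)
      (fun t ↦ ⟨hs t, mem_univ _⟩) (fun t ↦ ⟨hstat t, mem_univ _⟩) rfl
    have h1 := congrFun this 0
    rw [hs0] at h1
    rw [← h1] at h0
    exact (Real.cos_arctan_pos τ₀).ne' h0
  have h0 : s 0 ∈ Ioo (-(Real.pi / 2)) (Real.pi / 2) := by
    rw [hs0]; exact ⟨Real.neg_pi_div_two_lt_arctan _, Real.arctan_lt_pi_div_two _⟩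
  have hnot (a : ℝ) (ha : Real.cos a = 0) : a ∉ range s := by
    rintro ⟨y, rfl⟩; exact hne y ha
  have hord : (range s).OrdConnected := (isPreconnected_range hcont).ordConnected
  constructor
  · by_contra! h
    exact hnot (-(Real.pi / 2)) (by simp) (hord.out ⟨y, rfl⟩ ⟨0, rfl⟩ ⟨h, h0.1.le⟩)
  · by_contra! h
    exact hnot (Real.pi / 2) (by simp) (hord.out ⟨0, rfl⟩ ⟨y, rfl⟩ ⟨h0.2.le, h⟩)

theorem tan_sq_add_one {s : ℝ} (hs : Real.cos s ≠ 0) :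
    Real.tan s ^ 2 + 1 = 1 / Real.cos s ^ 2 := by
  rw [Real.tan_eq_sin_div_cos]
  field_simp
  exact Real.sin_sq_add_cos_sq s

theorem cTau_tan {l E : ℝ} {s : ℝ} (hs : Real.cos s ≠ 0) :
    cTau l E (Real.tan s) = l ^ 2 * E * Real.cos s ^ 2 / angularPoly E s := by
  rw [angularPoly_eq E hs, cTau, tan_sq_add_one hs]
  field_simp

theorem cFib_tan {l E : ℝ} {s : ℝ} (hs : Real.cos s ≠ 0) :
    cFib l E (Real.tan s) = l ^ 2 * E * angularPoly E s / Real.cos s ^ 2 := by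
  rw [angularPoly_eq E hs, cFib, tan_sq_add_one hs]
  field_simp

theorem cBase_tan {l E : ℝ} {s : ℝ} (hs : Real.cos s ≠ 0) :
    cBase l E (Real.tan s) = l ^ 2 * E / Real.cos s ^ 2 := by
  rw [cBase, tan_sq_add_one hs, mul_one_div]

/-- `angularSpeed` times `dτ / ds` is the derivative of `τ` with respect to proper time. -/
theorem angularSpeed_eq {l E : ℝ} (hl : 0 < l) (hE : E ∈ Ioo (2 / 3) ((2 + Real.sqrt 3) / 3))
    {s : ℝ} (hs : 0 < Real.cos s) :
    angularSpeed l E s / Real.cos s ^ 2 = 1 / Real.sqrt (cTau l E (Real.tan s)) := by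
  have hA := angularPoly_pos hE s
  have hE0 := parameter_pos hE
  have e : Real.sqrt (cTau l E (Real.tan s)) =
      l * Real.sqrt E * Real.cos s / Real.sqrt (angularPoly E s) := by
    rw [cTau_tan hs.ne', Real.sqrt_div (by positivity), mul_assoc, mul_assoc,
      Real.sqrt_mul (by positivity), Real.sqrt_mul hE0.le, Real.sqrt_sq hl.le, Real.sqrt_sq hs.le]
  have h1 := Real.sqrt_pos.2 hA
  have h2 := Real.sqrt_pos.2 hE0
  rw [e, angularSpeed]
  field_simp

/-- The potential of the motion in the time direction, as a function of the angle. -/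
def angularPotential (l E P Q s : ℝ) : ℝ :=
  Real.cos s ^ 2 * (P / angularPoly E s + Q) / (l ^ 2 * E)

theorem contDiff_angularPotential {l E : ℝ} (hE : E ∈ Ioo (2 / 3) ((2 + Real.sqrt 3) / 3))
    (P Q : ℝ) : ContDiff ℝ ∞ (angularPotential l E P Q) :=
  ((Real.contDiff_cos.pow 2).mul ((contDiff_const.div (contDiff_angularPoly E)
    fun s ↦ (angularPoly_pos hE s).ne').add contDiff_const)).div_const _

/-- The potential is `P / b + Q / c` in terms of `τ = tan s`. -/
theorem deriv_angularPotential {l E : ℝ} (hl : 0 < l)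
    (hE : E ∈ Ioo (2 / 3) ((2 + Real.sqrt 3) / 3)) (P Q : ℝ) {s : ℝ} (hs : Real.cos s ≠ 0) :
    deriv (angularPotential l E P Q) s =
      (-P * cFib₁ l E (Real.tan s) / cFib l E (Real.tan s) ^ 2
          - Q * cBase₁ l E (Real.tan s) / cBase l E (Real.tan s) ^ 2) / Real.cos s ^ 2 := by
  have hb := (cFib_pos hl hE (Real.tan s)).ne'
  have hc := (cBase_pos hl hE (Real.tan s)).ne'
  have h1 := (((hasDerivAt_const (Real.tan s) P).div (hasDerivAt_cFib l E _) hb).add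
    ((hasDerivAt_const (Real.tan s) Q).div (hasDerivAt_cBase l E _) hc)).comp s
      (Real.hasDerivAt_tan hs)
  have h2 : angularPotential l E P Q =ᶠ[𝓝 s] fun s ↦
      P / cFib l E (Real.tan s) + Q / cBase l E (Real.tan s) := by
    filter_upwards [Real.continuous_cos.continuousAt.eventually_ne hs] with σ hσ
    have hA := (angularPoly_pos hE σ).ne'
    have h3 := (scale_pos hl hE).ne'
    rw [cFib_tan hσ, cBase_tan hσ, angularPotential]
    field_simp
  rw [h2.deriv_eq]
  refine h1.deriv.trans ?_
  ring

/-- The motion of the time coordinate along a geodesic, in the potential `P / b + Q / c`. -/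
theorem exists_radial_motion {l E : ℝ} (hl : 0 < l) (hE : E ∈ Ioo (2 / 3) ((2 + Real.sqrt 3) / 3))
    (P Q τ₀ τ₁ : ℝ) : ∃ τ τ' τ'' : ℝ → ℝ, (∀ t, HasDerivAt τ (τ' t) t) ∧
      (∀ t, HasDerivAt τ' (τ'' t) t) ∧ Continuous τ'' ∧ τ 0 = τ₀ ∧ τ' 0 = τ₁ ∧
      ∀ t, cTau l E (τ t) * τ'' t + cTau₁ l E (τ t) / 2 * τ' t ^ 2 =
        (-P * cFib₁ l E (τ t) / cFib l E (τ t) ^ 2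
          - Q * cBase₁ l E (τ t) / cBase l E (τ t) ^ 2) / 2 := by
  obtain ⟨s, hs0, hs, hsI⟩ := exists_properTime (l := l) hE τ₀
  have hcos (y : ℝ) : 0 < Real.cos (s y) := Real.cos_pos_of_mem_Ioo (hsI y)
  have h2π : (2 * Real.pi) ≠ 0 := by positivity
  have hκ := contDiff_angularSpeed (l := l) hE
  have hw := contDiff_angularPotential (l := l) hE P Q
  have hwp : Function.Periodic (angularPotential l E P Q) (2 * Real.pi) := fun s ↦ by
    simp [angularPotential, periodic_angularPoly E s]
  -- the force, as a function of the angle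
  let g : ℝ → ℝ := fun σ ↦ deriv (angularPotential l E P Q) σ * angularSpeed l E σ / 2
  have hdw : ContDiff ℝ ∞ (deriv (angularPotential l E P Q)) := (contDiff_infty_iff_deriv.1 hw).2
  have hg : ContDiff ℝ ∞ g := (hdw.mul hκ).div_const 2
  have hgp : Function.Periodic g (2 * Real.pi) := fun σ ↦ by
    simp only [g, periodic_deriv hwp σ, periodic_angularSpeed l E σ]
  obtain ⟨C, hC⟩ := bounded_of_periodic h2π (f := fun σ ↦ deriv g σ * angularSpeed l E σ)
    (fun σ ↦ by simp only [periodic_deriv hgp σ, periodic_angularSpeed l E σ])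
    ((hg.continuous_deriv (by simp)).mul hκ.continuous)
  have hgs (y : ℝ) : HasDerivAt (fun y ↦ g (s y)) (deriv g (s y) * angularSpeed l E (s y)) y :=
    ((hg.differentiable (by simp) (s y)).hasDerivAt).comp y (hs y)
  obtain ⟨K, hK⟩ := lipschitzWith_of_abs_deriv_le hgs fun y ↦ hC (s y)
  have hscont : Continuous s := continuous_iff_continuousAt.2 fun y ↦ (hs y).continuousAt
  have hs1 : ContDiff ℝ 1 s := by
    rw [contDiff_one_iff_deriv]
    refine ⟨fun y ↦ (hs y).differentiableAt, ?_⟩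
    rw [show deriv s = fun y ↦ angularSpeed l E (s y) from funext fun y ↦ (hs y).deriv]
    exact hκ.continuous.comp hscont
  have hgs1 : ContDiff ℝ 1 (fun y ↦ g (s y)) := (hg.of_le (by simp)).comp hs1
  have ha (τ : ℝ) := cTau_pos hl hE τ
  obtain ⟨γ, hγ0, hγ⟩ := exists_global_solution (f := fun z : ℝ × ℝ ↦ (z.2, g (s z.1)))
    (LipschitzWith.prod_snd.prodMk (hK.comp LipschitzWith.prod_fst))
    (contDiff_snd.prodMk (hgs1.comp contDiff_fst)) (0, τ₁ * Real.sqrt (cTau l E τ₀))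
  have hy (t : ℝ) : HasDerivAt (fun t ↦ (γ t).1) (γ t).2 t :=
    (hasFDerivAt_fst (𝕜 := ℝ) (E := ℝ) (F := ℝ) (p := γ t)).comp_hasDerivAt t (hγ t)
  have hv (t : ℝ) : HasDerivAt (fun t ↦ (γ t).2) (g (s (γ t).1)) t :=
    (hasFDerivAt_snd (𝕜 := ℝ) (E := ℝ) (F := ℝ) (p := γ t)).comp_hasDerivAt t (hγ t)
  have hγc : Continuous γ := continuous_iff_continuousAt.2 fun y ↦ (hγ y).continuousAt
  let τ : ℝ → ℝ := fun t ↦ Real.tan (s (γ t).1)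
  let τ' : ℝ → ℝ := fun t ↦ (γ t).2 / Real.sqrt (cTau l E (τ t))
  have hsq (t : ℝ) : 0 < Real.sqrt (cTau l E (τ t)) := Real.sqrt_pos.2 (ha _)
  have hτ (t : ℝ) : HasDerivAt τ (τ' t) t := by
    refine ((Real.hasDerivAt_tan (hcos (γ t).1).ne').comp t ((hs (γ t).1).comp t
      (hy t))).congr_deriv ?_
    have h1 := angularSpeed_eq hl hE (hcos (γ t).1)
    have h2 : τ' t = (γ t).2 * (1 / Real.sqrt (cTau l E (Real.tan (s (γ t).1)))) :=
      div_eq_mul_one_div _ _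
    rw [h2, ← h1]
    ring
  have hτc : Continuous τ := continuous_iff_continuousAt.2 fun t ↦ (hτ t).continuousAt
  have hτ' (t : ℝ) : HasDerivAt τ' _ t :=
    (hv t).div (((hasDerivAt_cTau (l := l) hE (τ t)).comp t (hτ t)).sqrt (ha _).ne') (hsq t).ne'
  have hac : Continuous fun t ↦ Real.sqrt (cTau l E (τ t)) :=
    ((contDiff_cTau hE).continuous.comp hτc).sqrt
  have ha1c : Continuous fun t ↦ cTau₁ l E (τ t) := by
    have : cTau₁ l E = deriv (cTau l E) := funext fun τ ↦ (hasDerivAt_cTau hE τ).deriv.symm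
    rw [this]
    exact ((contDiff_cTau hE).continuous_deriv (by simp)).comp hτc
  have hvc : Continuous fun t ↦ (γ t).2 := continuous_snd.comp hγc
  have hτ'c : Continuous τ' := hvc.div hac fun t ↦ (hsq t).ne'
  have hgc : Continuous fun t ↦ g (s (γ t).1) :=
    hg.continuous.comp (hscont.comp (continuous_fst.comp hγc))
  have h00 : τ 0 = τ₀ := by simp only [τ, hγ0, hs0, Real.tan_arctan]
  refine ⟨τ, τ', _, hτ, hτ', ?_, h00, ?_, fun t ↦ ?_⟩
  · exact ((hgc.mul hac).sub (hvc.mul ((ha1c.mul hτ'c).div (continuous_const.mul hac)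
      fun t ↦ (mul_pos two_pos (hsq t)).ne'))).div (hac.pow 2) fun t ↦ (pow_pos (hsq t) 2).ne'
  · simp only [τ', h00, hγ0]
    rw [mul_div_cancel_right₀]
    exact (Real.sqrt_pos.2 (ha _)).ne'
  · have h1 : g (s (γ t).1) * Real.sqrt (cTau l E (τ t)) =
        (-P * cFib₁ l E (τ t) / cFib l E (τ t) ^ 2
          - Q * cBase₁ l E (τ t) / cBase l E (τ t) ^ 2) / 2 := by
      have e1 := deriv_angularPotential hl hE P Q (hcos (γ t).1).ne'
      have e2 := angularSpeed_eq hl hE (hcos (γ t).1)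
      have e3 := (hcos (γ t).1).ne'
      have e4 := (hsq t).ne'
      change angularSpeed l E (s (γ t).1) / Real.cos (s (γ t).1) ^ 2
        = 1 / Real.sqrt (cTau l E (τ t)) at e2
      rw [div_eq_div_iff (by positivity) e4, one_mul] at e2
      simp only [g, e1]
      have key (D c κ r : ℝ) (hc : c ≠ 0) (h : κ * r = c ^ 2) :
          D / c ^ 2 * κ / 2 * r = D / 2 := by
        have : D / c ^ 2 * κ / 2 * r = D / c ^ 2 * (κ * r) / 2 := by ring
        rw [this, h]
        field_simp
      exact key _ _ _ _ e3 e2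
    rw [← h1]
    have h2 := Real.sq_sqrt (ha (τ t)).le
    have h3 := (hsq t).ne'
    have h4 : (γ t).2 = τ' t * Real.sqrt (cTau l E (τ t)) := by
      simp only [τ']; field_simp
    simp only [Function.comp_apply]
    rw [h4, h2]
    have h5 := (ha (τ t)).ne'
    field_simp
    ring

/-! ### Geodesics in the ambient space -/

/-- The Christoffel symbols of the first kind of a form pulled back under `F`. -/
theorem christoffelFirst_pullback {V W : Type*} [NormedAddCommGroup V] [NormedSpace ℝ V]
    [NormedAddCommGroup W] [NormedSpace ℝ W] {F : V → W} {g : W → W →L[ℝ] W →L[ℝ] ℝ}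
    {G : V → V →L[ℝ] V →L[ℝ] ℝ} {y : V} (hF : ContDiff ℝ ∞ F) (hg : DifferentiableAt ℝ g (F y))
    (hGd : DifferentiableAt ℝ G y) (hs : ∀ u v, g (F y) u v = g (F y) v u)
    (hG : ∀ᶠ z in 𝓝 y, ∀ u v, G z u v = g (F z) (fderiv ℝ F z u) (fderiv ℝ F z v)) (u w : V) :
    christoffelFirst G y u u w =
      christoffelFirst g (F y) (fderiv ℝ F y u) (fderiv ℝ F y u) (fderiv ℝ F y w)
        + g (F y) (fderiv ℝ (fderiv ℝ F) y u u) (fderiv ℝ F y w) := by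
  have hD : DifferentiableAt ℝ (fderiv ℝ F) y :=
    (hF.fderiv_right (m := ∞) (by simp)).differentiable (by simp) y
  have hFy := (hF.differentiable (by simp) y).hasFDerivAt
  have key (z u v : V) : fderiv ℝ G y z u v =
      fderiv ℝ g (F y) (fderiv ℝ F y z) (fderiv ℝ F y u) (fderiv ℝ F y v)
        + g (F y) (fderiv ℝ (fderiv ℝ F) y z u) (fderiv ℝ F y v)
        + g (F y) (fderiv ℝ F y u) (fderiv ℝ (fderiv ℝ F) y z v) := by
    have h1 := (hGd.hasFDerivAt.clm_apply (hasFDerivAt_const u y)).clm_apply (hasFDerivAt_const v y)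
    have hdu (u : V) := hD.hasFDerivAt.clm_apply (hasFDerivAt_const u y)
    have h2 := ((hg.hasFDerivAt.comp y hFy).clm_apply (hdu u)).clm_apply (hdu v)
    have e : (fun z ↦ G z u v) =ᶠ[𝓝 y]
        fun z ↦ (g ∘ F) z (fderiv ℝ F z u) (fderiv ℝ F z v) := by
      filter_upwards [hG] with z hz using hz u v
    have := congrArg (fun L : V →L[ℝ] ℝ ↦ L z) (h1.unique (h2.congr_of_eventuallyEq e))
    simp at this
    rw [this]
    ring
  have hsymm (u v : V) : fderiv ℝ (fderiv ℝ F) y u v = fderiv ℝ (fderiv ℝ F) y v u :=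
    (hF.contDiffAt.isSymmSndFDerivAt
      (by rw [minSmoothness_of_isRCLikeNormedField]; norm_cast)) u v
  rw [christoffelFirst_apply, christoffelFirst_apply, key, key, hsymm w u,
    hs (fderiv ℝ F y u) (fderiv ℝ (fderiv ℝ F) y u w)]
  ring

/-- The metric is nondegenerate at the centre of adapted coordinates. -/
theorem localMetric_prodChart_nondegenerate {l E : ℝ} (hl : 0 < l)
    (hE : E ∈ Ioo (2 / 3) ((2 + Real.sqrt 3) / 3)) (x₀ : S3) (τ : ℝ) (u : ℝ × E3)
    (h : ∀ w, localMetric I4 (taubNUT l E) (prodChart x₀) (τ, 0) u w = 0) : u = 0 := by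
  have h0 : ((τ, (0 : E3)) : ℝ × E3).2 2 ∈ Ioo (-(Real.pi / 2)) (Real.pi / 2) := by
    simp [Real.pi_pos]
  have h1 := h (-u.1, u.2)
  rw [localMetric_prodChart l E x₀ h0] at h1
  simp [locForm, locTheta, locN] at h1
  have ha := cTau_pos hl hE τ
  have hb := cFib_pos hl hE τ
  have hc := cBase_pos hl hE τ
  have e1 : u.1 = 0 := by
    by_contra h; have : 0 < u.1 * u.1 := mul_self_pos.2 h
    nlinarith [mul_pos ha this, mul_nonneg hb.le (mul_self_nonneg (u.2 2)),
      mul_nonneg hc.le (add_nonneg (mul_self_nonneg (u.2 0)) (mul_self_nonneg (u.2 1)))]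
  have e2 : u.2 2 = 0 := by
    by_contra h; have : 0 < u.2 2 * u.2 2 := mul_self_pos.2 h
    nlinarith [mul_pos hb this, mul_nonneg ha.le (mul_self_nonneg (u.1)),
      mul_nonneg hc.le (add_nonneg (mul_self_nonneg (u.2 0)) (mul_self_nonneg (u.2 1)))]
  have e3 : u.2 0 * u.2 0 + u.2 1 * u.2 1 = 0 := by
    rw [e1, e2] at h1
    simpa [hc.ne'] using h1
  have e4 : u.2 0 = 0 := by nlinarith [mul_self_nonneg (u.2 0), mul_self_nonneg (u.2 1)]
  have e5 : u.2 1 = 0 := by nlinarith [mul_self_nonneg (u.2 0), mul_self_nonneg (u.2 1)]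
  refine Prod.ext e1 ?_
  ext i
  fin_cases i
  exacts [e4, e5, e2]

/-- A curve in `ℝ × S³` is a geodesic if its acceleration in the ambient space is orthogonal to
`ℝ × S³`, in the sense of the extended metric. -/
theorem isGeodesic_of_ambient {l E : ℝ} (hl : 0 < l)
    (hE : E ∈ Ioo (2 / 3) ((2 + Real.sqrt 3) / 3)) {c : ℝ → ℝ × S3} {X₁ X₂ : ℝ → ℝ × E4}
    (hc : ContMDiff 𝓘(ℝ, ℝ) I4 2 c) (h1 : ∀ t, HasDerivAt (fun t ↦ emb (c t)) (X₁ t) t)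
    (h2 : ∀ t, HasDerivAt X₁ (X₂ t) t)
    (h : ∀ t (W : ℝ × E4), inner ℝ ((c t).2 : E4) W.2 = (0 : ℝ) →
      ambTaubNUT l E (emb (c t)) (X₂ t) W
        + christoffelFirst (ambTaubNUT l E) (emb (c t)) (X₁ t) (X₁ t) W = 0) :
    IsGeodesic I4 (taubNUT l E) c := by
  refine ⟨hc, fun t ↦ ?_⟩
  set x₀ := (c t).2 with hx₀
  set e := prodChart x₀ with he
  have hmem := prodChart_mem_maximalAtlas x₀
  have hsrc : c t ∈ e.source := by
    refine ⟨mem_univ _, ?_⟩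
    simp [hopfChart, hx₀]
  refine ⟨e, hmem, hsrc, ?_⟩
  intro x
  have hxt : x t = ((c t).1, (0 : E3)) := prodChart_extend_self (c t).1 x₀
  have hct : (c t) = ((c t).1, x₀) := rfl
  -- the curve in the chart is twice continuously differentiable
  have hX : ContDiff ℝ 2 (fun t ↦ emb (c t)) := by
    have := (contMDiff_emb.of_le (m := 2) (by norm_cast)).comp hc
    exact contMDiff_iff_contDiff.1 this
  have hx : ContDiffAt ℝ 2 x t := by
    have hpos : 0 < inner ℝ (x₀ : E4) ((fun q : ℝ × E4 ↦ q.2) (emb (c t))) := by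
      change 0 < inner ℝ (x₀ : E4) (x₀ : E4)
      rw [inner_coe_self]; norm_num
    have hcoord : ContDiffAt ℝ 2 (hopfCoord (x₀ : E4)) (emb (c t)).2 :=
      (contDiffAt_hopfCoord (x₀ : E4) hpos).of_le (by norm_cast)
    have hx2 : ContDiffAt ℝ 2 (fun t ↦ hopfCoord (x₀ : E4) (emb (c t)).2) t :=
      ContDiffAt.comp t (g := hopfCoord (x₀ : E4)) (f := fun t ↦ (emb (c t)).2) hcoord
        (contDiff_snd.comp hX).contDiffAt
    exact (contDiff_fst.comp hX).contDiffAt.prodMk hx2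
  have hev : ∀ᶠ s in 𝓝 t, c s ∈ e.source := hc.continuous.continuousAt.eventually_mem
    (e.open_source.mem_nhds hsrc)
  set F : ℝ × E3 → ℝ × E4 := locEmb e with hF
  have hFc : ContDiff ℝ ∞ F := by
    have : F = fun y ↦ (y.1, hopfParam x₀ y.2) := funext fun y ↦ locEmb_prodChart x₀ y
    rw [this]
    exact contDiff_fst.prodMk ((contDiff_hopfParam _).comp contDiff_snd)
  have hFx : ∀ᶠ s in 𝓝 t, emb (c s) = F (x s) := by
    filter_upwards [hev] with s hs
    rw [hF, locEmb, e.extend_left_inv hs]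
  have hxd : ∀ᶠ s in 𝓝 t, HasDerivAt x (deriv x s) s := by
    filter_upwards [hx.eventually (by simp)] with s hs
    exact (hs.differentiableAt (by simp)).hasDerivAt
  have hxdd : HasDerivAt (deriv x) (deriv (deriv x) t) t := by
    have : ContDiffAt ℝ 1 (deriv x) t :=
      ((hx.fderiv_right (m := 1) (by norm_num)).clm_apply contDiffAt_const).congr_of_eventuallyEq
        (Eventually.of_forall fun s ↦ fderiv_apply_one_eq_deriv.symm)
    exact (this.differentiableAt (by simp)).hasDerivAt
  have e1 : ∀ᶠ s in 𝓝 t, X₁ s = fderiv ℝ F (x s) (deriv x s) := by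
    filter_upwards [hFx.eventually_nhds, hxd] with s hs hxs
    have h3 := ((hFc.differentiable (by simp) (x s)).hasFDerivAt).comp_hasDerivAt s hxs
    exact (h1 s).unique (h3.congr_of_eventuallyEq hs)
  have hD : DifferentiableAt ℝ (fderiv ℝ F) (x t) :=
    (hFc.fderiv_right (m := ∞) (by simp)).differentiable (by simp) _
  have e2 : X₂ t = fderiv ℝ (fderiv ℝ F) (x t) (deriv x t) (deriv x t)
      + fderiv ℝ F (x t) (deriv (deriv x) t) := by
    have h3 := (hD.hasFDerivAt.comp_hasDerivAt t hxd.self_of_nhds).clm_apply hxdd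
    exact (h2 t).unique (h3.congr_of_eventuallyEq e1)
  have h0 : (x t).2 2 ∈ Ioo (-(Real.pi / 2)) (Real.pi / 2) := by
    rw [hxt]; simp [Real.pi_pos]
  have htgt := prodChart_extend_target x₀ h0
  have hnon : ∀ u, (∀ w, localMetric I4 (taubNUT l E) e (x t) u w = 0) → u = 0 := by
    rw [hxt]; exact localMetric_prodChart_nondegenerate hl hE x₀ _
  refine hnon _ fun w ↦ ?_
  have hloc : ∀ᶠ z in 𝓝 (x t), ∀ u v, localMetric I4 (taubNUT l E) e z u v =
      ambTaubNUT l E (F z) (fderiv ℝ F z u) (fderiv ℝ F z v) := by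
    filter_upwards [e.isOpen_extend_target.mem_nhds htgt] with z hz u v
    exact localMetric_taubNUT hmem hz u v
  have hW : inner ℝ ((c t).2 : E4) (fderiv ℝ F (x t) w).2 = (0 : ℝ) := by
    have h3 := fderiv_locEmb hmem htgt w
    rw [← hF, mvfderiv_emb_apply] at h3
    rw [h3]
    have h4 : (e.extend I4).symm (x t) = c t := e.extend_left_inv hsrc
    have h5 := inner_dcoe ((e.extend I4).symm (x t)).2
      (mfderiv 𝓘(ℝ, ℝ × E3) I4 (e.extend I4).symm (x t) w).2
    rw [← h4]
    exact h5
  have hEL := h t (fderiv ℝ F (x t) w) hW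
  rw [map_add, add_apply, christoffel_spec hnon,
    christoffelFirst_pullback hFc ((contDiff_ambTaubNUT hE).differentiable (by simp) _)
      ((contDiffAt_localMetric hE hmem htgt).differentiableAt (by simp))
      (fun u v ↦ ambForm_symm _ _ _ _ _ _) hloc, hloc.self_of_nhds]
  rw [e2, e1.self_of_nhds, hFx.self_of_nhds, map_add, add_apply] at hEL
  linarith

theorem fderiv_ambTaubNUT {l E : ℝ} (hE : E ∈ Ioo (2 / 3) ((2 + Real.sqrt 3) / 3))
    (q Z U V : ℝ × E4) :
    fderiv ℝ (ambTaubNUT l E) q Z U V =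
      -(cTau₁ l E q.1 * Z.1) * (U.1 * V.1)
      + (cFib₁ l E q.1 * Z.1 * (inner ℝ (hopfRot q.2) U.2 * inner ℝ (hopfRot q.2) V.2)
        + cFib l E q.1 * (inner ℝ (hopfRot Z.2) U.2 * inner ℝ (hopfRot q.2) V.2
          + inner ℝ (hopfRot q.2) U.2 * inner ℝ (hopfRot Z.2) V.2))
      + (cBase₁ l E q.1 * Z.1 * (inner ℝ q.2 q.2 * inner ℝ U.2 V.2
          - inner ℝ (hopfRot q.2) U.2 * inner ℝ (hopfRot q.2) V.2)
        + cBase l E q.1 * (2 * inner ℝ q.2 Z.2 * inner ℝ U.2 V.2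
          - (inner ℝ (hopfRot Z.2) U.2 * inner ℝ (hopfRot q.2) V.2
          + inner ℝ (hopfRot q.2) U.2 * inner ℝ (hopfRot Z.2) V.2))) := by
  have hd := ((contDiff_ambTaubNUT (l := l) hE).differentiable (by simp) q).hasFDerivAt
  have h1 := ((hd.clm_apply (hasFDerivAt_const U q)).clm_apply
    (hasFDerivAt_const V q)).hasLineDerivAt Z
  have hline : HasDerivAt (fun t : ℝ ↦ q + t • Z) Z 0 := by
    simpa using ((hasDerivAt_id (0 : ℝ)).smul_const Z).const_add q
  have hτ : HasDerivAt (fun t : ℝ ↦ (q + t • Z).1) Z.1 0 := by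
    simpa using ((hasDerivAt_id (0 : ℝ)).mul_const Z.1).const_add q.1
  have hx : HasDerivAt (fun t : ℝ ↦ (q + t • Z).2) Z.2 0 := by
    simpa using ((hasDerivAt_id (0 : ℝ)).smul_const Z.2).const_add q.2
  have hI : HasDerivAt (fun t : ℝ ↦ hopfRot (q + t • Z).2) (hopfRot Z.2) 0 :=
    hopfRotL.hasFDerivAt.comp_hasDerivAt (0 : ℝ) hx
  have hθ (U : ℝ × E4) : HasDerivAt (fun t : ℝ ↦ (inner ℝ (hopfRot (q + t • Z).2) U.2 : ℝ))
      (inner ℝ (hopfRot Z.2) U.2) 0 := by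
    simpa using hI.inner ℝ (hasDerivAt_const (0 : ℝ) U.2)
  have hxx : HasDerivAt (fun t : ℝ ↦ (inner ℝ (q + t • Z).2 (q + t • Z).2 : ℝ))
      (2 * inner ℝ q.2 Z.2) 0 := by
    refine (hx.inner ℝ hx).congr_deriv ?_
    simp [real_inner_comm]; ring
  have ha : HasDerivAt (fun t : ℝ ↦ cTau l E (q + t • Z).1) (cTau₁ l E q.1 * Z.1) 0 :=
    HasDerivAt.comp (h₂ := cTau l E) (h := fun t : ℝ ↦ (q + t • Z).1) (0 : ℝ)
      (by simpa using hasDerivAt_cTau hE q.1) hτ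
  have hb : HasDerivAt (fun t : ℝ ↦ cFib l E (q + t • Z).1) (cFib₁ l E q.1 * Z.1) 0 :=
    HasDerivAt.comp (h₂ := cFib l E) (h := fun t : ℝ ↦ (q + t • Z).1) (0 : ℝ)
      (by simpa using hasDerivAt_cFib l E q.1) hτ
  have hc : HasDerivAt (fun t : ℝ ↦ cBase l E (q + t • Z).1) (cBase₁ l E q.1 * Z.1) 0 :=
    HasDerivAt.comp (h₂ := cBase l E) (h := fun t : ℝ ↦ (q + t • Z).1) (0 : ℝ)
      (by simpa using hasDerivAt_cBase l E q.1) hτ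
  have h2 := ((ha.neg.mul_const (U.1 * V.1)).add (hb.mul ((hθ U).mul (hθ V)))).add
      (hc.mul ((hxx.mul_const (inner ℝ U.2 V.2)).sub ((hθ U).mul (hθ V))))
  have h3 := HasDerivAt.unique (f := fun t : ℝ ↦ ambTaubNUT l E (q + t • Z) U V) h1
    (h2.congr_of_eventuallyEq (Eventually.of_forall fun t ↦ by
      simp only [ambTaubNUT, ambForm_apply]; rfl))
  simp at h3
  rw [h3]
  simp

/-! ### Left multiplication by quaternions -/

/-- Left multiplication by the imaginary quaternion `q`. It commutes with `hopfRot`, which is a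
right multiplication. -/
def quatMul (q : E3) : E4 →L[ℝ] E4 :=
  LinearMap.toContinuousLinearMap
    { toFun x := !₂[-(q 0 * x 1) - q 1 * x 2 - q 2 * x 3, q 0 * x 0 - q 1 * x 3 + q 2 * x 2,
        q 0 * x 3 + q 1 * x 0 - q 2 * x 1, -(q 0 * x 2) + q 1 * x 1 + q 2 * x 0]
      map_add' x y := by ext i; fin_cases i <;> simp <;> ring
      map_smul' r x := by ext i; fin_cases i <;> simp <;> ring }

theorem quatMul_apply (q : E3) (x : E4) : quatMul q x =
    !₂[-(q 0 * x 1) - q 1 * x 2 - q 2 * x 3, q 0 * x 0 - q 1 * x 3 + q 2 * x 2,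
        q 0 * x 3 + q 1 * x 0 - q 2 * x 1, -(q 0 * x 2) + q 1 * x 1 + q 2 * x 0] := rfl

theorem quatMul_quatMul (q : E3) (x : E4) :
    quatMul q (quatMul q x) = -((q 0 ^ 2 + q 1 ^ 2 + q 2 ^ 2) • x) := by
  ext i
  fin_cases i <;> simp [quatMul_apply] <;> ring

theorem quatMul_hopfRot (q : E3) (x : E4) : quatMul q (hopfRot x) = hopfRot (quatMul q x) := by
  ext i
  fin_cases i <;> simp [quatMul_apply, hopfRot] <;> ring

theorem inner_quatMul_quatMul (q : E3) (x y : E4) : inner ℝ (quatMul q x) (quatMul q y) =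
    (q 0 ^ 2 + q 1 ^ 2 + q 2 ^ 2) * inner ℝ x y := by
  simp only [inner_eq4, quatMul_apply]
  simp
  ring

theorem quatMul_smul (r : ℝ) (q : E3) (x : E4) : quatMul (r • q) x = r • quatMul q x := by
  ext i
  fin_cases i <;> simp [quatMul_apply] <;> ring

/-- Imaginary unit quaternions act on a vector with all unit tangent vectors as values. -/
theorem exists_quatMul_eq {x ξ : E4} (hx : inner ℝ x x = (1 : ℝ)) (hξ : inner ℝ x ξ = (0 : ℝ)) :
    ∃ (j : ℝ) (q : E3), q 0 ^ 2 + q 1 ^ 2 + q 2 ^ 2 = 1 ∧ j • quatMul q x = ξ := by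
  obtain ⟨μ, hμ⟩ : ∃ μ : E3, quatMul μ x = ξ := by
    refine ⟨!₂[inner ℝ (quatMul !₂[1, 0, 0] x) ξ, inner ℝ (quatMul !₂[0, 1, 0] x) ξ,
      inner ℝ (quatMul !₂[0, 0, 1] x) ξ], ?_⟩
    have key : quatMul !₂[inner ℝ (quatMul !₂[1, 0, 0] x) ξ, inner ℝ (quatMul !₂[0, 1, 0] x) ξ,
      inner ℝ (quatMul !₂[0, 0, 1] x) ξ] x = (inner ℝ x x : ℝ) • ξ - (inner ℝ x ξ : ℝ) • x := by
      simp only [inner_eq4]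
      ext i
      fin_cases i <;> simp [quatMul_apply] <;> ring
    rw [key, hx, hξ]
    simp
  set n := μ 0 ^ 2 + μ 1 ^ 2 + μ 2 ^ 2 with hn
  by_cases h0 : n = 0
  · refine ⟨0, !₂[1, 0, 0], by simp, ?_⟩
    have h1 := inner_quatMul_quatMul μ x x
    rw [hμ, ← hn, h0, zero_mul, inner_self_eq_zero] at h1
    rw [h1, zero_smul]
  · have hpos : 0 < n := lt_of_le_of_ne (by positivity) (Ne.symm h0)
    have hs := (Real.sqrt_pos.2 hpos).ne'
    refine ⟨Real.sqrt n, (Real.sqrt n)⁻¹ • μ, ?_, ?_⟩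
    · have h2 := Real.sq_sqrt hpos.le
      simp only [PiLp.smul_apply, smul_eq_mul, mul_pow]
      rw [← mul_add, ← mul_add, ← hn, inv_pow, h2, inv_mul_cancel₀ h0]
    · rw [quatMul_smul, smul_smul, mul_inv_cancel₀ hs, one_smul, hμ]

/-- The rotations `exp (β J)` by a complex structure that is an isometry are isometries. -/
theorem inner_rotate_of_isometry {J : E4 →L[ℝ] E4} (hJ2 : ∀ x, J (J x) = -x)
    (hJ : ∀ x y, inner ℝ (J x) (J y) = (inner ℝ x y : ℝ)) (x y : E4) (β : ℝ) :
    inner ℝ (Real.cos β • x + Real.sin β • J x) (Real.cos β • y + Real.sin β • J y) =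
      (inner ℝ x y : ℝ) := by
  have h : inner ℝ (J x) y = -(inner ℝ x (J y) : ℝ) := by
    have := hJ x (J y)
    rw [hJ2, inner_neg_right] at this
    linarith
  simp only [inner_add_left, inner_add_right, real_inner_smul_left, real_inner_smul_right, hJ, h]
  linear_combination (inner ℝ x y) * Real.cos_sq_add_sin_sq β

/-! ### Geodesic completeness -/

theorem contDiff_two_of_hasDerivAt {f f' f'' : ℝ → ℝ} (h1 : ∀ t, HasDerivAt f (f' t) t)
    (h2 : ∀ t, HasDerivAt f' (f'' t) t) (h : Continuous f'') : ContDiff ℝ 2 f := by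
  have e1 : deriv f = f' := funext fun t ↦ (h1 t).deriv
  have e2 : deriv f' = f'' := funext fun t ↦ (h2 t).deriv
  have : ContDiff ℝ (1 + 1) f := by
    rw [contDiff_succ_iff_deriv]
    refine ⟨fun t ↦ (h1 t).differentiableAt, by simp, ?_⟩
    rw [e1, contDiff_one_iff_deriv, e2]
    exact ⟨fun t ↦ (h2 t).differentiableAt, h⟩
  exact this

/-- The geodesic equation for a curve `(τ, x)` with `x' = β' i x + α' J x`. -/
theorem ambient_geodesic_equation {l E : ℝ} (hl : 0 < l)
    (hE : E ∈ Ioo (2 / 3) ((2 + Real.sqrt 3) / 3)) {J : E4 →L[ℝ] E4} (hJ2 : ∀ x, J (J x) = -x)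
    (hJ : ∀ x y, inner ℝ (J x) (J y) = (inner ℝ x y : ℝ))
    (hJI : ∀ x, J (hopfRot x) = hopfRot (J x)) {τ τ' τ'' j S : ℝ} {x : E4}
    (hx : inner ℝ x x = (1 : ℝ)) (hS : inner ℝ (hopfRot x) (J x) = S)
    (hτ : cTau l E τ * τ'' + cTau₁ l E τ / 2 * τ' ^ 2 =
        (-(j ^ 2 * S ^ 2) * cFib₁ l E τ / cFib l E τ ^ 2
          - (j ^ 2 * (1 - S ^ 2)) * cBase₁ l E τ / cBase l E τ ^ 2) / 2)
    {W : ℝ × E4} (hW : inner ℝ x W.2 = (0 : ℝ)) :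
    let α' := j / cBase l E τ
    let β' := j * S * (1 / cFib l E τ - 1 / cBase l E τ)
    let α'' := -(j * (cBase₁ l E τ * τ')) / cBase l E τ ^ 2
    let β'' := j * S * (-(cFib₁ l E τ * τ') / cFib l E τ ^ 2
      + (cBase₁ l E τ * τ') / cBase l E τ ^ 2)
    let x' := β' • hopfRot x + α' • J x
    let x'' := β'' • hopfRot x + β' • hopfRot x' + (α'' • J x + α' • J x')
    ambTaubNUT l E (τ, x) (τ'', x'') W
      + christoffelFirst (ambTaubNUT l E) (τ, x) (τ', x') (τ', x') W = 0 := by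
  intro α' β' α'' β'' x' x''
  have hb := (cFib_pos hl hE τ).ne'
  have hc := (cBase_pos hl hE τ).ne'
  have hskew (x y : E4) : inner ℝ (J x) y = -(inner ℝ x (J y) : ℝ) := by
    have := hJ x (J y)
    rw [hJ2, inner_neg_right] at this
    linarith
  have hxJ (y : E4) : inner ℝ y (J y) = (0 : ℝ) := by
    have := hskew y y
    rw [real_inner_comm] at this
    linarith
  have hxI (y : E4) : inner ℝ y (hopfRot y) = (0 : ℝ) := by
    rw [real_inner_comm]; exact inner_hopfRot_self y
  have hJx (y : E4) : inner ℝ (J y) y = (0 : ℝ) := by rw [real_inner_comm]; exact hxJ y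
  have hIJ : inner ℝ (J x) (hopfRot x) = S := by rw [real_inner_comm]; exact hS
  -- the components of `W` in the frame `i x, J x, i J x`
  obtain ⟨p, hp⟩ : ∃ p, inner ℝ (hopfRot x) W.2 = (p : ℝ) := ⟨_, rfl⟩
  obtain ⟨k, hk⟩ : ∃ k, inner ℝ (J x) W.2 = (k : ℝ) := ⟨_, rfl⟩
  obtain ⟨m, hm⟩ : ∃ m, inner ℝ (hopfRot (J x)) W.2 = (m : ℝ) := ⟨_, rfl⟩
  have hIx' : hopfRot x' = -(β' • x) + α' • hopfRot (J x) := by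
    simp only [x', hopfRot_add, hopfRot_smul, hopfRot_hopfRot, smul_neg]
  have hJx' : J x' = β' • hopfRot (J x) - α' • x := by
    simp only [x', map_add, map_smul, hJ2, hJI, smul_neg]
    abel
  have i1 : inner ℝ (hopfRot x) x' = β' + α' * S := by
    simp only [x', inner_add_right, real_inner_smul_right, inner_hopfRot_hopfRot, hx, hS]; ring
  have i2 : inner ℝ x' W.2 = β' * p + α' * k := by
    simp only [x', inner_add_left, real_inner_smul_left, hp, hk]
  have i3 : inner ℝ (hopfRot x') W.2 = α' * m := by
    rw [hIx', inner_add_left, inner_neg_left, real_inner_smul_left, real_inner_smul_left, hW, hm]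
    ring
  have i4 : inner ℝ (hopfRot W.2) x' = -(α' * m) := by
    rw [inner_hopfRot_comm, real_inner_comm, i3]
  have i5 : inner ℝ x' x' = β' ^ 2 + 2 * α' * β' * S + α' ^ 2 := by
    simp only [x', inner_add_left, inner_add_right, real_inner_smul_left, real_inner_smul_right,
      inner_hopfRot_hopfRot, hx, hS, hIJ, hJ]
    ring
  have i6 : inner ℝ x x' = (0 : ℝ) := by
    simp only [x', inner_add_right, real_inner_smul_right, hxI, hxJ]; ring
  have i7 : inner ℝ x'' W.2 = β'' * p + 2 * (α' * β') * m + α'' * k := by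
    simp only [x'', hJx', inner_add_left, inner_sub_left, real_inner_smul_left, i3, hp, hk, hm, hW]
    ring
  have i8 : inner ℝ (hopfRot x) x'' = β'' + α'' * S := by
    have h1 : inner ℝ (hopfRot x) (hopfRot x') = (0 : ℝ) := by rw [inner_hopfRot_hopfRot, i6]
    have h2 : inner ℝ (hopfRot x) (J x') = (0 : ℝ) := by
      rw [hJx', inner_sub_right, real_inner_smul_right, real_inner_smul_right,
        inner_hopfRot_hopfRot, hxJ, inner_hopfRot_self]
      ring
    simp only [x'', inner_add_right, real_inner_smul_right, h1, h2, inner_hopfRot_hopfRot, hx, hS]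
    ring
  rw [christoffelFirst_apply, fderiv_ambTaubNUT hE, fderiv_ambTaubNUT hE]
  simp only [ambTaubNUT, ambForm_apply, hx, hp, i1, i2, i3, i4, i5, i6, i7, i8, hW,
    inner_hopfRot_self]
  have hτ2 : cTau l E τ * τ'' = (-(j ^ 2 * S ^ 2) * cFib₁ l E τ / cFib l E τ ^ 2
          - (j ^ 2 * (1 - S ^ 2)) * cBase₁ l E τ / cBase l E τ ^ 2) / 2
          - cTau₁ l E τ / 2 * τ' ^ 2 := by linarith
  have e1 : -cTau l E τ * (τ'' * W.1) = -(cTau l E τ * τ'') * W.1 := by ring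
  rw [e1, hτ2]
  simp only [α', β', α'', β'']
  field_simp
  ring

theorem tangentBundle_ext {p q : ℝ × S3} {v : TangentSpace I4 p} {w : TangentSpace I4 q}
    (h : p = q) (hv : mvfderiv I4 emb p v = mvfderiv I4 emb q w) :
    (⟨p, v⟩ : TangentBundle I4 (ℝ × S3)) = ⟨q, w⟩ := by
  subst h
  rw [mvfderiv_emb_injective p hv]

/-- The spatial part of the geodesic is `e^{iβ} exp (α J) x₀`, where `j J` is the conserved momentum
of the left translations; `α` and `β` are integrals of functions of `τ`, which exists for all times.
-/
theorem isGeodesicallyComplete_taubNUT {l E : ℝ} (hl : 0 < l)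
    (hE : E ∈ Ioo (2 / 3) ((2 + Real.sqrt 3) / 3)) : IsGeodesicallyComplete I4 (taubNUT l E) := by
  rintro ⟨⟨τ₀, x₀⟩, v⟩
  have hb (τ : ℝ) := (cFib_pos hl hE τ).ne'
  have hc (τ : ℝ) := (cBase_pos hl hE τ).ne'
  set ξ := dcoe x₀ v.2 with hξ
  have hx0 := inner_coe_self x₀
  have hx0ξ : inner ℝ (x₀ : E4) ξ = (0 : ℝ) := inner_dcoe x₀ v.2
  have hx0I : inner ℝ (x₀ : E4) (hopfRot x₀) = (0 : ℝ) := by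
    rw [real_inner_comm]; exact inner_hopfRot_self _
  set θ₀ : ℝ := inner ℝ (hopfRot (x₀ : E4)) ξ with hθ₀
  -- the conserved momentum of the left translations
  obtain ⟨j, q, hq, hμ⟩ := exists_quatMul_eq (ξ := ((cFib l E τ₀ - cBase l E τ₀) * θ₀) •
    hopfRot (x₀ : E4) + cBase l E τ₀ • ξ) hx0 (by
      rw [inner_add_right, real_inner_smul_right, real_inner_smul_right, hx0I, hx0ξ]; ring)
  set J := quatMul q with hJdef
  have hJ2 (x : E4) : J (J x) = -x := by rw [hJdef, quatMul_quatMul, hq, one_smul]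
  have hJ (x y : E4) : inner ℝ (J x) (J y) = (inner ℝ x y : ℝ) := by
    rw [hJdef, inner_quatMul_quatMul, hq, one_mul]
  have hJI (x : E4) : J (hopfRot x) = hopfRot (J x) := quatMul_hopfRot q x
  obtain ⟨S, hS⟩ : ∃ S : ℝ, inner ℝ (hopfRot (x₀ : E4)) (J x₀) = S := ⟨_, rfl⟩
  have hjS : j * S = cFib l E τ₀ * θ₀ := by
    have := congrArg (fun z ↦ (inner ℝ (hopfRot (x₀ : E4)) z : ℝ)) hμ
    simp only [inner_add_right, real_inner_smul_right, inner_hopfRot_hopfRot, hx0, hS,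
      ← hθ₀] at this
    rw [this]; ring
  obtain ⟨τ, τ', τ'', hτ, hτ', hτ''c, hτ0, hτ'0, heq⟩ :=
    exists_radial_motion hl hE (j ^ 2 * S ^ 2) (j ^ 2 * (1 - S ^ 2)) τ₀ v.1
  have hτc : Continuous τ := continuous_iff_continuousAt.2 fun t ↦ (hτ t).continuousAt
  have hτ'c : Continuous τ' := continuous_iff_continuousAt.2 fun t ↦ (hτ' t).continuousAt
  have hbd (t : ℝ) : HasDerivAt (fun t ↦ cFib l E (τ t)) (cFib₁ l E (τ t) * τ' t) t :=
    (hasDerivAt_cFib l E (τ t)).comp t (hτ t)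
  have hcd (t : ℝ) : HasDerivAt (fun t ↦ cBase l E (τ t)) (cBase₁ l E (τ t) * τ' t) t :=
    (hasDerivAt_cBase l E (τ t)).comp t (hτ t)
  have hbc : Continuous fun t ↦ cFib l E (τ t) := contDiff_cFib.continuous.comp hτc
  have hcc : Continuous fun t ↦ cBase l E (τ t) := contDiff_cBase.continuous.comp hτc
  have hb1c : Continuous fun t ↦ cFib₁ l E (τ t) * τ' t := by
    have : cFib₁ l E = deriv (cFib l E) := funext fun τ ↦ (hasDerivAt_cFib l E τ).deriv.symm
    rw [this]
    exact ((contDiff_cFib.continuous_deriv (by simp)).comp hτc).mul hτ'c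
  have hc1c : Continuous fun t ↦ cBase₁ l E (τ t) * τ' t := by
    have : cBase₁ l E = deriv (cBase l E) := funext fun τ ↦ (hasDerivAt_cBase l E τ).deriv.symm
    rw [this]
    exact ((contDiff_cBase.continuous_deriv (by simp)).comp hτc).mul hτ'c
  -- the angles of the left and right rotations
  let α' : ℝ → ℝ := fun t ↦ j / cBase l E (τ t)
  let β' : ℝ → ℝ := fun t ↦ j * S * (1 / cFib l E (τ t) - 1 / cBase l E (τ t))
  let α'' : ℝ → ℝ := fun t ↦ -(j * (cBase₁ l E (τ t) * τ' t)) / cBase l E (τ t) ^ 2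
  let β'' : ℝ → ℝ := fun t ↦ j * S * (-(cFib₁ l E (τ t) * τ' t) / cFib l E (τ t) ^ 2
      + (cBase₁ l E (τ t) * τ' t) / cBase l E (τ t) ^ 2)
  have hα'c : Continuous α' := continuous_const.div hcc fun t ↦ hc _
  have hβ'c : Continuous β' := continuous_const.mul ((continuous_const.div hbc fun t ↦ hb _).sub
    (continuous_const.div hcc fun t ↦ hc _))
  have hα''c : Continuous α'' := (continuous_const.mul hc1c).neg.div (hcc.pow 2)
    fun t ↦ pow_ne_zero 2 (hc _)
  have hβ''c : Continuous β'' := continuous_const.mul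
    ((hb1c.neg.div (hbc.pow 2) fun t ↦ pow_ne_zero 2 (hb _)).add
      (hc1c.div (hcc.pow 2) fun t ↦ pow_ne_zero 2 (hc _)))
  have hα' (t : ℝ) : HasDerivAt α' (α'' t) t := by
    refine ((hasDerivAt_const t j).div (hcd t) (hc _)).congr_deriv ?_
    simp only [α'']; ring
  have hβ' (t : ℝ) : HasDerivAt β' (β'' t) t := by
    refine ((((hasDerivAt_const t (1 : ℝ)).div (hbd t) (hb _)).sub
      ((hasDerivAt_const t (1 : ℝ)).div (hcd t) (hc _))).const_mul (j * S)).congr_deriv ?_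
    simp only [β'']; ring
  let α : ℝ → ℝ := fun t ↦ ∫ u in (0 : ℝ)..t, α' u
  let β : ℝ → ℝ := fun t ↦ ∫ u in (0 : ℝ)..t, β' u
  have hα (t : ℝ) : HasDerivAt α (α' t) t := hα'c.integral_hasStrictDerivAt 0 t |>.hasDerivAt
  have hβ (t : ℝ) : HasDerivAt β (β' t) t := hβ'c.integral_hasStrictDerivAt 0 t |>.hasDerivAt
  have hα0 : α 0 = 0 := by simp [α]
  have hβ0 : β 0 = 0 := by simp [β]
  let y : ℝ → E4 := fun t ↦ Real.cos (α t) • (x₀ : E4) + Real.sin (α t) • J x₀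
  let x : ℝ → E4 := fun t ↦ Real.cos (β t) • y t + Real.sin (β t) • hopfRot (y t)
  let x' : ℝ → E4 := fun t ↦ β' t • hopfRot (x t) + α' t • J (x t)
  have hJy (t : ℝ) : J (y t) = Real.cos (α t) • J x₀ + Real.sin (α t) • J (J x₀) := by
    simp only [y, map_add, map_smul]
  have hIy (t : ℝ) : hopfRot (y t) = Real.cos (α t) • hopfRot x₀ +
      Real.sin (α t) • J (hopfRot x₀) := by
    simp only [y, hopfRot_add, hopfRot_smul, hJI]
  have hJx (t : ℝ) : J (x t) = Real.cos (β t) • J (y t) + Real.sin (β t) • hopfRot (J (y t)) := by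
    simp only [x, map_add, map_smul, hJI]
  have hIx (t : ℝ) : hopfRot (x t) = Real.cos (β t) • hopfRot (y t) +
      Real.sin (β t) • hopfRot (hopfRot (y t)) := by
    simp only [x, hopfRot_add, hopfRot_smul]
  have hy (t : ℝ) : HasDerivAt y (α' t • J (y t)) t := by
    refine (((hα t).cos.smul_const (x₀ : E4)).add ((hα t).sin.smul_const (J x₀))).congr_deriv ?_
    rw [hJy, hJ2]; module
  have hx (t : ℝ) : HasDerivAt x (x' t) t := by
    have hI : HasDerivAt (fun t ↦ hopfRot (y t)) (hopfRot (α' t • J (y t))) t :=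
      hopfRotL.hasFDerivAt.comp_hasDerivAt t (hy t)
    refine (((hβ t).cos.smul (hy t)).add ((hβ t).sin.smul hI)).congr_deriv ?_
    simp only [x']
    rw [hJx, hIx, hopfRot_hopfRot, hopfRot_smul]
    module
  have hx' (t : ℝ) : HasDerivAt x' (β'' t • hopfRot (x t) + β' t • hopfRot (x' t)
      + (α'' t • J (x t) + α' t • J (x' t))) t := by
    have hI : HasDerivAt (fun t ↦ hopfRot (x t)) (hopfRot (x' t)) t :=
      hopfRotL.hasFDerivAt.comp_hasDerivAt t (hx t)
    have hJ : HasDerivAt (fun t ↦ J (x t)) (J (x' t)) t :=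
      J.hasFDerivAt.comp_hasDerivAt t (hx t)
    refine (((hβ' t).smul hI).add ((hα' t).smul hJ)).congr_deriv ?_
    abel
  have hxx (t : ℝ) : inner ℝ (x t) (x t) = (1 : ℝ) := by
    simp only [x, y]
    rw [inner_rotate, inner_rotate_of_isometry hJ2 hJ, hx0]
  have hSx (t : ℝ) : inner ℝ (hopfRot (x t)) (J (x t)) = S := by
    rw [hJx, hIx, inner_rotate, hJy, hIy, inner_rotate_of_isometry hJ2 hJ, hS]
  have hmem (t : ℝ) : x t ∈ Metric.sphere (0 : E4) 1 := by
    have h := hxx t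
    rw [real_inner_self_eq_norm_sq] at h
    rw [mem_sphere_zero_iff_norm]
    nlinarith [norm_nonneg (x t)]
  let c : ℝ → ℝ × S3 := fun t ↦ (τ t, ⟨x t, hmem t⟩)
  have hα2 : ContDiff ℝ 2 α := contDiff_two_of_hasDerivAt hα hα' hα''c
  have hβ2 : ContDiff ℝ 2 β := contDiff_two_of_hasDerivAt hβ hβ' hβ''c
  have hy2 : ContDiff ℝ 2 y := (hα2.cos.smul contDiff_const).add (hα2.sin.smul contDiff_const)
  have hx2 : ContDiff ℝ 2 x := (hβ2.cos.smul hy2).add (hβ2.sin.smul (hopfRotL.contDiff.comp hy2))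
  have hcc : ContMDiff 𝓘(ℝ, ℝ) I4 2 c :=
    (contDiff_two_of_hasDerivAt hτ hτ' hτ''c).contMDiff.prodMk
      (hx2.contMDiff.codRestrict_sphere hmem)
  have hX (t : ℝ) : HasDerivAt (fun t ↦ emb (c t)) (τ' t, x' t) t := (hτ t).prodMk (hx t)
  refine ⟨c, isGeodesic_of_ambient hl hE hcc hX (fun t ↦ (hτ' t).prodMk (hx' t))
    fun t W hW ↦ ?_, ?_⟩
  · exact ambient_geodesic_equation hl hE hJ2 hJ hJI (hxx t) (hSx t) (heq t) hW
  · have hx00 : x 0 = x₀ := by simp [x, y, hα0, hβ0]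
    refine tangentBundle_ext (Prod.ext hτ0 (Subtype.ext hx00)) ?_
    have h1 := hasDerivAt_emb_comp (hcc.mdifferentiable (by simp) 0)
    rw [h1.unique (hX 0), mvfderiv_emb_apply]
    refine Prod.ext hτ'0 ?_
    simp only [x', α', β', hx00, hτ0]
    have e1 : (j / cBase l E τ₀) • J (x₀ : E4) = (1 / cBase l E τ₀) • (j • J (x₀ : E4)) := by
      rw [smul_smul]; congr 1; ring
    rw [e1, hμ, hjS, ← hξ]
    have hb0 := hb τ₀
    have hc0 := hc τ₀
    match_scalars
    · field_simp; ring
    · field_simp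

/-! ### The geodesic defining function -/

/-- The polynomial `B(r) = r⁴ A(1 / r)`. -/
def boundaryPoly (E r : ℝ) : ℝ :=
  E - (4 - 6 * E) * r ^ 2 - (8 * E - 8) * r ^ 3 + (4 - 3 * E) * r ^ 4

theorem boundaryPoly_eq (E : ℝ) {r : ℝ} (hr : r ≠ 0) :
    boundaryPoly E r = r ^ 4 * taubNUTPoly E (1 / r) := by
  unfold boundaryPoly taubNUTPoly; field_simp; ring

theorem boundaryPoly_pos {E : ℝ} (hE : E ∈ Ioo (2 / 3) ((2 + Real.sqrt 3) / 3)) (r : ℝ) :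
    0 < boundaryPoly E r := by
  rcases eq_or_ne r 0 with rfl | hr
  · simpa [boundaryPoly] using parameter_pos hE
  · rw [boundaryPoly_eq E hr]
    exact mul_pos (by positivity) (taubNUTPoly_pos hE _)

theorem contDiff_boundaryPoly (E : ℝ) : ContDiff ℝ ∞ (boundaryPoly E) := by
  unfold boundaryPoly; fun_prop

/-- The function `f` for which `-(f dr / r)²` is the time part of the metric divided by `l²`, in the
coordinate `r = 1 / τ`. -/
def lapse (E r : ℝ) : ℝ := Real.sqrt (E * (1 + r ^ 2) / boundaryPoly E r)

/-- The quotient `(f - 1) / r²`; by the choice of `E` as the leading coefficient of `A`, it is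
smooth at `r = 0`. -/
def lapseQuot (E r : ℝ) : ℝ :=
  ((4 - 5 * E) + (8 * E - 8) * r - (4 - 3 * E) * r ^ 2) / (boundaryPoly E r * (lapse E r + 1))

/-- The integral `∫₀^r (f - 1) / r`, so that `ρ = r exp (lapseInt r) / √E` solves
`dρ / ρ = f dr / r`. -/
def lapseInt (E r : ℝ) : ℝ := ∫ s in (0 : ℝ)..r, s * lapseQuot E s

/-- The geodesic defining function `ρ` in terms of `r = 1 / τ`. -/
def geodesicDefining (E r : ℝ) : ℝ := r / Real.sqrt E * Real.exp (lapseInt E r)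

/-- The derivative `dr / dρ`, as a function of `r`. -/
def definingSpeed (E r : ℝ) : ℝ := Real.sqrt E * Real.exp (-lapseInt E r) / lapse E r

section

variable {E : ℝ} (hE : E ∈ Ioo (2 / 3) ((2 + Real.sqrt 3) / 3))
include hE

theorem lapse_arg_pos (r : ℝ) : 0 < E * (1 + r ^ 2) / boundaryPoly E r :=
  div_pos (mul_pos (parameter_pos hE) (by positivity)) (boundaryPoly_pos hE r)

theorem lapse_pos (r : ℝ) : 0 < lapse E r := Real.sqrt_pos.2 (lapse_arg_pos hE r)

theorem lapse_sq (r : ℝ) : lapse E r ^ 2 = E * (1 + r ^ 2) / boundaryPoly E r :=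
  Real.sq_sqrt (lapse_arg_pos hE r).le

theorem contDiff_lapse_arg : ContDiff ℝ ∞ fun r ↦ E * (1 + r ^ 2) / boundaryPoly E r :=
  (by fun_prop : ContDiff ℝ ∞ fun r : ℝ ↦ E * (1 + r ^ 2)).div (contDiff_boundaryPoly E)
    fun r ↦ (boundaryPoly_pos hE r).ne'

theorem contDiff_lapse : ContDiff ℝ ∞ (lapse E) :=
  (contDiff_lapse_arg hE).sqrt fun r ↦ (lapse_arg_pos hE r).ne'

theorem lapseQuot_den_ne (r : ℝ) : boundaryPoly E r * (lapse E r + 1) ≠ 0 :=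
  (mul_pos (boundaryPoly_pos hE r) (by linarith [lapse_pos hE r])).ne'

theorem contDiff_lapseQuot : ContDiff ℝ ∞ (lapseQuot E) :=
  ContDiff.div (by fun_prop)
    ((contDiff_boundaryPoly E).mul ((contDiff_lapse hE).add contDiff_const))
    fun r ↦ lapseQuot_den_ne hE r

/-- The defining property of `lapseQuot`: the difference `f² - 1` is divisible by `r²`. -/
theorem lapse_eq (r : ℝ) : lapse E r = 1 + r ^ 2 * lapseQuot E r := by
  have h1 := lapse_sq hE r
  have hB := boundaryPoly_pos hE r
  have hf := lapse_pos hE r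
  rw [eq_div_iff hB.ne'] at h1
  rw [lapseQuot, mul_div_assoc', ← sub_eq_iff_eq_add', eq_div_iff (lapseQuot_den_ne hE r)]
  have h2 : boundaryPoly E r = E - (4 - 6 * E) * r ^ 2 - (8 * E - 8) * r ^ 3
    + (4 - 3 * E) * r ^ 4 := rfl
  linear_combination h1 - h2

theorem hasDerivAt_lapseInt (r : ℝ) : HasDerivAt (lapseInt E) (r * lapseQuot E r) r :=
  (continuous_id.mul (contDiff_lapseQuot hE).continuous).integral_hasStrictDerivAt 0 r
    |>.hasDerivAt

theorem contDiff_lapseInt : ContDiff ℝ ∞ (lapseInt E) := by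
  rw [contDiff_infty_iff_deriv]
  refine ⟨fun r ↦ (hasDerivAt_lapseInt hE r).differentiableAt, ?_⟩
  have : deriv (lapseInt E) = fun r ↦ r * lapseQuot E r :=
    funext fun r ↦ (hasDerivAt_lapseInt hE r).deriv
  rw [this]
  exact contDiff_id.mul (contDiff_lapseQuot hE)

theorem contDiff_geodesicDefining : ContDiff ℝ ∞ (geodesicDefining E) :=
  (contDiff_id.div_const _).mul (contDiff_lapseInt hE).exp

/-- This is the equation `dρ / ρ = f dr / r`, in a form that is regular at `r = 0`. -/
theorem hasDerivAt_geodesicDefining (r : ℝ) :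
    HasDerivAt (geodesicDefining E) (definingSpeed E r)⁻¹ r := by
  have h := ((hasDerivAt_id r).div_const (Real.sqrt E)).mul (hasDerivAt_lapseInt hE r).exp
  refine h.congr_deriv ?_
  have hs : 0 < Real.sqrt E := Real.sqrt_pos.2 (parameter_pos hE)
  have hf := lapse_pos hE r
  rw [definingSpeed, Real.exp_neg]
  field_simp
  rw [lapse_eq hE r, id]
  ring

theorem definingSpeed_pos (r : ℝ) : 0 < definingSpeed E r :=
  div_pos (mul_pos (Real.sqrt_pos.2 (parameter_pos hE)) (Real.exp_pos _)) (lapse_pos hE r)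

theorem contDiff_definingSpeed : ContDiff ℝ ∞ (definingSpeed E) :=
  (contDiff_const.mul (contDiff_lapseInt hE).neg.exp).div (contDiff_lapse hE)
    fun r ↦ (lapse_pos hE r).ne'

theorem strictMono_geodesicDefining : StrictMono (geodesicDefining E) := by
  refine strictMono_of_deriv_pos fun r ↦ ?_
  rw [(hasDerivAt_geodesicDefining hE r).deriv]
  exact inv_pos.2 (definingSpeed_pos hE r)

end

theorem lapseInt_zero (E : ℝ) : lapseInt E 0 = 0 := by simp [lapseInt]

theorem geodesicDefining_zero (E : ℝ) : geodesicDefining E 0 = 0 := by simp [geodesicDefining]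

/-- Inversion of the geodesic defining function near the boundary. -/
theorem exists_inverse_geodesicDefining {E : ℝ} (hE : E ∈ Ioo (2 / 3) ((2 + Real.sqrt 3) / 3)) :
    ∃ (ε : ℝ) (R : ℝ → ℝ), 0 < ε ∧ ContDiffOn ℝ ∞ R (Ioo (-ε) ε) ∧ R 0 = 0 ∧
      (∀ s ∈ Ioo (-ε) ε, geodesicDefining E (R s) = s) ∧
      (∀ s ∈ Ioo (-ε) ε, HasDerivAt R (definingSpeed E (R s)) s) ∧
      ∀ᶠ r in 𝓝 0, R (geodesicDefining E r) = r := by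
  have hd (r : ℝ) : HasFDerivAt (geodesicDefining E)
      ((ContinuousLinearEquiv.unitsEquivAut ℝ (Units.mk0 _
        (inv_pos.2 (definingSpeed_pos hE r)).ne') : ℝ ≃L[ℝ] ℝ) : ℝ →L[ℝ] ℝ) r := by
    refine (hasDerivAt_geodesicDefining hE r).hasFDerivAt.congr_fderiv ?_
    ext; simp
  set e := (contDiff_geodesicDefining hE).contDiffAt.toOpenPartialHomeomorph _ (hd 0) (by simp)
    with he
  have hcoe (r : ℝ) : e r = geodesicDefining E r := rfl
  have h0s : (0 : ℝ) ∈ e.source :=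
    (contDiff_geodesicDefining hE).contDiffAt.mem_toOpenPartialHomeomorph_source (hd 0) (by simp)
  have h0 : e 0 = 0 := geodesicDefining_zero E
  have h0t : (0 : ℝ) ∈ e.target := by rw [← h0]; exact e.map_source h0s
  obtain ⟨ε, hε, hball⟩ := Metric.isOpen_iff.1 e.open_target 0 h0t
  rw [Real.ball_eq_Ioo, zero_sub, zero_add] at hball
  have hne (s : ℝ) := (inv_pos.2 (definingSpeed_pos hE (e.symm s))).ne'
  refine ⟨ε, e.symm, hε, fun s hs ↦ ?_, ?_, fun s hs ↦ e.right_inv (hball hs), fun s hs ↦ ?_, ?_⟩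
  · exact (e.contDiffAt_symm_deriv (hne s) (hball hs)
      (hasDerivAt_geodesicDefining hE _) (contDiff_geodesicDefining hE).contDiffAt).contDiffWithinAt
  · conv_lhs => rw [← h0]
    exact e.left_inv h0s
  · have := e.hasDerivAt_symm (hball hs) (hne s) (hasDerivAt_geodesicDefining hE _)
    rwa [inv_inv] at this
  · filter_upwards [e.open_source.mem_nhds h0s] with r hr
    exact e.left_inv hr

/-! ### The third order coefficient -/

/-- If `r' = V ∘ r` with `r 0 = 0`, then the third derivative of `M ∘ r` at `0` only involves the
first derivative of `M' / r`, provided that `V' 0 = 0`. -/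
theorem iteratedDeriv_three_comp {R V P m : ℝ → ℝ}
    (hR : ∀ᶠ s in 𝓝 0, HasDerivAt R (V (R s)) s) (h0 : R 0 = 0) (hV : ContDiff ℝ ∞ V)
    (hm : ContDiff ℝ ∞ m) (hP : ∀ x, HasDerivAt P (x * m x) x) (hV0 : deriv V 0 = 0) :
    iteratedDeriv 3 (fun s ↦ P (R s)) 0 = 2 * deriv m 0 * V 0 ^ 3 := by
  have hcomp {p p' : ℝ → ℝ} (hp : ∀ x, HasDerivAt p (p' x) x) :
      deriv (fun s ↦ p (R s)) =ᶠ[𝓝 0] fun s ↦ p' (R s) * V (R s) := by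
    filter_upwards [hR] with s hs
    exact ((hp (R s)).comp s hs).deriv
  have hdV (x : ℝ) : HasDerivAt V (deriv V x) x :=
    (hV.differentiable (by simp) x).hasDerivAt
  have hdm (x : ℝ) : HasDerivAt m (deriv m x) x :=
    (hm.differentiable (by simp) x).hasDerivAt
  have hV' : ContDiff ℝ ∞ (deriv V) := (contDiff_infty_iff_deriv.1 hV).2
  have hm' : ContDiff ℝ ∞ (deriv m) := (contDiff_infty_iff_deriv.1 hm).2
  have hddV (x : ℝ) : HasDerivAt (deriv V) (deriv (deriv V) x) x :=
    (hV'.differentiable (by simp) x).hasDerivAt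
  have hddm (x : ℝ) : HasDerivAt (deriv m) (deriv (deriv m) x) x :=
    (hm'.differentiable (by simp) x).hasDerivAt
  have h1 := hcomp hP
  have h2 := hcomp fun x ↦ ((hasDerivAt_id x).mul (hdm x)).mul (hdV x)
  have h3 := hcomp fun x ↦ ((((hasDerivAt_const x (1 : ℝ)).mul (hdm x)).add
    ((hasDerivAt_id x).mul (hddm x))).mul (hdV x)).add
    (((hasDerivAt_id x).mul (hdm x)).mul (hddV x)) |>.mul (hdV x)
  rw [iteratedDeriv_succ, iteratedDeriv_succ, iteratedDeriv_one]
  have e1 : deriv (deriv fun s ↦ P (R s)) =ᶠ[𝓝 0] _ := h1.deriv.trans h2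
  have e2 : deriv (deriv (deriv fun s ↦ P (R s))) =ᶠ[𝓝 0] _ := e1.deriv.trans h3
  rw [e2.self_of_nhds]
  simp [h0, hV0]
  ring

/-- The coefficient of `θ₁²` in `h_ρ`, as a function of `r`. -/
def fibreCoeff (E r : ℝ) : ℝ := Real.exp (2 * lapseInt E r) * (boundaryPoly E r / (1 + r ^ 2))

/-- The coefficient of `g_{S²} / 4` in `h_ρ`, as a function of `r`. -/
def baseCoeff (E r : ℝ) : ℝ := Real.exp (2 * lapseInt E r) * (1 + r ^ 2)

/-- The quotient `B'(r) / r`. -/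
def boundaryPolyQuot (E r : ℝ) : ℝ :=
  -2 * (4 - 6 * E) - 3 * (8 * E - 8) * r + 4 * (4 - 3 * E) * r ^ 2

theorem hasDerivAt_boundaryPoly (E r : ℝ) :
    HasDerivAt (boundaryPoly E) (r * boundaryPolyQuot E r) r := by
  have h := ((((hasDerivAt_pow 2 r).const_mul (4 - 6 * E)).const_sub E).sub
    ((hasDerivAt_pow 3 r).const_mul (8 * E - 8))).add ((hasDerivAt_pow 4 r).const_mul (4 - 3 * E))
  refine h.congr_deriv ?_
  simp [boundaryPolyQuot]; ring

/-- The derivative of `fibreCoeff`, divided by `r`. -/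
def fibreCoeffQuot (E r : ℝ) : ℝ :=
  Real.exp (2 * lapseInt E r) * ((2 * lapseQuot E r * boundaryPoly E r + boundaryPolyQuot E r)
    / (1 + r ^ 2) - 2 * boundaryPoly E r / (1 + r ^ 2) ^ 2)

/-- The derivative of `baseCoeff`, divided by `r`. -/
def baseCoeffQuot (E r : ℝ) : ℝ :=
  Real.exp (2 * lapseInt E r) * (2 * lapseQuot E r * (1 + r ^ 2) + 2)

theorem hasDerivAt_one_add_sq (r : ℝ) : HasDerivAt (fun r : ℝ ↦ 1 + r ^ 2) (2 * r) r := by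
  simpa using (hasDerivAt_pow 2 r).const_add 1

section

variable {E : ℝ} (hE : E ∈ Ioo (2 / 3) ((2 + Real.sqrt 3) / 3))
include hE

theorem hasDerivAt_fibreCoeff (r : ℝ) : HasDerivAt (fibreCoeff E) (r * fibreCoeffQuot E r) r := by
  have hr : 1 + r ^ 2 ≠ 0 := by positivity
  have h := ((hasDerivAt_lapseInt hE r).const_mul 2).exp.mul
    ((hasDerivAt_boundaryPoly E r).div (hasDerivAt_one_add_sq r) hr)
  refine h.congr_deriv ?_
  simp only [fibreCoeffQuot, Pi.div_apply]
  field_simp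
  ring

theorem hasDerivAt_baseCoeff (r : ℝ) : HasDerivAt (baseCoeff E) (r * baseCoeffQuot E r) r := by
  have h := ((hasDerivAt_lapseInt hE r).const_mul 2).exp.mul (hasDerivAt_one_add_sq r)
  refine h.congr_deriv ?_
  simp only [baseCoeffQuot]
  ring

theorem contDiff_fibreCoeffQuot : ContDiff ℝ ∞ (fibreCoeffQuot E) := by
  have h1 := contDiff_lapseInt hE
  have h2 := contDiff_lapseQuot hE
  have h3 := contDiff_boundaryPoly E
  have h4 : ContDiff ℝ ∞ (boundaryPolyQuot E) := by unfold boundaryPolyQuot; fun_prop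
  have h5 : ContDiff ℝ ∞ fun r : ℝ ↦ 1 + r ^ 2 := by fun_prop
  exact (contDiff_const.mul h1).exp.mul (((((contDiff_const.mul h2).mul h3).add h4).div h5
    fun r ↦ by positivity).sub ((contDiff_const.mul h3).div (h5.pow 2) fun r ↦ by positivity))

theorem contDiff_baseCoeffQuot : ContDiff ℝ ∞ (baseCoeffQuot E) := by
  have h1 := contDiff_lapseInt hE
  have h2 := contDiff_lapseQuot hE
  unfold baseCoeffQuot
  fun_prop

theorem contDiff_fibreCoeff : ContDiff ℝ ∞ (fibreCoeff E) :=
  (contDiff_const.mul (contDiff_lapseInt hE)).exp.mul ((contDiff_boundaryPoly E).div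
    (by fun_prop) fun r ↦ by positivity)

theorem contDiff_baseCoeff : ContDiff ℝ ∞ (baseCoeff E) :=
  (contDiff_const.mul (contDiff_lapseInt hE)).exp.mul (by fun_prop)

theorem lapse_zero : lapse E 0 = 1 := by rw [lapse_eq hE]; simp

theorem hasDerivAt_lapse_zero : HasDerivAt (lapse E) 0 0 := by
  have h := (hasDerivAt_pow 2 (0 : ℝ)).mul
    ((contDiff_lapseQuot hE).differentiable (by simp) 0).hasDerivAt |>.const_add 1
  rw [show lapse E = fun r ↦ 1 + r ^ 2 * lapseQuot E r from funext (lapse_eq hE)]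
  refine h.congr_deriv ?_
  simp

theorem hasDerivAt_lapseInt_zero : HasDerivAt (lapseInt E) 0 0 := by
  simpa using hasDerivAt_lapseInt hE 0

theorem deriv_definingSpeed_zero : deriv (definingSpeed E) 0 = 0 := by
  have h := ((hasDerivAt_lapseInt_zero hE).neg.exp.const_mul (Real.sqrt E)).div
    (hasDerivAt_lapse_zero hE) (lapse_pos hE 0).ne'
  refine h.deriv.trans ?_
  simp

theorem definingSpeed_zero : definingSpeed E 0 = Real.sqrt E := by
  simp [definingSpeed, lapseInt_zero, lapse_zero hE]

theorem hasDerivAt_lapseQuot_zero : HasDerivAt (lapseQuot E) (4 * (E - 1) / E) 0 := by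
  have hn : HasDerivAt (fun r : ℝ ↦ (4 - 5 * E) + (8 * E - 8) * r - (4 - 3 * E) * r ^ 2)
      (8 * E - 8) 0 := by
    refine ((((hasDerivAt_id (0 : ℝ)).const_mul (8 * E - 8)).const_add (4 - 5 * E)).sub
      ((hasDerivAt_pow 2 (0 : ℝ)).const_mul (4 - 3 * E))).congr_deriv ?_
    simp
  have hB : HasDerivAt (boundaryPoly E) 0 0 := by simpa using hasDerivAt_boundaryPoly E 0
  have h := hn.div (hB.mul ((hasDerivAt_lapse_zero hE).add_const 1)) (lapseQuot_den_ne hE 0)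
  refine h.congr_deriv ?_
  have := (parameter_pos hE).ne'
  simp [lapse_zero hE, boundaryPoly]
  field_simp
  ring

theorem deriv_fibreCoeffQuot_zero : deriv (fibreCoeffQuot E) 0 = -16 * (E - 1) := by
  have hB : HasDerivAt (boundaryPoly E) 0 0 := by simpa using hasDerivAt_boundaryPoly E 0
  have hQ : HasDerivAt (boundaryPolyQuot E) (-3 * (8 * E - 8)) 0 := by
    refine ((((hasDerivAt_id (0 : ℝ)).const_mul (3 * (8 * E - 8))).const_sub
      (-2 * (4 - 6 * E))).add ((hasDerivAt_pow 2 (0 : ℝ)).const_mul (4 * (4 - 3 * E)))).congr_deriv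
        ?_
    simp
  have h1 := hasDerivAt_one_add_sq 0
  have h := ((hasDerivAt_lapseInt_zero hE).const_mul 2).exp.mul
    ((((((hasDerivAt_lapseQuot_zero hE).const_mul 2).mul hB).add hQ).div h1 (by simp)).sub
      ((hB.const_mul 2).div (h1.pow 2) (by simp)))
  refine h.deriv.trans ?_
  have := (parameter_pos hE).ne'
  simp [lapseInt_zero, boundaryPoly]
  field_simp
  ring

theorem deriv_baseCoeffQuot_zero : deriv (baseCoeffQuot E) 0 = 8 * (E - 1) / E := by
  have h := ((hasDerivAt_lapseInt_zero hE).const_mul 2).exp.mul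
    ((((hasDerivAt_lapseQuot_zero hE).const_mul 2).mul (hasDerivAt_one_add_sq 0)).add_const 2)
  refine h.deriv.trans ?_
  simp [lapseInt_zero]
  ring

end

theorem fibreCoeff_zero (E : ℝ) : fibreCoeff E 0 = E := by
  simp [fibreCoeff, lapseInt_zero, boundaryPoly]

theorem baseCoeff_zero (E : ℝ) : baseCoeff E 0 = 1 := by
  simp [baseCoeff, lapseInt_zero]

/-! ### The geodesic compactification -/

/-- The metric `a θ₁² + b g_{S²} / 4` on `S³`. -/
def squashedMetric (a b : ℝ) : BilinField (𝓡 3) S3 := fun x ↦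
  pullBilin (dcoe x) (a • thetaSq (x : E4) + (b / 4) • hopfBase (x : E4))

theorem squashedMetric_apply (a b : ℝ) (x : S3) (u v : TangentSpace (𝓡 3) x) :
    squashedMetric a b x u v = ambForm 0 a b (x : E4) (0, dcoe x u) (0, dcoe x v) := by
  simp [squashedMetric, ambForm, pullBilin_apply]

theorem squashedMetric_one_right (E : ℝ) : squashedMetric E 1 = bergerMetric E := by
  funext x
  ext u v
  rw [squashedMetric_apply, bergerMetric_apply]

/-- The geodesic compactification `(ρ, x) ↦ (1 / r(ρ), x)`, where `R` is the function `r(ρ)`. -/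
def collarMap (R : ℝ → ℝ) (p : ℝ × S3) : ℝ × S3 := ((R p.1)⁻¹, p.2)

/-- The metrics `h_ρ` of the geodesic compactification. -/
def collarFamily (E : ℝ) (R : ℝ → ℝ) (ρ : ℝ) : BilinField (𝓡 3) S3 :=
  squashedMetric (fibreCoeff E (R ρ)) (baseCoeff E (R ρ))

theorem mfderiv_collarMap {R : ℝ → ℝ} {R' ρ : ℝ} (hR : HasDerivAt R R' ρ) (h0 : R ρ ≠ 0) (x : S3)
    (U : TangentSpace I4 ((ρ, x) : ℝ × S3)) :
    (mfderiv I4 I4 (collarMap R) (ρ, x) U).1 = -R' / R ρ ^ 2 * U.1 ∧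
      (mfderiv I4 I4 (collarMap R) (ρ, x) U).2 = U.2 := by
  have h1 : HasMFDerivAt I4 𝓘(ℝ, ℝ) (fun p : ℝ × S3 ↦ (R p.1)⁻¹) (ρ, x) _ :=
    HasMFDerivAt.comp (I' := 𝓘(ℝ, ℝ)) (g := fun s ↦ (R s)⁻¹) (ρ, x)
      (hR.inv h0).hasFDerivAt.hasMFDerivAt (hasMFDerivAt_fst (ρ, x))
  have h2 := h1.prodMk (hasMFDerivAt_snd (I := 𝓘(ℝ, ℝ)) (I' := 𝓡 3) ((ρ, x) : ℝ × S3))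
  have h3 := h2.mfderiv
  have h4 := congrArg (fun L ↦ L U) h3
  refine ⟨(congrArg Prod.fst h4).trans ?_, (congrArg Prod.snd h4).trans rfl⟩
  change U.1 * (-R' / R ρ ^ 2) = _
  ring

theorem taubNUT_collarMap (l E : ℝ) {R : ℝ → ℝ} {R' ρ : ℝ} (hR : HasDerivAt R R' ρ)
    (h0 : R ρ ≠ 0) (x : S3) (U V : TangentSpace I4 ((ρ, x) : ℝ × S3)) :
    taubNUT l E (collarMap R (ρ, x)) (mfderiv I4 I4 (collarMap R) (ρ, x) U)
      (mfderiv I4 I4 (collarMap R) (ρ, x) V) =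
      ambForm (cTau l E (R ρ)⁻¹) (cFib l E (R ρ)⁻¹) (cBase l E (R ρ)⁻¹) x
        (-R' / R ρ ^ 2 * U.1, dcoe x U.2) (-R' / R ρ ^ 2 * V.1, dcoe x V.2) := by
  refine (taubNUT_apply l E _ _ _).trans ?_
  have h (W : TangentSpace I4 ((ρ, x) : ℝ × S3)) :
      ((mfderiv I4 I4 (collarMap R) (ρ, x) W).1, dcoe x (mfderiv I4 I4 (collarMap R) (ρ, x) W).2) =
        (-R' / R ρ ^ 2 * W.1, dcoe x W.2) :=
    Prod.ext (mfderiv_collarMap hR h0 x W).1 (congrArg (dcoe x) (mfderiv_collarMap hR h0 x W).2)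
  exact congr (congrArg (fun A ↦ ⇑(ambForm (cTau l E (R ρ)⁻¹) (cFib l E (R ρ)⁻¹)
    (cBase l E (R ρ)⁻¹) x A)) (h U)) (h V)

section

variable {l E : ℝ} (hE : E ∈ Ioo (2 / 3) ((2 + Real.sqrt 3) / 3)) {r : ℝ}
include hE

theorem div_geodesicDefining_sq (hr : r ≠ 0) :
    (l / geodesicDefining E r) ^ 2 = l ^ 2 * E * Real.exp (-lapseInt E r) ^ 2 / r ^ 2 := by
  have hE0 := parameter_pos hE
  have hs : 0 < Real.sqrt E := Real.sqrt_pos.2 hE0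
  have h : Real.sqrt E ^ 2 = E := Real.sq_sqrt hE0.le
  rw [geodesicDefining, Real.exp_neg]
  field_simp
  rw [h]

/-- The time part of the metric in the coordinate `ρ` is `-(l / ρ)² dρ²`. -/
theorem cTau_inv (hr : r ≠ 0) : cTau l E r⁻¹ * (definingSpeed E r / r ^ 2) ^ 2 =
    (l / geodesicDefining E r) ^ 2 := by
  have hB := (boundaryPoly_pos hE r).ne'
  have hA := boundaryPoly_eq E hr
  have hf := (lapse_pos hE r).ne'
  have hf2 := lapse_sq hE r
  have hE0 := parameter_pos hE
  have h : Real.sqrt E ^ 2 = E := Real.sq_sqrt hE0.le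
  have hT : taubNUTPoly E r⁻¹ = boundaryPoly E r / r ^ 4 := by
    rw [hA, one_div]; field_simp
  rw [div_geodesicDefining_sq hE hr, cTau, hT, definingSpeed, div_pow, div_pow, mul_pow, h, hf2]
  have : (1 + r ^ 2) ≠ 0 := by positivity
  field_simp

theorem cFib_inv (hr : r ≠ 0) :
    cFib l E r⁻¹ = (l / geodesicDefining E r) ^ 2 * fibreCoeff E r := by
  have hA := boundaryPoly_eq E hr
  have hT : taubNUTPoly E r⁻¹ = boundaryPoly E r / r ^ 4 := by
    rw [hA, one_div]; field_simp
  have : Real.exp (2 * lapseInt E r) = Real.exp (lapseInt E r) ^ 2 := by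
    rw [← Real.exp_nat_mul]; norm_num
  rw [div_geodesicDefining_sq hE hr, cFib, hT, fibreCoeff, this, Real.exp_neg]
  have : (1 + r ^ 2) ≠ 0 := by positivity
  have := (Real.exp_pos (lapseInt E r)).ne'
  field_simp

theorem cBase_inv (hr : r ≠ 0) :
    cBase l E r⁻¹ = (l / geodesicDefining E r) ^ 2 * baseCoeff E r := by
  have : Real.exp (2 * lapseInt E r) = Real.exp (lapseInt E r) ^ 2 := by
    rw [← Real.exp_nat_mul]; norm_num
  rw [div_geodesicDefining_sq hE hr, cBase, baseCoeff, this, Real.exp_neg]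
  have := (Real.exp_pos (lapseInt E r)).ne'
  field_simp

theorem fibreCoeff_pos (r : ℝ) : 0 < fibreCoeff E r :=
  mul_pos (Real.exp_pos _) (div_pos (boundaryPoly_pos hE r) (by positivity))

omit hE in
theorem baseCoeff_pos (E r : ℝ) : 0 < baseCoeff E r :=
  mul_pos (Real.exp_pos _) (by positivity)

end

/-- The geodesic compactification. An inextendible causal curve ends up in it since `τ` tends to `∞`
on the curve. -/
theorem exists_futureCollar {l E : ℝ} (hl : 0 < l)
    (hE : E ∈ Ioo (2 / 3) ((2 + Real.sqrt 3) / 3)) :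
    ∃ (ε : ℝ) (R : ℝ → ℝ), R 0 = 0 ∧ ContDiffAt ℝ ∞ R 0 ∧
      (∀ᶠ s in 𝓝 0, HasDerivAt R (definingSpeed E (R s)) s) ∧
      IsFutureCollar l (taubNUT l E) partialTau ε (collarMap R) (collarFamily E R) := by
  obtain ⟨ε, R, hε, hRs, hR0, hρ, hR', hinv⟩ := exists_inverse_geodesicDefining hE
  have hnhds : Ioo (-ε) ε ∈ 𝓝 (0 : ℝ) := Ioo_mem_nhds (by linarith) hε
  have hsub : Ioo 0 ε ⊆ Ioo (-ε) ε := Ioo_subset_Ioo_left (by linarith)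
  have hsub' : Ico 0 ε ⊆ Ioo (-ε) ε := fun s hs ↦ ⟨by linarith [hs.1], hs.2⟩
  have hpos (s : ℝ) (hs : s ∈ Ioo 0 ε) : 0 < R s := by
    rw [← (strictMono_geodesicDefining hE).lt_iff_lt, hρ s (hsub hs), geodesicDefining_zero]
    exact hs.1
  refine ⟨ε, R, hR0, hRs.contDiffAt hnhds, ?_, ?_⟩
  · filter_upwards [hnhds] with s hs using hR' s hs
  have hRm : ContMDiffOn I4 𝓘(ℝ, ℝ) ∞ (fun p : ℝ × S3 ↦ R p.1) (Ioo (-ε) ε ×ˢ univ) :=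
    (contMDiffOn_iff_contDiffOn.2 hRs).comp contMDiffOn_fst fun p hp ↦ hp.1
  constructor
  · exact hε
  · have h1 : ContMDiffOn I4 𝓘(ℝ, ℝ) ∞ (fun p : ℝ × S3 ↦ (R p.1)⁻¹) (Ioo 0 ε ×ˢ univ) :=
      (contMDiffOn_iff_contDiffOn.2 ((hRs.mono hsub).inv fun s hs ↦ (hpos s hs).ne')).comp
        contMDiffOn_fst fun p hp ↦ hp.1
    exact h1.prodMk contMDiffOn_snd
  · rintro ⟨s, x⟩ hs ⟨s', x'⟩ hs' h
    have h1 := (Prod.mk.inj h).1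
    have h2 := (Prod.mk.inj h).2
    have h3 : R s = R s' := inv_injective h1
    have h4 : s = s' := by
      rw [← hρ s (hsub hs.1), ← hρ s' (hsub hs'.1), h3]
    exact Prod.ext h4 h2
  · intro p hp
    have hf : ContMDiffWithinAt I4 𝓘(ℝ, ℝ) ∞ (fun p : ℝ × S3 ↦ fibreCoeff E (R p.1))
        (Ico 0 ε ×ˢ univ) p :=
      (contDiff_fibreCoeff hE).contMDiff.contMDiffAt.comp_contMDiffWithinAt p
        ((hRm.mono (prod_mono_left hsub')) p hp)
    have hb : ContMDiffWithinAt I4 𝓘(ℝ, ℝ) ∞ (fun p : ℝ × S3 ↦ baseCoeff E (R p.1) / 4)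
        (Ico 0 ε ×ˢ univ) p :=
      ((contDiff_baseCoeff hE).div_const 4).contMDiff.contMDiffAt.comp_contMDiffWithinAt p
        ((hRm.mono (prod_mono_left hsub')) p hp)
    have ht := (contDiff_thetaSq.contMDiff.comp contMDiff_emb_snd p).contMDiffWithinAt
      (s := Ico 0 ε ×ˢ univ)
    have hh := (contDiff_hopfBase.contMDiff.comp contMDiff_emb_snd p).contMDiffWithinAt
      (s := Ico 0 ε ×ˢ univ)
    exact contMDiffWithinAt_pullBilin contMDiff_coe (contMDiff_snd p).contMDiffWithinAt
      ((hf.smul ht).add (hb.smul hh))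
  · intro s _ x u v
    rw [collarFamily, squashedMetric_apply, squashedMetric_apply, ambForm_symm]
  · intro s _ x u hu
    rw [collarFamily, squashedMetric_apply]
    exact ambForm_space_pos (fibreCoeff_pos hE _) (baseCoeff_pos E _) (inner_coe_self x) rfl
      fun h ↦ hu (injective_dcoe x (h.trans (map_zero _).symm))
  · intro s hs x U V
    have hr := (hpos s hs).ne'
    have e := hρ s (hsub hs)
    have h1 := cTau_inv (l := l) hE hr
    have h2 := cFib_inv (l := l) hE hr
    have h3 := cBase_inv (l := l) hE hr
    rw [e] at h1 h2 h3
    have hsnd (W : TangentSpace I4 ((s, x) : ℝ × S3)) :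
        mfderiv I4 (𝓡 3) (Prod.snd : ℝ × S3 → S3) (s, x) W = W.2 := by
      rw [mfderiv_snd]; rfl
    have hsq := squashedMetric_apply (fibreCoeff E (R s)) (baseCoeff E (R s)) x U.2 V.2
    refine (taubNUT_collarMap l E (hR' s (hsub hs)) hr x U V).trans ?_
    rw [mvfderiv_fst_apply, mvfderiv_fst_apply, hsnd, hsnd, collarFamily]
    refine Eq.trans ?_ (congrArg (fun z ↦ (l / s) ^ 2 * (-(U.1 * V.1) + z)) hsq.symm)
    rw [ambForm_apply, ambForm_apply, h2, h3, ← h1]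
    ring
  · intro s hs x
    have hr := (hpos s hs).ne'
    have h1 := cTau_pos hl hE (collarMap R (s, x)).1
    have h2 : 0 < definingSpeed E (R s) / R s ^ 2 :=
      div_pos (definingSpeed_pos hE _) (pow_pos (hpos s hs) 2)
    have h3 := (mfderiv_collarMap (hR' s (hsub hs)) hr x
      (((1 : ℝ), (0 : E3)) : TangentSpace I4 ((s, x) : ℝ × S3))).1
    refine lt_of_lt_of_eq (mul_pos h1 h2) ?_
    refine Eq.trans ?_ (taubNUT_partialTau l E _ _).symm
    rw [h3]
    ring
  · intro c hc hi δ hδ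
    have h1 := tendsto_inv_atTop_nhdsGT_zero.comp
      (tendsto_atTop_of_futureInextendible hl hE hc hi)
    have h2 : Tendsto (geodesicDefining E) (𝓝 0) (𝓝 0) := by
      have := (contDiff_geodesicDefining hE).continuous.tendsto 0
      rwa [geodesicDefining_zero] at this
    have h3 : ∀ᶠ r in 𝓝[>] (0 : ℝ), 0 < r ∧ geodesicDefining E r < δ ∧
        R (geodesicDefining E r) = r := by
      filter_upwards [self_mem_nhdsWithin, nhdsWithin_le_nhds hinv,
        nhdsWithin_le_nhds (h2.eventually_lt_const hδ.1)] with r h1 h2 h3 using ⟨h1, h3, h2⟩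
    filter_upwards [h1.eventually h3] with t ht
    obtain ⟨h4, h5, h6⟩ := ht
    refine ⟨(geodesicDefining E (c t).1⁻¹, (c t).2), ⟨⟨?_, h5⟩, trivial⟩, ?_⟩
    · rw [← geodesicDefining_zero E]
      exact strictMono_geodesicDefining hE h4
    · refine Prod.ext ?_ rfl
      simp only [collarMap]
      simp only [Function.comp] at h6
      rw [h6, inv_inv]

theorem collarFamily_zero {E : ℝ} {R : ℝ → ℝ} (h0 : R 0 = 0) :
    collarFamily E R 0 = bergerMetric E := by
  rw [collarFamily, h0, fibreCoeff_zero, baseCoeff_zero, squashedMetric_one_right]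

/-- The third order coefficient is a multiple of `E - 1`. It is trace free with respect to `h₀`: it
is proportional to `g_{S²} / 4 - 2 E θ₁²`. -/
theorem coeffThree_collarFamily {E : ℝ} (hE : E ∈ Ioo (2 / 3) ((2 + Real.sqrt 3) / 3)) {R : ℝ → ℝ}
    (h0 : R 0 = 0) (hRs : ContDiffAt ℝ ∞ R 0)
    (hR : ∀ᶠ s in 𝓝 0, HasDerivAt R (definingSpeed E (R s)) s) (x : S3)
    (u v : TangentSpace (𝓡 3) x) :
    coeffThree (collarFamily E R) x u v = (E - 1) * Real.sqrt E * (8 / 3) *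
      (inner ℝ (dcoe x u) (dcoe x v) - (1 + 2 * E) *
        (inner ℝ (hopfRot x) (dcoe x u) * inner ℝ (hopfRot x) (dcoe x v))) := by
  have hE0 := parameter_pos hE
  have hs : Real.sqrt E ^ 2 = E := Real.sq_sqrt hE0.le
  set α : ℝ := inner ℝ (hopfRot x) (dcoe x u) * inner ℝ (hopfRot x) (dcoe x v)
  set β : ℝ := inner ℝ (dcoe x u) (dcoe x v) - α
  have hP (r : ℝ) : HasDerivAt (fun r ↦ fibreCoeff E r * α + baseCoeff E r * β)
      (r * (fibreCoeffQuot E r * α + baseCoeffQuot E r * β)) r :=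
    (((hasDerivAt_fibreCoeff hE r).mul_const α).add
      ((hasDerivAt_baseCoeff hE r).mul_const β)).congr_deriv (by ring)
  have hPs : ContDiff ℝ ∞ fun r ↦ fibreCoeff E r * α + baseCoeff E r * β :=
    ((contDiff_fibreCoeff hE).mul contDiff_const).add ((contDiff_baseCoeff hE).mul contDiff_const)
  have hm : ContDiff ℝ ∞ fun r ↦ fibreCoeffQuot E r * α + baseCoeffQuot E r * β :=
    ((contDiff_fibreCoeffQuot hE).mul contDiff_const).add
      ((contDiff_baseCoeffQuot hE).mul contDiff_const)
  have hm' : deriv (fun r ↦ fibreCoeffQuot E r * α + baseCoeffQuot E r * β) 0 =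
      -16 * (E - 1) * α + 8 * (E - 1) / E * β := by
    have h1 := ((contDiff_fibreCoeffQuot hE).differentiable (by simp) 0).hasDerivAt
    have h2 := ((contDiff_baseCoeffQuot hE).differentiable (by simp) 0).hasDerivAt
    rw [deriv_fibreCoeffQuot_zero hE] at h1
    rw [deriv_baseCoeffQuot_zero hE] at h2
    exact ((h1.mul_const α).add (h2.mul_const β)).deriv
  have key := iteratedDeriv_three_comp hR h0 (contDiff_definingSpeed hE) hm hP
    (deriv_definingSpeed_zero hE)
  have hfun : (fun ρ ↦ collarFamily E R ρ x u v) =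
      fun s ↦ fibreCoeff E (R s) * α + baseCoeff E (R s) * β := by
    funext s
    rw [collarFamily, squashedMetric_apply, ambForm_apply, inner_coe_self]
    simp [α, β]
  have hcd : ContDiffAt ℝ (3 : ℕ) (fun s ↦ fibreCoeff E (R s) * α + baseCoeff E (R s) * β) 0 :=
    contDiffAt_infty.1 (hPs.contDiffAt.comp (0 : ℝ) hRs) 3
  rw [coeffThree, hfun, iteratedDerivWithin_eq_iteratedDeriv (uniqueDiffOn_Ici 0) hcd
    self_mem_Ici, key, hm', definingSpeed_zero hE]
  have h3 : Real.sqrt E ^ 3 = E * Real.sqrt E := by rw [pow_succ, hs]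
  rw [h3]
  simp only [β]
  field_simp
  ring

/-! ### Rotation of the Hopf fibres -/

theorem rotate_mem_sphere (x : S3) (β : ℝ) :
    Real.cos β • (x : E4) + Real.sin β • hopfRot x ∈ Metric.sphere (0 : E4) 1 := by
  have h := inner_rotate (x : E4) x β
  rw [inner_coe_self, real_inner_self_eq_norm_sq] at h
  rw [mem_sphere_zero_iff_norm]
  nlinarith [norm_nonneg (Real.cos β • (x : E4) + Real.sin β • hopfRot x)]

/-- The rotation of the Hopf fibres by the angle `t / L`. -/
def hopfFlow (L t : ℝ) (x : S3) : S3 :=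
  ⟨Real.cos (t / L) • (x : E4) + Real.sin (t / L) • hopfRot x, rotate_mem_sphere x _⟩

theorem exists_hopfField (L : ℝ) (x : S3) :
    ∃ u : TangentSpace (𝓡 3) x, dcoe x u = (1 / L) • hopfRot (x : E4) := by
  rw [mem_range_dcoe, real_inner_smul_right, real_inner_comm, inner_hopfRot_self, mul_zero]

/-- The vector field that generates `hopfFlow L`. -/
def hopfField (L : ℝ) (x : S3) : TangentSpace (𝓡 3) x := (exists_hopfField L x).choose

/-- The rotation field at speed `1 / L`; it has unit length for `γ` when `L = l √E`. -/
theorem dcoe_hopfField (L : ℝ) (x : S3) : dcoe x (hopfField L x) = (1 / L) • hopfRot (x : E4) :=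
  (exists_hopfField L x).choose_spec

theorem coe_hopfFlow (L t : ℝ) (x : S3) : (hopfFlow L t x : E4) =
    Real.cos (t / L) • (x : E4) + Real.sin (t / L) • hopfRot x := rfl

theorem hopfFlow_zero (L : ℝ) (x : S3) : hopfFlow L 0 x = x := by
  apply Subtype.ext
  simp [coe_hopfFlow]

theorem hopfFlow_add (L s t : ℝ) (x : S3) :
    hopfFlow L (s + t) x = hopfFlow L s (hopfFlow L t x) := by
  apply Subtype.ext
  simp only [coe_hopfFlow, hopfRot_add, hopfRot_smul, hopfRot_hopfRot, add_div, Real.cos_add,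
    Real.sin_add]
  module

theorem contMDiff_hopfFlow (L : ℝ) :
    ContMDiff I4 (𝓡 3) ∞ fun p : ℝ × S3 ↦ hopfFlow L p.1 p.2 := by
  have h : ContDiff ℝ ∞ fun p : ℝ × E4 ↦
      Real.cos (p.1 / L) • p.2 + Real.sin (p.1 / L) • hopfRotL p.2 := by fun_prop
  exact (h.contMDiff.comp contMDiff_emb).codRestrict_sphere fun p ↦ rotate_mem_sphere p.2 _

theorem contMDiff_hopfFlow_left (L : ℝ) (x : S3) :
    ContMDiff 𝓘(ℝ, ℝ) (𝓡 3) ∞ fun t ↦ hopfFlow L t x :=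
  ContMDiff.comp (g := fun p : ℝ × S3 ↦ hopfFlow L p.1 p.2) (f := fun t : ℝ ↦ (t, x))
    (contMDiff_hopfFlow L) (contMDiff_id.prodMk contMDiff_const)

theorem contMDiff_hopfFlow_right (L t : ℝ) : ContMDiff (𝓡 3) (𝓡 3) ∞ (hopfFlow L t) :=
  ContMDiff.comp (g := fun p : ℝ × S3 ↦ hopfFlow L p.1 p.2) (f := fun x : S3 ↦ (t, x))
    (contMDiff_hopfFlow L) (contMDiff_const.prodMk contMDiff_id)

theorem dcoe_mfderiv {E' H' P : Type*} [NormedAddCommGroup E'] [NormedSpace ℝ E']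
    [TopologicalSpace H'] {I' : ModelWithCorners ℝ E' H'} [TopologicalSpace P] [ChartedSpace H' P]
    {f : P → S3} {p : P} (hf : MDifferentiableAt I' (𝓡 3) f p) (u : TangentSpace I' p) :
    dcoe (f p) (mfderiv I' (𝓡 3) f p u) = mfderiv I' 𝓘(ℝ, E4) (fun q ↦ (f q : E4)) p u :=
  (mfderiv_comp_apply (I := I') (I' := 𝓡 3) (I'' := 𝓘(ℝ, E4)) p (g := fun q : S3 ↦ (q : E4))
    (contMDiff_coe.mdifferentiable (by simp) _) hf u).symm

theorem isMIntegralCurve_hopfFlow (L : ℝ) (x : S3) :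
    IsMIntegralCurve (I := 𝓡 3) (fun t ↦ hopfFlow L t x) (hopfField L) := by
  intro t
  have hd := (contMDiff_hopfFlow_left L x).mdifferentiable (by simp) t
  have h1 : dcoe (hopfFlow L t x) (mfderiv 𝓘(ℝ, ℝ) (𝓡 3) (fun t ↦ hopfFlow L t x) t (1 : ℝ)) =
      (1 / L) • hopfRot (hopfFlow L t x : E4) := by
    have hlin : HasDerivAt (fun t : ℝ ↦ t / L) (1 / L) t := (hasDerivAt_id t).div_const L
    have hder : HasDerivAt (fun t ↦ (hopfFlow L t x : E4))
        ((1 / L) • hopfRot (hopfFlow L t x : E4)) t := by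
      refine ((hlin.cos.smul_const (x : E4)).add
        (hlin.sin.smul_const (hopfRot (x : E4)))).congr_deriv ?_
      rw [coe_hopfFlow, hopfRot_add, hopfRot_smul, hopfRot_smul, hopfRot_hopfRot]
      module
    refine (dcoe_mfderiv (f := fun t ↦ hopfFlow L t x) hd (1 : ℝ)).trans ?_
    rw [mfderiv_eq_fderiv]
    exact hder.deriv
  have h2 : mfderiv 𝓘(ℝ, ℝ) (𝓡 3) (fun t ↦ hopfFlow L t x) t (1 : ℝ) =
      hopfField L (hopfFlow L t x) :=
    injective_dcoe _ (h1.trans (dcoe_hopfField L _).symm)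
  have h3 := hd.hasMFDerivAt
  refine h3.congr_mfderiv ?_
  refine ContinuousLinearMap.ext_ring ?_
  exact h2.trans (one_smul ℝ (hopfField L (hopfFlow L t x))).symm

theorem dcoe_mfderiv_hopfFlow (L t : ℝ) (x : S3) (u : TangentSpace (𝓡 3) x) :
    dcoe (hopfFlow L t x) (mfderiv (𝓡 3) (𝓡 3) (hopfFlow L t) x u) =
      Real.cos (t / L) • dcoe x u + Real.sin (t / L) • hopfRot (dcoe x u) := by
  refine (dcoe_mfderiv ((contMDiff_hopfFlow_right L t).mdifferentiable (by simp) x) u).trans ?_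
  set A : E4 →L[ℝ] E4 := Real.cos (t / L) • ContinuousLinearMap.id ℝ E4
    + Real.sin (t / L) • hopfRotL
  have h := mvfderiv_comp_fderiv (I := 𝓡 3) (f := fun q : S3 ↦ (q : E4)) (k := A) x
    A.differentiableAt (contMDiff_coe.mdifferentiable (by simp) x) u
  rw [A.fderiv] at h
  exact h

theorem isKilling_hopfFlow {l E L : ℝ} {h : ℝ → BilinField (𝓡 3) S3} (h0 : h 0 = bergerMetric E) :
    IsKilling (boundaryMetric l h) (hopfField L) (hopfFlow L) := by
  have hiso : ∀ t x, ∀ u v : TangentSpace (𝓡 3) x,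
      boundaryMetric l h (hopfFlow L t x) (mfderiv (𝓡 3) (𝓡 3) (hopfFlow L t) x u)
        (mfderiv (𝓡 3) (𝓡 3) (hopfFlow L t) x v) = boundaryMetric l h x u v := by
    intro t x u v
    change l ^ 2 * h 0 (hopfFlow L t x) _ _ = l ^ 2 * h 0 x u v
    rw [h0, bergerMetric_apply, bergerMetric_apply, dcoe_mfderiv_hopfFlow, dcoe_mfderiv_hopfFlow,
      coe_hopfFlow, ambForm_rotate]
  exact
    { smooth := contMDiff_hopfFlow L
      zero := hopfFlow_zero L
      add := hopfFlow_add L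
      velocity := isMIntegralCurve_hopfFlow L
      conformal := fun t x ↦ ⟨1, one_pos, fun u v ↦ by rw [hiso, one_mul]⟩
      isometric := hiso }

/-! ### The quotient by the rotation of the fibres -/

/-- The squared modulus of `w` at `(z, w) ∈ ℂ²`. -/
def sndSq (x : E4) : ℝ := x 2 ^ 2 + x 3 ^ 2

/-- The coordinate `z / w` of the Hopf fibre of `(z, w)`. -/
def hopfQuot (x : E4) : E2 :=
  !₂[(x 0 * x 2 + x 1 * x 3) / sndSq x, (x 1 * x 2 - x 0 * x 3) / sndSq x]

/-- The point of `S³` over `ζ ∈ ℂ`, `(ζ, 1)` normalised. -/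
def hopfSection (y : E2) : E4 := (Real.sqrt (1 + y 0 ^ 2 + y 1 ^ 2))⁻¹ • !₂[y 0, y 1, 1, 0]

/-- The real part of `z' w - z w'` for `x = (z, w)` and `u = (z', w')`. -/
def quotRe (x u : E4) : ℝ := u 0 * x 2 - u 1 * x 3 - (x 0 * u 2 - x 1 * u 3)

/-- The imaginary part of `z' w - z w'` for `x = (z, w)` and `u = (z', w')`. -/
def quotIm (x u : E4) : ℝ := u 0 * x 3 + u 1 * x 2 - (x 0 * u 3 + x 1 * u 2)

/-- On the orthogonal complement of the complex line of `x`, the complex determinant with `x` is an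
isometry. -/
theorem inner_sub_theta {x : E4} (hx : inner ℝ x x = (1 : ℝ)) {u v : E4}
    (hu : inner ℝ x u = (0 : ℝ)) :
    inner ℝ u v - inner ℝ (hopfRot x) u * inner ℝ (hopfRot x) v =
      quotRe x u * quotRe x v + quotIm x u * quotIm x v := by
  have h : inner ℝ x x * inner ℝ u v = inner ℝ x u * inner ℝ x v
      + inner ℝ (hopfRot x) u * inner ℝ (hopfRot x) v
      + (quotRe x u * quotRe x v + quotIm x u * quotIm x v) := by
    simp only [inner_eq4, quotRe, quotIm, hopfRot]
    simp
    ring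
  rw [hx, hu] at h
  linarith

theorem one_add_hopfQuot {x : E4} (hx : inner ℝ x x = (1 : ℝ)) (h : sndSq x ≠ 0) :
    1 + hopfQuot x 0 ^ 2 + hopfQuot x 1 ^ 2 = (sndSq x)⁻¹ := by
  have h1 : x 0 ^ 2 + x 1 ^ 2 + sndSq x = 1 := by
    rw [inner_eq4] at hx; unfold sndSq; linarith
  have h2 : (x 0 * x 2 + x 1 * x 3) ^ 2 + (x 1 * x 2 - x 0 * x 3) ^ 2 =
      (x 0 ^ 2 + x 1 ^ 2) * sndSq x := by unfold sndSq; ring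
  simp only [hopfQuot]
  simp
  field_simp
  linear_combination h2 + sndSq x * h1

theorem sndSq_rotate (x : E4) (β : ℝ) :
    sndSq (Real.cos β • x + Real.sin β • hopfRot x) = sndSq x := by
  simp [sndSq, hopfRot]
  linear_combination (x 2 ^ 2 + x 3 ^ 2) * Real.cos_sq_add_sin_sq β

theorem hopfQuot_rotate (x : E4) (β : ℝ) :
    hopfQuot (Real.cos β • x + Real.sin β • hopfRot x) = hopfQuot x := by
  have h := Real.cos_sq_add_sin_sq β
  ext i
  fin_cases i <;> simp only [hopfQuot, sndSq_rotate] <;> simp [hopfRot] <;> congr 1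
  · linear_combination (x 0 * x 2 + x 1 * x 3) * h
  · linear_combination (x 1 * x 2 - x 0 * x 3) * h

/-- Two points of the sphere with the same quotient lie on the same Hopf fibre. -/
theorem exists_rotate_of_hopfQuot_eq {x x' : E4} (hx : inner ℝ x x = (1 : ℝ))
    (hx' : inner ℝ x' x' = (1 : ℝ)) (h : sndSq x ≠ 0) (h' : sndSq x' ≠ 0)
    (hq : hopfQuot x = hopfQuot x') :
    ∃ β : ℝ, Real.cos β • x + Real.sin β • hopfRot x = x' := by
  have hn : sndSq x = sndSq x' := by
    rw [← inv_inj, ← one_add_hopfQuot hx h, ← one_add_hopfQuot hx' h', hq]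
  have hq0 : x 0 * x 2 + x 1 * x 3 = x' 0 * x' 2 + x' 1 * x' 3 := by
    have := congrArg (fun y : E2 ↦ y 0) hq
    simp only [hopfQuot, hn] at this
    simpa [h'] using this
  have hq1 : x 1 * x 2 - x 0 * x 3 = x' 1 * x' 2 - x' 0 * x' 3 := by
    have := congrArg (fun y : E2 ↦ y 1) hq
    simp only [hopfQuot, hn] at this
    simpa [h'] using this
  -- the angle is that of `w' / w`
  set z : ℂ := ⟨(x' 2 * x 2 + x' 3 * x 3) / sndSq x, (x' 3 * x 2 - x' 2 * x 3) / sndSq x⟩ with hz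
  have hz1 : ‖z‖ = 1 := by
    have : Complex.normSq z = 1 := by
      rw [Complex.normSq_mk, div_mul_div_comm, div_mul_div_comm, ← add_div, div_eq_one_iff_eq
        (mul_ne_zero h h)]
      nth_rewrite 2 [hn]
      unfold sndSq; ring
    rw [Complex.normSq_eq_norm_sq] at this
    nlinarith [norm_nonneg z]
  have hz0 : z ≠ 0 := by intro h0; rw [h0, norm_zero] at hz1; exact zero_ne_one hz1
  have hc := Complex.cos_arg hz0
  have hs := Complex.sin_arg z
  rw [hz1, div_one] at hc hs
  refine ⟨z.arg, ?_⟩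
  rw [hc, hs]
  have hn2 : x 2 ^ 2 + x 3 ^ 2 = sndSq x := rfl
  have hn2' : x' 2 ^ 2 + x' 3 ^ 2 = sndSq x := hn.symm
  ext i
  fin_cases i <;> simp [hz, hopfRot] <;> field_simp
  · linear_combination x' 2 * hq0 - x' 3 * hq1 + x' 0 * hn2'
  · linear_combination x' 3 * hq0 + x' 2 * hq1 + x' 1 * hn2'
  · linear_combination x' 2 * hn2
  · linear_combination x' 3 * hn2

theorem hopfSection_norm (y : E2) : inner ℝ (hopfSection y) (hopfSection y) = (1 : ℝ) := by
  have hn : 0 < 1 + y 0 ^ 2 + y 1 ^ 2 := by positivity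
  have h := Real.sq_sqrt hn.le
  rw [hopfSection, real_inner_smul_left, real_inner_smul_right, inner_eq4]
  have := (Real.sqrt_pos.2 hn).ne'
  simp
  field_simp
  rw [h]; ring

theorem sndSq_hopfSection (y : E2) : sndSq (hopfSection y) = (1 + y 0 ^ 2 + y 1 ^ 2)⁻¹ := by
  have hn : 0 < 1 + y 0 ^ 2 + y 1 ^ 2 := by positivity
  have h := Real.sq_sqrt hn.le
  simp [sndSq, hopfSection, h]

theorem hopfQuot_hopfSection (y : E2) : hopfQuot (hopfSection y) = y := by
  have hn : 0 < 1 + y 0 ^ 2 + y 1 ^ 2 := by positivity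
  have h := Real.sq_sqrt hn.le
  have := (Real.sqrt_pos.2 hn).ne'
  ext i
  fin_cases i <;> simp only [hopfQuot, sndSq_hopfSection] <;> simp [hopfSection] <;> field_simp <;>
    rw [h]

/-- The derivative of the quotient map along a curve. -/
theorem hasDerivAt_hopfQuot {c : ℝ → E4} {u : E4} {t : ℝ} (hc : HasDerivAt c u t)
    (h : sndSq (c t) ≠ 0) :
    HasDerivAt (fun t ↦ hopfQuot (c t) 0)
      ((quotRe (c t) u * (c t 2 ^ 2 - c t 3 ^ 2) + quotIm (c t) u * (2 * c t 2 * c t 3))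
        / sndSq (c t) ^ 2) t ∧
    HasDerivAt (fun t ↦ hopfQuot (c t) 1)
      ((quotIm (c t) u * (c t 2 ^ 2 - c t 3 ^ 2) - quotRe (c t) u * (2 * c t 2 * c t 3))
        / sndSq (c t) ^ 2) t := by
  have hk (i : Fin 4) : HasDerivAt (fun t ↦ c t i) (u i) t :=
    (EuclideanSpace.proj i : E4 →L[ℝ] ℝ).hasFDerivAt.comp_hasDerivAt t hc
  have hn : HasDerivAt (fun t ↦ sndSq (c t)) (2 * c t 2 * u 2 + 2 * c t 3 * u 3) t := by
    refine (((hk 2).pow 2).add ((hk 3).pow 2)).congr_deriv ?_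
    simp
  constructor
  · refine ((((hk 0).mul (hk 2)).add ((hk 1).mul (hk 3))).div hn h).congr_deriv ?_
    congr 1
    simp [sndSq, quotRe, quotIm]
    ring
  · refine ((((hk 1).mul (hk 2)).sub ((hk 0).mul (hk 3))).div hn h).congr_deriv ?_
    congr 1
    simp [sndSq, quotRe, quotIm]
    ring

/-! ### Unit normals and Gram determinants -/

section Gram

variable {V : Type*} [AddCommGroup V] [Module ℝ V]

theorem linearIndependent_three_iff {a b K : V} : LinearIndependent ℝ ![a, b, K] ↔
    ∀ r s t : ℝ, r • a + s • b + t • K = 0 → r = 0 ∧ s = 0 ∧ t = 0 := by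
  rw [Fintype.linearIndependent_iff]
  constructor
  · intro h r s t hrst
    have := h ![r, s, t] (by simpa [Fin.sum_univ_three] using hrst)
    exact ⟨this 0, this 1, this 2⟩
  · intro h g hg
    have := h (g 0) (g 1) (g 2) (by simpa [Fin.sum_univ_three] using hg)
    intro i
    fin_cases i
    exacts [this.1, this.2.1, this.2.2]

variable [TopologicalSpace V]
  {B : V →L[ℝ] V →L[ℝ] ℝ} {a b K : V}

/-- The unit normal of a plane in the direction of a transverse vector. -/
theorem exists_unit_normal (hsymm : ∀ u v, B u v = B v u) (hpos : ∀ u, u ≠ 0 → 0 < B u u)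
    (hli : LinearIndependent ℝ ![a, b, K]) :
    ∃ ν, B ν a = 0 ∧ B ν b = 0 ∧ B ν ν = 1 ∧ 0 < B ν K := by
  rw [linearIndependent_three_iff] at hli
  have ha : a ≠ 0 := by
    rintro rfl
    simpa using hli 1 0 0 (by simp)
  have haa := hpos a ha
  have hw : B a a • b - B a b • a ≠ 0 := by
    intro h
    have := hli (-B a b) (B a a) 0 (by rw [← h]; module)
    exact haa.ne' this.2.1
  have hdet : 0 < B a a * B b b - B a b ^ 2 := by
    have h1 := hpos _ hw
    have h2 : B (B a a • b - B a b • a) (B a a • b - B a b • a) =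
        B a a * (B a a * B b b - B a b ^ 2) := by
      simp [hsymm b a]; ring
    rw [h2] at h1
    exact pos_of_mul_pos_right h1 haa.le
  -- Cramer's rule for the component of `K` that is orthogonal to `a` and `b`
  set d := B a a * B b b - B a b ^ 2
  set n := d • K - (B a K * B b b - B b K * B a b) • a - (B a a * B b K - B a b * B a K) • b
    with hn
  have hn0 : n ≠ 0 := by
    intro h
    have := hli (-(B a K * B b b - B b K * B a b)) (-(B a a * B b K - B a b * B a K)) d
      (by rw [← h, hn]; module)
    exact hdet.ne' this.2.2
  have hna : B n a = 0 := by
    simp [hn, hsymm K a, hsymm b a, d]; ring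
  have hnb : B n b = 0 := by
    simp [hn, hsymm K b, d]; ring
  have hnn := hpos n hn0
  have hnK : B n n = d * B n K := by
    nth_rewrite 2 [hn]
    simp [hna, hnb]
  have hs := Real.sqrt_pos.2 hnn
  have hsq := Real.sq_sqrt hnn.le
  refine ⟨(Real.sqrt (B n n))⁻¹ • n, by simp [hna], by simp [hnb], ?_, ?_⟩
  · simp only [map_smul, smul_apply, smul_eq_mul]
    field_simp
    exact hsq.symm
  · simp only [map_smul, smul_apply, smul_eq_mul]
    refine mul_pos (inv_pos.2 hs) ?_
    rw [hnK] at hnn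
    exact pos_of_mul_pos_right hnn hdet.le

/-- The flux of `K` through the parallelogram of `a` and `b` is the volume of the parallelepiped of
`a`, `b` and `K`. -/
theorem normal_mul_area (hsymm : ∀ u v, B u v = B v u) (hfin : Module.finrank ℝ V = 3)
    (hli : LinearIndependent ℝ ![a, b, K]) {ν : V} (ha : B ν a = 0) (hb : B ν b = 0)
    (h1 : B ν ν = 1) (hK : 0 < B ν K) :
    B ν K * Real.sqrt (B a a * B b b - B a b ^ 2) =
      Real.sqrt (B a a * (B b b * B K K - B b K ^ 2) - B a b * (B a b * B K K - B b K * B a K)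
        + B a K * (B a b * B b K - B b b * B a K)) := by
  have : FiniteDimensional ℝ V := Module.finite_of_finrank_pos (by rw [hfin]; norm_num)
  have hspan := hli.span_eq_top_of_card_eq_finrank' (by simp [hfin])
  have hν : ν ∈ Submodule.span ℝ (Set.range ![a, b, K]) := hspan ▸ Submodule.mem_top
  obtain ⟨c, hc⟩ := (Submodule.mem_span_range_iff_exists_fun ℝ).1 hν
  rw [Fin.sum_univ_three] at hc
  simp only [Matrix.cons_val_zero, Matrix.cons_val_one, Matrix.cons_val] at hc
  have e (u : V) : B ν u = c 0 * B a u + c 1 * B b u + c 2 * B K u := by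
    rw [← hc]; simp
  have e1 := e a
  have e2 := e b
  have e3 := e K
  have e4 : B ν ν = c 2 * B ν K := by
    have h := congrArg (B ν) hc
    rw [map_add, map_add, map_smul, map_smul, map_smul, ha, hb] at h
    simpa using h.symm
  rw [ha, hsymm b a, hsymm K a] at e1
  rw [hb, hsymm K b] at e2
  rw [h1] at e4
  set p := B ν K
  have hdet : B a a * (B b b * B K K - B b K ^ 2) - B a b * (B a b * B K K - B b K * B a K)
        + B a K * (B a b * B b K - B b b * B a K) = p ^ 2 * (B a a * B b b - B a b ^ 2) := by
    linear_combination (B a a * (B b b * B K K - B b K ^ 2)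
      - B a b * (B a b * B K K - B b K * B a K) + B a K * (B a b * B b K - B b b * B a K)) * e4
      - p * (B a b * B b K - B b b * B a K) * e1 - p * (B a b * B a K - B a a * B b K) * e2
      - p * (B a a * B b b - B a b ^ 2) * e3
  rw [hdet, Real.sqrt_mul (sq_nonneg p), Real.sqrt_sq hK.le]

end Gram

/-! ### Surfaces transverse to the Hopf fibres -/

theorem det_eq_of_single (A : E2 →L[ℝ] E2) :
    A.det = A (EuclideanSpace.single 0 1) 0 * A (EuclideanSpace.single 1 1) 1
      - A (EuclideanSpace.single 1 1) 0 * A (EuclideanSpace.single 0 1) 1 := by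
  rw [ContinuousLinearMap.det,
    ← LinearMap.det_toMatrix (EuclideanSpace.basisFun (Fin 2) ℝ).toBasis, Matrix.det_fin_two]
  simp [LinearMap.toMatrix_apply]

theorem contDiffAt_hopfQuot {x : E4} (h : sndSq x ≠ 0) : ContDiffAt ℝ ∞ hopfQuot x := by
  have hn : ContDiff ℝ ∞ sndSq := by unfold sndSq; fun_prop
  refine contDiffAt_euclidean.2 fun i ↦ ?_
  fin_cases i
  · exact ContDiffAt.div (f := fun x : E4 ↦ x 0 * x 2 + x 1 * x 3) (by fun_prop) hn.contDiffAt h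
  · exact ContDiffAt.div (f := fun x : E4 ↦ x 1 * x 2 - x 0 * x 3) (by fun_prop) hn.contDiffAt h

/-- The Jacobian of the projection of a surface along the Hopf fibres. -/
theorem det_fderiv_hopfQuot {s : E2 → E4} {y : E2} (hs : DifferentiableAt ℝ s y)
    (h : sndSq (s y) ≠ 0) :
    DifferentiableAt ℝ (fun y ↦ hopfQuot (s y)) y ∧
    (fderiv ℝ (fun y ↦ hopfQuot (s y)) y).det * sndSq (s y) ^ 2 =
      quotRe (s y) (fderiv ℝ s y (EuclideanSpace.single 0 1))
          * quotIm (s y) (fderiv ℝ s y (EuclideanSpace.single 1 1))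
        - quotRe (s y) (fderiv ℝ s y (EuclideanSpace.single 1 1))
          * quotIm (s y) (fderiv ℝ s y (EuclideanSpace.single 0 1)) := by
  have hd : DifferentiableAt ℝ (fun y ↦ hopfQuot (s y)) y :=
    ((contDiffAt_hopfQuot h).differentiableAt (by simp)).comp y hs
  refine ⟨hd, ?_⟩
  have hl (u : E2) : HasDerivAt (fun t : ℝ ↦ s (y + t • u)) (fderiv ℝ s y u) 0 :=
    hs.hasFDerivAt.hasLineDerivAt u
  have hq (u : E2) (i : Fin 2) : HasDerivAt (fun t : ℝ ↦ hopfQuot (s (y + t • u)) i)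
      (fderiv ℝ (fun y ↦ hopfQuot (s y)) y u i) 0 :=
    (EuclideanSpace.proj i : E2 →L[ℝ] ℝ).hasFDerivAt.comp_hasDerivAt (0 : ℝ)
      (hd.hasFDerivAt.hasLineDerivAt u)
  have hy (u : E2) : s (y + (0 : ℝ) • u) = s y := by simp
  have hc (u : E2) := hasDerivAt_hopfQuot (hl u) (by rw [hy]; exact h)
  have h0 (u : E2) := (hq u 0).unique (hc u).1
  have h1 (u : E2) := (hq u 1).unique (hc u).2
  simp only [hy] at h0 h1
  rw [det_eq_of_single, h0, h0, h1, h1]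
  have hn : sndSq (s y) = s y 2 ^ 2 + s y 3 ^ 2 := rfl
  field_simp
  rw [hn]
  ring

/-- The points at which `z / w` is infinite form a single fibre. -/
theorem exists_rotate_of_sndSq_eq_zero {x x' : E4} (hx : inner ℝ x x = (1 : ℝ))
    (hx' : inner ℝ x' x' = (1 : ℝ)) (h : sndSq x = 0) (h' : sndSq x' = 0) :
    ∃ β : ℝ, Real.cos β • x + Real.sin β • hopfRot x = x' := by
  have hz (x : E4) (hx : inner ℝ x x = (1 : ℝ)) (h : sndSq x = 0) :
      x 2 = 0 ∧ x 3 = 0 ∧ x 0 ^ 2 + x 1 ^ 2 = 1 := by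
    unfold sndSq at h
    rw [inner_eq4] at hx
    have h2 : x 2 = 0 := by nlinarith [sq_nonneg (x 2), sq_nonneg (x 3)]
    have h3 : x 3 = 0 := by nlinarith [sq_nonneg (x 2), sq_nonneg (x 3)]
    exact ⟨h2, h3, by nlinarith⟩
  obtain ⟨h2, h3, hn⟩ := hz x hx h
  obtain ⟨h2', h3', hn'⟩ := hz x' hx' h'
  set z : ℂ := ⟨x' 0 * x 0 + x' 1 * x 1, x' 1 * x 0 - x' 0 * x 1⟩ with hz
  have hz1 : ‖z‖ = 1 := by
    have : Complex.normSq z = 1 := by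
      rw [Complex.normSq_mk]
      linear_combination (x' 0 ^ 2 + x' 1 ^ 2) * hn + hn'
    rw [Complex.normSq_eq_norm_sq] at this
    nlinarith [norm_nonneg z]
  have hz0 : z ≠ 0 := by intro h0; rw [h0, norm_zero] at hz1; exact zero_ne_one hz1
  have hc := Complex.cos_arg hz0
  have hs := Complex.sin_arg z
  rw [hz1, div_one] at hc hs
  refine ⟨z.arg, ?_⟩
  rw [hc, hs]
  ext i
  fin_cases i <;> simp [hz, hopfRot, h2, h3, h2', h3']
  · linear_combination x' 0 * hn
  · linear_combination x' 1 * hn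

/-- The points of a Hopf fibre of the sphere form an orbit of the rotation. -/
theorem exists_hopfFlow {L : ℝ} (hL : L ≠ 0) {x x' : S3}
    (h : (sndSq (x : E4) = 0 ∧ sndSq (x' : E4) = 0) ∨
      (sndSq (x : E4) ≠ 0 ∧ sndSq (x' : E4) ≠ 0 ∧ hopfQuot x = hopfQuot x')) :
    ∃ t, hopfFlow L t x = x' := by
  obtain ⟨β, hβ⟩ : ∃ β : ℝ, Real.cos β • (x : E4) + Real.sin β • hopfRot x = x' := by
    rcases h with ⟨h, h'⟩ | ⟨h, h', hq⟩
    · exact exists_rotate_of_sndSq_eq_zero (inner_coe_self x) (inner_coe_self x') h h'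
    · exact exists_rotate_of_hopfQuot_eq (inner_coe_self x) (inner_coe_self x') h h' hq
  refine ⟨β * L, Subtype.ext ?_⟩
  rw [coe_hopfFlow, mul_div_cancel_right₀ _ hL, hβ]

theorem hopfQuot_hopfFlow (L t : ℝ) (x : S3) : hopfQuot (hopfFlow L t x) = hopfQuot x :=
  hopfQuot_rotate _ _

theorem sndSq_hopfFlow (L t : ℝ) (x : S3) : sndSq (hopfFlow L t x : E4) = sndSq (x : E4) :=
  sndSq_rotate _ _

/-- The density `(1 + |ζ|²)⁻²` of the area of the sphere of radius `1 / 2` in the stereographic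
coordinate `ζ`. -/
def baseDensity (ζ : E2) : ℝ := ((1 + ζ 0 ^ 2 + ζ 1 ^ 2) ^ 2)⁻¹

theorem integrable_baseDensity : Integrable baseDensity := by
  have h := integrable_rpow_neg_one_add_norm_sq (E := E2) (μ := volume) (r := 4) (by simp; norm_num)
  refine h.congr (Eventually.of_forall fun ζ ↦ ?_)
  have : ‖ζ‖ ^ 2 = ζ 0 ^ 2 + ζ 1 ^ 2 := by
    rw [EuclideanSpace.norm_sq_eq, Fin.sum_univ_two]; simp
  simp only [baseDensity, this]
  rw [show (-4 / 2 : ℝ) = -((2 : ℕ) : ℝ) by norm_num, Real.rpow_neg (by positivity),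
    Real.rpow_natCast, add_assoc]

theorem integral_baseDensity_pos : 0 < ∫ ζ : E2, baseDensity ζ := by
  have hpos (ζ : E2) : 0 < baseDensity ζ := by unfold baseDensity; positivity
  rw [integral_pos_iff_support_of_nonneg (fun ζ ↦ (hpos ζ).le) integrable_baseDensity]
  have : Function.support baseDensity = univ := eq_univ_of_forall fun ζ ↦ (hpos ζ).ne'
  rw [this]
  simp

/-! ### The charge of the rotation of the fibres -/

section Flux

variable {l E : ℝ} {h : ℝ → BilinField (𝓡 3) S3}

theorem boundaryMetric_apply (h0 : h 0 = bergerMetric E) (x : S3) (u v : TangentSpace (𝓡 3) x) :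
    boundaryMetric l h x u v = l ^ 2 *
      (E * (inner ℝ (hopfRot x) (dcoe x u) * inner ℝ (hopfRot x) (dcoe x v))
        + (inner ℝ (dcoe x u) (dcoe x v)
          - inner ℝ (hopfRot x) (dcoe x u) * inner ℝ (hopfRot x) (dcoe x v))) := by
  change l ^ 2 * h 0 x u v = _
  rw [h0, bergerMetric_apply, ambForm_apply, inner_coe_self]
  simp

theorem boundaryMetric_symm (h0 : h 0 = bergerMetric E) (x : S3) (u v : TangentSpace (𝓡 3) x) :
    boundaryMetric l h x u v = boundaryMetric l h x v u := by
  rw [boundaryMetric_apply h0, boundaryMetric_apply h0, real_inner_comm (dcoe x v) (dcoe x u)]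
  ring

theorem boundaryMetric_pos (hl : 0 < l) (hE : 0 < E) (h0 : h 0 = bergerMetric E) (x : S3)
    (u : TangentSpace (𝓡 3) x) (hu : u ≠ 0) : 0 < boundaryMetric l h x u u := by
  change 0 < l ^ 2 * h 0 x u u
  rw [h0, bergerMetric_apply]
  exact mul_pos (by positivity) (ambForm_space_pos hE one_pos (inner_coe_self x) rfl
      fun h ↦ hu (injective_dcoe x (h.trans (map_zero _).symm)))

theorem boundaryMetric_hopfField (h0 : h 0 = bergerMetric E) (L : ℝ) (x : S3)
    (u : TangentSpace (𝓡 3) x) :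
    boundaryMetric l h x u (hopfField L x) =
      l ^ 2 * E / L * inner ℝ (hopfRot x) (dcoe x u) := by
  rw [boundaryMetric_apply h0, dcoe_hopfField, real_inner_smul_right, real_inner_smul_right,
    inner_hopfRot_hopfRot, inner_coe_self, real_inner_comm (hopfRot (x : E4)) (dcoe x u)]
  ring

theorem boundaryMetric_hopfField_self (hl : 0 < l) (hE : 0 < E) (h0 : h 0 = bergerMetric E)
    (x : S3) :
    boundaryMetric l h x (hopfField (l * Real.sqrt E) x) (hopfField (l * Real.sqrt E) x) = 1 := by
  rw [boundaryMetric_hopfField h0, dcoe_hopfField, real_inner_smul_right, inner_hopfRot_hopfRot,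
    inner_coe_self]
  have hs := Real.sqrt_pos.2 hE
  field_simp
  rw [Real.sq_sqrt hE.le]

/-- The vectors `a`, `b` and the rotation field are independent as soon as the projections of `a`
and `b` along the Hopf fibres are. -/
theorem linearIndependent_hopfField {L : ℝ} (hL : L ≠ 0) {x : S3} {a b : TangentSpace (𝓡 3) x}
    (hab : quotRe x (dcoe x a) * quotIm x (dcoe x b)
      - quotRe x (dcoe x b) * quotIm x (dcoe x a) ≠ 0) :
    LinearIndependent ℝ ![a, b, hopfField L x] := by
  rw [linearIndependent_three_iff]
  intro r s t hrst
  have h1 := congrArg (dcoe x) hrst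
  rw [map_add, map_add, map_smul, map_smul, map_smul, dcoe_hopfField, map_zero] at h1
  have hc (i : Fin 4) := congrArg (fun v : E4 ↦ v i) h1
  have hre : r * quotRe x (dcoe x a) + s * quotRe x (dcoe x b) = 0 := by
    have h0 := hc 0
    have h1 := hc 1
    have h2 := hc 2
    have h3 := hc 3
    simp [hopfRot] at h0 h1 h2 h3
    unfold quotRe
    linear_combination (x : E4) 2 * h0 - (x : E4) 3 * h1 - (x : E4) 0 * h2 + (x : E4) 1 * h3
  have him : r * quotIm x (dcoe x a) + s * quotIm x (dcoe x b) = 0 := by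
    have h0 := hc 0
    have h1 := hc 1
    have h2 := hc 2
    have h3 := hc 3
    simp [hopfRot] at h0 h1 h2 h3
    unfold quotIm
    linear_combination (x : E4) 3 * h0 + (x : E4) 2 * h1 - (x : E4) 0 * h3 - (x : E4) 1 * h2
  have hr : r = 0 := by
    have : r * (quotRe x (dcoe x a) * quotIm x (dcoe x b)
      - quotRe x (dcoe x b) * quotIm x (dcoe x a)) = 0 := by
      linear_combination quotIm x (dcoe x b) * hre - quotRe x (dcoe x b) * him
    exact (mul_eq_zero.1 this).resolve_right hab
  have hs : s = 0 := by
    have : s * (quotRe x (dcoe x a) * quotIm x (dcoe x b)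
      - quotRe x (dcoe x b) * quotIm x (dcoe x a)) = 0 := by
      linear_combination quotRe x (dcoe x a) * him - quotIm x (dcoe x a) * hre
    exact (mul_eq_zero.1 this).resolve_right hab
  refine ⟨hr, hs, ?_⟩
  rw [hr, hs, zero_smul, zero_smul, zero_add, zero_add] at h1
  have h2 := congrArg (fun v : E4 ↦ (inner ℝ (hopfRot (x : E4)) v : ℝ)) h1
  simp only [real_inner_smul_right, inner_hopfRot_hopfRot, inner_coe_self, inner_zero_right] at h2
  simpa [hL] using h2

/-- The flux density of the unit rotation field through a transverse surface is the area density of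
its projection along the Hopf fibres. -/
theorem flux_density (hl : 0 < l) (hE : 0 < E) (h0 : h 0 = bergerMetric E) {x : S3}
    {a b ν : TangentSpace (𝓡 3) x}
    (hli : LinearIndependent ℝ ![a, b, hopfField (l * Real.sqrt E) x])
    (ha : boundaryMetric l h x ν a = 0) (hb : boundaryMetric l h x ν b = 0)
    (h1 : boundaryMetric l h x ν ν = 1)
    (hK : 0 < boundaryMetric l h x ν (hopfField (l * Real.sqrt E) x)) :
    boundaryMetric l h x ν (hopfField (l * Real.sqrt E) x) *
      Real.sqrt (boundaryMetric l h x a a * boundaryMetric l h x b b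
        - boundaryMetric l h x a b ^ 2) =
      l ^ 2 * |quotRe x (dcoe x a) * quotIm x (dcoe x b)
        - quotRe x (dcoe x b) * quotIm x (dcoe x a)| := by
  have hfin : Module.finrank ℝ (TangentSpace (𝓡 3) x) = 3 := finrank_euclideanSpace_fin
  rw [normal_mul_area (boundaryMetric_symm h0 x) hfin hli ha hb h1 hK,
    boundaryMetric_hopfField_self hl hE h0, boundaryMetric_hopfField h0,
    boundaryMetric_hopfField h0, boundaryMetric_apply h0, boundaryMetric_apply h0,
    boundaryMetric_apply h0, inner_sub_theta (inner_coe_self x) (inner_dcoe x a),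
    inner_sub_theta (inner_coe_self x) (inner_dcoe x a),
    inner_sub_theta (inner_coe_self x) (inner_dcoe x b)]
  have hs := Real.sqrt_pos.2 hE
  have hs2 := Real.sq_sqrt hE.le
  set p : ℝ := inner ℝ (hopfRot x) (dcoe x a)
  set q : ℝ := inner ℝ (hopfRot x) (dcoe x b)
  have hκ : (l ^ 2 * E / (l * Real.sqrt E)) ^ 2 = l ^ 2 * E := by
    field_simp
    rw [hs2]
  set κ := l ^ 2 * E / (l * Real.sqrt E)
  refine Eq.trans ?_ (congrArg (· * _) (abs_of_nonneg (sq_nonneg l)))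
  rw [← abs_mul, ← Real.sqrt_sq_eq_abs]
  congr 1
  set ra := quotRe x (dcoe x a)
  set rb := quotRe x (dcoe x b)
  set ia := quotIm x (dcoe x a)
  set ib := quotIm x (dcoe x b)
  linear_combination (-(l ^ 2 * (E * (p * p) + (ra * ra + ia * ia))) * q ^ 2
    + 2 * (l ^ 2 * (E * (p * q) + (ra * rb + ia * ib))) * p * q
    - (l ^ 2 * (E * (q * q) + (rb * rb + ib * ib))) * p ^ 2) * hκ

variable {U : Set E2} {σ : E2 → S3} {ν : ∀ y : E2, TangentSpace (𝓡 3) (σ y)}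

theorem dcoe_coordVec {y : E2} (hσ : MDifferentiableAt 𝓘(ℝ, E2) (𝓡 3) σ y) (i : Fin 2) :
    dcoe (σ y) (coordVec σ y i) =
      fderiv ℝ (fun y ↦ (σ y : E4)) y (EuclideanSpace.single i 1) := by
  refine (dcoe_mfderiv hσ _).trans ?_
  rw [mfderiv_eq_fderiv]
  rfl

/-- The flux of the unit rotation field of the fibres through a slice is the area of the base. -/
theorem integral_flux (hl : 0 < l) (hE : 0 < E) (h0 : h 0 = bergerMetric E)
    (hS : IsSlice (boundaryMetric l h) (hopfField (l * Real.sqrt E)) (hopfFlow (l * Real.sqrt E))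
      U σ ν) :
    IntegrableOn (fun y ↦ boundaryMetric l h (σ y) (ν y) (hopfField (l * Real.sqrt E) (σ y)) *
      areaDensity (boundaryMetric l h) σ y) U ∧
    ∫ y in U, boundaryMetric l h (σ y) (ν y) (hopfField (l * Real.sqrt E) (σ y)) *
      areaDensity (boundaryMetric l h) σ y = l ^ 2 * ∫ ζ : E2, baseDensity ζ := by
  have hL : l * Real.sqrt E ≠ 0 := (mul_pos hl (Real.sqrt_pos.2 hE)).ne'
  set L := l * Real.sqrt E with hLdef
  have hmd (y : E2) (hy : y ∈ U) : MDifferentiableAt 𝓘(ℝ, E2) (𝓡 3) σ y :=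
    ((hS.smooth y hy).contMDiffAt (hS.isOpen.mem_nhds hy)).mdifferentiableAt (by simp)
  have hd (y : E2) (hy : y ∈ U) : DifferentiableAt ℝ (fun y ↦ (σ y : E4)) y :=
    mdifferentiableAt_iff_differentiableAt.1
      ((contMDiff_coe.mdifferentiable (by simp) (σ y)).comp y (hmd y hy))
  -- the fibre at infinity meets the slice at most once
  set V : Set E2 := U ∩ {y | sndSq (σ y : E4) ≠ 0} with hV
  have hVopen : IsOpen V := by
    have hc : ContinuousOn (fun y ↦ sndSq (σ y : E4)) U := by
      have : Continuous sndSq := by unfold sndSq; fun_prop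
      exact this.comp_continuousOn fun y hy ↦ (hd y hy).continuousAt.continuousWithinAt
    exact hc.isOpen_inter_preimage hS.isOpen isOpen_ne
  have hVU : V =ᵐ[volume] U := by
    have hsub : (U \ V).Subsingleton := by
      rintro y ⟨hy, hyV⟩ y' ⟨hy', hyV'⟩
      have e : sndSq (σ y : E4) = 0 := by by_contra h; exact hyV ⟨hy, h⟩
      have e' : sndSq (σ y' : E4) = 0 := by by_contra h; exact hyV' ⟨hy', h⟩
      obtain ⟨t, ht⟩ := exists_hopfFlow hL (Or.inl ⟨e, e'⟩)
      exact hS.once y hy y' hy' t ht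
    rw [ae_eq_set]
    refine ⟨?_, hsub.measure_zero _⟩
    rw [Set.sdiff_eq_empty.2 inter_subset_left, measure_empty]
  set f : E2 → E2 := fun y ↦ hopfQuot (σ y) with hf
  have hinj : InjOn f V := by
    rintro y ⟨hy, hn⟩ y' ⟨hy', hn'⟩ hyy
    obtain ⟨t, ht⟩ := exists_hopfFlow hL (Or.inr ⟨hn, hn', hyy⟩)
    exact hS.once y hy y' hy' t ht
  -- the projection misses at most the finitely many fibres that the slice misses
  have himage : f '' V =ᵐ[volume] (univ : Set E2) := by
    obtain ⟨F, hF, hcov⟩ := hS.covers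
    refine eventuallyEq_univ.2 ?_
    have hsub : (f '' V)ᶜ ⊆ (fun x : S3 ↦ hopfQuot x) '' F := by
      intro ζ hζ
      have hmem : hopfSection ζ ∈ Metric.sphere (0 : E4) 1 := by
        have := hopfSection_norm ζ
        rw [real_inner_self_eq_norm_sq] at this
        rw [mem_sphere_zero_iff_norm]
        nlinarith [norm_nonneg (hopfSection ζ)]
      by_contra hnot
      have hno : ∀ p ∈ F, ∀ t : ℝ, hopfFlow L t p ≠ (⟨hopfSection ζ, hmem⟩ : S3) := by
        intro p hp t ht
        refine hnot ⟨p, hp, ?_⟩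
        have := hopfQuot_hopfFlow L t p
        rw [ht] at this
        exact this.symm.trans (hopfQuot_hopfSection ζ)
      obtain ⟨y, hy, t, ht⟩ := hcov _ hno
      refine hζ ⟨y, ⟨hy, ?_⟩, ?_⟩
      · have := sndSq_hopfFlow L t (σ y)
        rw [ht] at this
        change sndSq (σ y : E4) ≠ 0
        rw [← this]
        change sndSq (hopfSection ζ) ≠ 0
        rw [sndSq_hopfSection]
        positivity
      · have := hopfQuot_hopfFlow L t (σ y)
        rw [ht] at this
        exact this.symm.trans (hopfQuot_hopfSection ζ)
    exact measure_mono_null hsub ((hF.image _).measure_zero _)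
  have hder : ∀ y ∈ V, HasFDerivWithinAt f (fderiv ℝ f y) V y := fun y hy ↦
    (det_fderiv_hopfQuot (hd y hy.1) hy.2).1.hasFDerivAt.hasFDerivWithinAt
  have hpt : ∀ y ∈ V, boundaryMetric l h (σ y) (ν y) (hopfField L (σ y)) *
      areaDensity (boundaryMetric l h) σ y =
        l ^ 2 * (|(fderiv ℝ f y).det| • baseDensity (f y)) := by
    intro y hy
    have e1 := flux_density hl hE h0 (hS.transverse y hy.1) (hS.normal y hy.1 0)
      (hS.normal y hy.1 1) (hS.unit y hy.1) (hS.direction y hy.1)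
    have e2 := (det_fderiv_hopfQuot (hd y hy.1) hy.2).2
    have e3 := one_add_hopfQuot (inner_coe_self (σ y)) hy.2
    rw [areaDensity]
    refine e1.trans ?_
    rw [dcoe_coordVec (hmd y hy.1), dcoe_coordVec (hmd y hy.1), ← e2, abs_mul,
      abs_of_nonneg (sq_nonneg (sndSq (σ y : E4))), baseDensity, e3, smul_eq_mul, inv_pow, inv_inv]
  have hint : IntegrableOn (fun y ↦ |(fderiv ℝ f y).det| • baseDensity (f y)) V :=
    (integrableOn_image_iff_integrableOn_abs_det_fderiv_smul volume hVopen.measurableSet hder hinj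
      baseDensity).1 integrable_baseDensity.integrableOn
  constructor
  · refine IntegrableOn.congr_set_ae ?_ hVU.symm
    exact IntegrableOn.congr_fun (hint.const_mul (l ^ 2)) (fun y hy ↦ (hpt y hy).symm)
      hVopen.measurableSet
  · rw [← setIntegral_congr_set hVU, setIntegral_congr_fun hVopen.measurableSet hpt,
      integral_const_mul, ← integral_image_eq_integral_abs_det_fderiv_smul volume
        hVopen.measurableSet hder hinj, setIntegral_congr_set himage, setIntegral_univ]

/-- The section `ζ ↦ (ζ, 1) / √(1 + |ζ|²)` of the Hopf fibration over the complement of a point is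
a slice. -/
theorem exists_slice (hl : 0 < l) (hE : 0 < E) (h0 : h 0 = bergerMetric E) {L : ℝ} (hL : L ≠ 0) :
    ∃ U σ ν, IsSlice (boundaryMetric l h) (hopfField L) (hopfFlow L) U σ ν := by
  have hmem (ζ : E2) : hopfSection ζ ∈ Metric.sphere (0 : E4) 1 := by
    have := hopfSection_norm ζ
    rw [real_inner_self_eq_norm_sq] at this
    rw [mem_sphere_zero_iff_norm]
    nlinarith [norm_nonneg (hopfSection ζ)]
  have hcd : ContDiff ℝ ∞ hopfSection := by
    have h1 : ContDiff ℝ ∞ fun y : E2 ↦ 1 + y 0 ^ 2 + y 1 ^ 2 := by fun_prop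
    have h2 : ContDiff ℝ ∞ fun y : E2 ↦ (!₂[y 0, y 1, 1, 0] : E4) := by
      refine contDiff_euclidean.2 fun i ↦ ?_
      fin_cases i <;> simp <;> fun_prop
    refine ContDiff.smul ((h1.sqrt fun y ↦ by positivity).inv fun y ↦ ?_) h2
    exact (Real.sqrt_pos.2 (by positivity)).ne'
  set σ : E2 → S3 := fun ζ ↦ ⟨hopfSection ζ, hmem ζ⟩ with hσ
  have hσs : ContMDiff 𝓘(ℝ, E2) (𝓡 3) ∞ σ := hcd.contMDiff.codRestrict_sphere hmem
  have hn (ζ : E2) : sndSq (σ ζ : E4) ≠ 0 := by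
    change sndSq (hopfSection ζ) ≠ 0
    rw [sndSq_hopfSection]
    positivity
  have hq (ζ : E2) : hopfQuot (σ ζ) = ζ := hopfQuot_hopfSection ζ
  have hli (y : E2) : LinearIndependent ℝ ![coordVec σ y 0, coordVec σ y 1, hopfField L (σ y)] := by
    refine linearIndependent_hopfField hL ?_
    have hmd := hσs.mdifferentiable (by simp) y
    have e := (det_fderiv_hopfQuot (s := fun y ↦ (σ y : E4)) (hcd.differentiable (by simp) y)
      (hn y)).2
    rw [dcoe_coordVec hmd, dcoe_coordVec hmd, ← e]
    have hid : (fun y ↦ hopfQuot (σ y : E4)) = id := funext hq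
    rw [hid, fderiv_id, det_eq_of_single]
    simp only [ContinuousLinearMap.id_apply]
    simp
    exact hn y
  choose ν hν using fun y ↦ exists_unit_normal (boundaryMetric_symm (l := l) h0 (σ y))
    (boundaryMetric_pos hl hE h0 (σ y)) (hli y)
  refine ⟨univ, σ, ν, isOpen_univ, hσs.contMDiffOn, fun y _ ↦ hli y, ?_, ?_, ?_,
    fun y _ ↦ (hν y).2.2.1, fun y _ ↦ (hν y).2.2.2⟩
  · intro y _ y' _ t ht
    have := hopfQuot_hopfFlow L t (σ y)
    rw [ht, hq, hq] at this
    exact this.symm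
  · have hp : (!₂[1, 0, 0, 0] : E4) ∈ Metric.sphere (0 : E4) 1 := by
      rw [mem_sphere_zero_iff_norm, EuclideanSpace.norm_eq]
      simp [Fin.sum_univ_four]
    refine ⟨{⟨!₂[1, 0, 0, 0], hp⟩}, finite_singleton _, fun x hx ↦ ?_⟩
    have hx0 : sndSq (x : E4) ≠ 0 := by
      intro h
      obtain ⟨t, ht⟩ := exists_hopfFlow (x := ⟨!₂[1, 0, 0, 0], hp⟩) (x' := x) hL
        (Or.inl ⟨by simp [sndSq], h⟩)
      exact hx _ rfl t ht
    obtain ⟨t, ht⟩ := exists_hopfFlow (x := σ (hopfQuot x)) (x' := x) hL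
      (Or.inr ⟨hn _, hx0, hq _⟩)
    exact ⟨hopfQuot x, trivial, t, ht⟩
  · intro y _ i
    fin_cases i
    exacts [(hν y).1, (hν y).2.1]

end Flux

/-! ### The mass -/

/-- The constant in the mass formula; the integral is the area of the sphere of radius `1 / 2`. -/
def massConstant (G : ℝ) : ℝ := 2 / (Real.pi * G) * ∫ ζ : E2, baseDensity ζ

theorem massConstant_pos {G : ℝ} (hG : 0 < G) : 0 < massConstant G :=
  mul_pos (by positivity) integral_baseDensity_pos

/-- In the direction of the rotation field, the stress-energy tensor is a constant multiple of the
boundary metric. -/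
theorem stressEnergy_hopfField {G l E : ℝ} (hl : 0 < l)
    (hE : E ∈ Ioo (2 / 3) ((2 + Real.sqrt 3) / 3)) {R : ℝ → ℝ}
    (h0 : R 0 = 0) (hRs : ContDiffAt ℝ ∞ R 0)
    (hR : ∀ᶠ s in 𝓝 0, HasDerivAt R (definingSpeed E (R s)) s) (L : ℝ) (x : S3)
    (u : TangentSpace (𝓡 3) x) :
    stressEnergy G l (collarFamily E R) x (hopfField L x) u =
      (E - 1) * Real.sqrt E / (Real.pi * G * l) *
        boundaryMetric l (collarFamily E R) x u (hopfField L x) := by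
  rw [stressEnergy, coeffThree_collarFamily hE h0 hRs hR,
    boundaryMetric_hopfField (collarFamily_zero h0), dcoe_hopfField, real_inner_smul_left,
    real_inner_smul_right, inner_hopfRot_hopfRot, inner_coe_self]
  field_simp
  ring

/-- The charge density is a constant multiple of the flux density of the rotation field, whose
integral over each slice is the area of the base. -/
theorem hasTaubNUTMass {G l E : ℝ} (hl : 0 < l)
    (hE : E ∈ Ioo (2 / 3) ((2 + Real.sqrt 3) / 3)) :
    HasTaubNUTMass G l E (massConstant G * (l / 2) * E ^ (1 / 2 : ℝ) * (E - 1)) := by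
  obtain ⟨ε, R, h0, hRs, hR, hC⟩ := exists_futureCollar hl hE
  have hE0 := parameter_pos hE
  have hz := collarFamily_zero (E := E) h0
  have hL : l * Real.sqrt E ≠ 0 := (mul_pos hl (Real.sqrt_pos.2 hE0)).ne'
  refine ⟨ε, collarMap R, collarFamily E R, hopfField (l * Real.sqrt E),
    hopfFlow (l * Real.sqrt E), hC, fun _ _ _ ↦ rfl, hz, isKilling_hopfFlow hz, fun _ _ ↦ rfl,
    boundaryMetric_hopfField_self hl hE0 hz, exists_slice hl hE0 hz hL, fun U σ ν hS ↦ ?_⟩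
  obtain ⟨h1, h2⟩ := integral_flux hl hE0 hz hS
  have hden : chargeDensity G l (collarFamily E R) (hopfField (l * Real.sqrt E)) σ ν =
      fun y ↦ (E - 1) * Real.sqrt E / (Real.pi * G * l) *
        (boundaryMetric l (collarFamily E R) (σ y) (ν y) (hopfField (l * Real.sqrt E) (σ y)) *
          areaDensity (boundaryMetric l (collarFamily E R)) σ y) := by
    funext y
    rw [chargeDensity, stressEnergy_hopfField hl hE h0 hRs hR, mul_assoc]
  rw [hden]
  refine ⟨h1.const_mul _, ?_⟩
  rw [integral_const_mul, h2, massConstant, ← Real.sqrt_eq_rpow]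
  field_simp

theorem HasTaubNUTMass.hasHolographicMass {G l E m : ℝ} (h : HasTaubNUTMass G l E m) :
    HasHolographicMass G l (taubNUT l E) partialTau m := by
  obtain ⟨ε, Ψ, h, K, φ, hC, -, -, hK, -, hu, hm⟩ := h
  refine ⟨S3, inferInstance, inferInstance, inferInstance, inferInstance, inferInstance, ε, Ψ, h,
    K, φ, hC, hK, fun x hx ↦ ?_, hm⟩
  have := hu x
  rw [hx, map_zero] at this
  exact zero_ne_one this

theorem one_mem_parameters : (1 : ℝ) ∈ Ioo (2 / 3) ((2 + Real.sqrt 3) / 3) := by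
  have := sqrt3_bounds.1
  constructor <;> linarith

theorem mass_pos {G l E : ℝ} (hG : 0 < G) (hl : 0 < l) (hE : 1 < E) :
    0 < massConstant G * (l / 2) * E ^ (1 / 2 : ℝ) * (E - 1) := by
  have h1 := massConstant_pos hG
  have h2 : 0 < E ^ (1 / 2 : ℝ) := Real.rpow_pos_of_pos (by linarith) _
  have h3 : 0 < E - 1 := by linarith
  positivity

theorem hasHolographicMass_deSitter {G l : ℝ} (hl : 0 < l) :
    HasHolographicMass G l (deSitterMetric l) partialTau 0 := by
  have h := (hasTaubNUTMass (G := G) hl one_mem_parameters).hasHolographicMass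
  rwa [taubNUT_one, sub_self, mul_zero] at h

/-- For `E = 1` the third order coefficient vanishes, so the stress-energy tensor does. -/
theorem exists_futureCollar_deSitter {l : ℝ} (hl : 0 < l) (G : ℝ) :
    ∃ (ε : ℝ) (Ψ : ℝ × S3 → ℝ × S3) (h : ℝ → BilinField (𝓡 3) S3),
      IsFutureCollar l (deSitterMetric l) partialTau ε Ψ h ∧ h 0 = roundMetric ∧
        ∀ (K : ∀ x : S3, TangentSpace (𝓡 3) x) (σ : E2 → S3)
          (ν : ∀ y : E2, TangentSpace (𝓡 3) (σ y)) (y : E2), chargeDensity G l h K σ ν y = 0 := by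
  obtain ⟨ε, R, h0, hRs, hR, hC⟩ := exists_futureCollar hl one_mem_parameters
  rw [taubNUT_one] at hC
  refine ⟨ε, collarMap R, collarFamily 1 R, hC, ?_, fun K σ ν y ↦ ?_⟩
  · rw [collarFamily_zero h0, roundMetric_eq_bergerMetric]
  · rw [chargeDensity, stressEnergy, coeffThree_collarFamily one_mem_parameters h0 hRs hR]
    ring

/-- The mass is continuous in `E`, negative at `E = 9 / 10` and positive at `E = 6 / 5`. -/
theorem exists_taubNUT_of_mass {G l : ℝ} (hG : 0 < G) (hl : 0 < l) :
    ∃ ε₀ : ℝ, 0 < ε₀ ∧ ∀ m ∈ Ioo (-ε₀) ε₀, ∃ E ∈ Ioo (2 / 3) ((2 + Real.sqrt 3) / 3),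
      massConstant G * (l / 2) * E ^ (1 / 2 : ℝ) * (E - 1) = m := by
  have hc := massConstant_pos hG
  set f : ℝ → ℝ := fun E ↦ massConstant G * (l / 2) * E ^ (1 / 2 : ℝ) * (E - 1) with hf
  have h1 : f (9 / 10) < 0 := by
    have : 0 < (9 / 10 : ℝ) ^ (1 / 2 : ℝ) := by positivity
    exact mul_neg_of_pos_of_neg (by positivity) (by norm_num)
  have h2 : 0 < f (6 / 5) := mass_pos hG hl (by norm_num)
  have hcont : Continuous f :=
    (continuous_const.mul (Real.continuous_rpow_const (by norm_num))).mul
      (continuous_id.sub continuous_const)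
  refine ⟨min (-f (9 / 10)) (f (6 / 5)), lt_min (neg_pos.2 h1) h2, fun m hm ↦ ?_⟩
  have hm' : m ∈ Icc (f (9 / 10)) (f (6 / 5)) :=
    ⟨by linarith [hm.1, min_le_left (-f (9 / 10)) (f (6 / 5))],
      by linarith [hm.2, min_le_right (-f (9 / 10)) (f (6 / 5))]⟩
  obtain ⟨E, hE, rfl⟩ := intermediate_value_Icc (by norm_num) hcont.continuousOn hm'
  -- `(2 + √3) / 3` is larger than `6 / 5` because `√3 > 1.6`
  have := sqrt3_bounds.1
  exact ⟨E, ⟨by linarith [hE.1], by linarith [hE.2]⟩, rfl⟩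

/-- The metric with `E = 11 / 10` has positive mass. -/
theorem not_maximalMassConjecture {G l : ℝ} (hG : 0 < G) (hl : 0 < l) :
    ¬ MaximalMassConjecture G l := by
  intro h
  have := sqrt3_bounds.1
  have hE : (11 / 10 : ℝ) ∈ Ioo (2 / 3) ((2 + Real.sqrt 3) / 3) := by constructor <;> linarith
  exact (mass_pos hG hl (E := 11 / 10) (by norm_num)).not_ge
    (h (ℝ × S3) _ _ (isDSpm_taubNUT hl hE) _ (hasTaubNUTMass hl hE).hasHolographicMass)

end DeSitter

end

theorem mainTheorem4 (G : ℝ) (hG : 0 < G) :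
    -- the range of the parameter
    ((∀ E : ℝ, (∀ τ, 0 < taubNUTPoly E τ) ↔ E ∈ Ioo (2 / 3) ((2 + Real.sqrt 3) / 3)) ∧
      (∀ E : ℝ, (∀ τ, 0 ≤ taubNUTPoly E τ) ↔ E ∈ Icc (2 / 3) ((2 + Real.sqrt 3) / 3))) ∧
    -- the metrics are complete, globally hyperbolic, and lie in `dS^±`
    (∀ l : ℝ, 0 < l → ∀ E ∈ Ioo (2 / 3) ((2 + Real.sqrt 3) / 3),
      IsGeodesicallyComplete I4 (taubNUT l E) ∧
      IsGloballyHyperbolic I4 (taubNUT l E) partialTau ∧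
      IsDSpm l (taubNUT l E) partialTau) ∧
    -- pure de Sitter space is the member `E = 1`, and all its conserved quantities vanish
    (∀ l : ℝ, 0 < l → taubNUT l 1 = deSitterMetric l ∧
      HasHolographicMass G l (deSitterMetric l) partialTau 0 ∧
      ∃ (ε : ℝ) (Ψ : ℝ × S3 → ℝ × S3) (h : ℝ → BilinField (𝓡 3) S3),
        IsFutureCollar l (deSitterMetric l) partialTau ε Ψ h ∧ h 0 = roundMetric ∧
        ∀ K φ, IsConformalKilling (boundaryMetric l h) K φ →
          ∀ U σ ν, IsSlice (boundaryMetric l h) K φ U σ ν →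
            IntegrableOn (chargeDensity G l h K σ ν) U ∧
              ∫ y in U, chargeDensity G l h K σ ν y = 0) ∧
    -- the mass formula, and the violation of the mass bound for `E > 1`
    (∃ c : ℝ, 0 < c ∧ ∀ l : ℝ, 0 < l → ∀ E ∈ Ioo (2 / 3) ((2 + Real.sqrt 3) / 3),
      HasTaubNUTMass G l E (c * (l / 2) * E ^ (1 / 2 : ℝ) * (E - 1)) ∧
      HasHolographicMass G l (taubNUT l E) partialTau
        (c * (l / 2) * E ^ (1 / 2 : ℝ) * (E - 1)) ∧
      (1 < E → 0 < c * (l / 2) * E ^ (1 / 2 : ℝ) * (E - 1))) ∧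
    -- the masses of the family fill an interval around the mass of pure de Sitter space
    (∀ l : ℝ, 0 < l → ∃ ε₀ : ℝ, 0 < ε₀ ∧ ∀ m ∈ Ioo (-ε₀) ε₀,
      ∃ E ∈ Ioo (2 / 3) ((2 + Real.sqrt 3) / 3),
        IsDSpm l (taubNUT l E) partialTau ∧ HasTaubNUTMass G l E m) ∧
    -- the maximal mass conjecture fails
    (∀ l : ℝ, 0 < l → ¬ MaximalMassConjecture G l) := by
  refine ⟨⟨taubNUTPoly_pos_iff, taubNUTPoly_nonneg_iff⟩, fun l hl E hE ↦
    ⟨isGeodesicallyComplete_taubNUT hl hE, isGloballyHyperbolic_taubNUT hl hE,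
      isDSpm_taubNUT hl hE⟩, fun l hl ↦ ⟨taubNUT_one l, hasHolographicMass_deSitter hl, ?_⟩,
    ⟨massConstant G, massConstant_pos hG, fun l hl E hE ↦ ⟨hasTaubNUTMass hl hE,
      (hasTaubNUTMass hl hE).hasHolographicMass, mass_pos hG hl⟩⟩, fun l hl ↦ ?_,
    fun l hl ↦ not_maximalMassConjecture hG hl⟩
  · obtain ⟨ε, Ψ, h, hC, h0, hz⟩ := exists_futureCollar_deSitter hl G
    refine ⟨ε, Ψ, h, hC, h0, fun K φ _ U σ ν _ ↦ ?_⟩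
    have hzero : chargeDensity G l h K σ ν = 0 := funext (hz K σ ν)
    rw [hzero]
    exact ⟨integrableOn_zero, by simp⟩
  · obtain ⟨ε₀, hε, h⟩ := exists_taubNUT_of_mass hG hl
    refine ⟨ε₀, hε, fun m hm ↦ ?_⟩
    obtain ⟨E, hE, rfl⟩ := h m hm
    exact ⟨E, hE, isDSpm_taubNUT hl hE, hasTaubNUTMass hl hE⟩
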